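/- **Notation.** Let $N\ge 1$ be an integer and $K\in\{0,1,2,\dots\}\cup\{\infty\}$. For $I=(i_1,\dots,i_N)\in\mathbb N^N$ put $|I|=\sum_n i_n$, $I!=\prod_n i_n!$. For a symmetric $N\times N$ matrix $B$, $B_I$ is the $|I|\times|I|$ matrix in which the $n$-th row and column of $B$ are repeated $i_n$ times, and $\mathrm{Haf}$ is the hafnian, $\mathrm{Haf}(M)=\frac1{m!\,2^m}\sum_{\sigma\in S_{2m}}\prod_{j=1}^m M_{\sigma(2j-1),\sigma(2j)}$ for $M$ of size $2m\times 2m$ (and $\mathrm{Haf}=1$ for the empty matrix). Let $\mathcal A=\prod_{0\le k\le K}\mathbb R_{\ge0}^{\{I:|I|=2k\}}$ (families $(a_I)$ of nonnegative coefficients, product topology), and let $\mathcal B$ be the set of symmetric $N\times N$ matrices with strictly positive entries and all eigenvalues in $(0,1)$. For $B\in\mathcal B$ let $b_{\min},b_{\max}$ be the smallest and largest entry and $d=\prod_j\sqrt{1-\lambda_j^2}$, where the $\lambda_j$ are the eigenvalues of $B$. Put $$\mu=\sum_{k=0}^K\sum_{|I|=2k}a_I\,\mathrm{Haf}(B_I)^2,\quad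 Q^{\rm GBS\text{-}I}=\frac1d\sum_{k=0}^K\sum_{|I|=2k}a_I^2\,I!\,\mathrm{Haf}(B_I)^2,\quad Q^{\rm MC}=\sum_{k_1,k_2=0}^K\ \sum_{|I|=2k_1,\,|J|=2k_2}a_Ia_J\,\mathrm{Haf}(B_{I+J})^2 ,$$ let $\mathcal A_B$ be the set of $(a_I)\in\mathcal A$ for which $\mu\ne0$ and $\mu,Q^{\rm GBS\text{-}I},Q^{\rm MC}$ are finite, and for $\epsilon,\delta\in(0,1)$ define the guaranteed sample sizes $$n^{\rm GBS\text{-}I}_{\mathrm{Haf}^2}=\frac{Q^{\rm GBS\text{-}I}-\mu^2}{\delta\epsilon^2\mu^2},\qquad n^{\rm MC}_{\mathrm{Haf}^2}=\frac{Q^{\rm MC}-\mu^2}{\delta\epsilon^2\mu^2}.$$ The problem space is $\mathcal P=\{((a_I),B): B\in\mathcal B,\ (a_I)\in\mathcal A_B\}\subseteq\mathcal A\times\mathcal B$ with the subspace topology. Let $\mathrm{Li}_{s,K}(z)=\sum_{k=1}^K z^k/k^s$, $f_{q,n}(z)=\sum_{k=1}^n\frac{k^q}{(2k)!}z^{2k}$,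 and $q^-=\min(q,0)$. For $k\ge1$ write $2k=Ns_k+r_k$ with integers $s_k\ge 0$ and $1\le r_k\le N$, put $m_k=(s_k!)^N(s_k+1)^{r_k}$ and $s_\infty=\infty$. Let $$G_{q,K,N}(z)=f_{q,\lfloor N/2\rfloor}(z)+2^{-q^-}(2\pi)^{\frac{N-1}2}N^{q-\frac12}e^{\frac N{12}}\,\mathrm{Li}_{0,N}\!\Big(\frac{2z}N\Big)\,\mathrm{Li}_{\frac12-\frac N2-q,\,s_K}\!\Big(\frac{z^N}{N^N}\Big),$$ $R_{q,K}(z)=2^{-q}\frac1{2\sqrt\pi}\mathrm{Li}_{\frac12-q,K}(z)$ if $q\ge0$ and $R_{q,K}(z)=\frac1{2\sqrt\pi}\mathrm{Li}_{\frac12-2q,K}(z)$ if $q<0$. For $\gamma_\alpha,\gamma_\beta>0$ and $q_\alpha,q_\beta\in\mathbb R$ let $$c_1=1+\tfrac1{\sqrt\pi}e^{\frac1{25}-\frac16}\mathrm{Li}_{\frac12-q_\alpha,K}(\gamma_\alpha b_{\min}^2),\qquad c_2=1+\tfrac1{\sqrt\pi}\mathrm{Li}_{\frac12-q_\beta,K}(\gamma_\beta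 b_{\max}^2).$$ For $s_1,s_2>0$ let $\mathcal B_{\alpha,\beta}$ be the set of $B\in\mathcal B$ such that $c_2^{-1}<c_1^{-1}$; $c_2^{-1}k^{q_\alpha}\gamma_\alpha^k<c_1^{-1}k^{q_\beta}\gamma_\beta^k$ for all integers $1\le k\le K$; $$\frac{s_1}{\epsilon^2\delta}\frac{c_1^{-2}}d\Big(1+\tfrac1{\sqrt\pi}G_{2q_\beta,K,N}(\gamma_\beta b_{\max})\Big)<\ln\!\Big(1+e^{\frac1{25}-\frac16}R_{q_\alpha,K}(4\gamma_\alpha b_{\min}^2)\Big)+2\ln(c_2^{-1})-\ln(\epsilon^2\delta+1)+\frac{s_1}{\epsilon^2\delta}-\ln(\max(s_2,1));$$ and, if $K=\infty$, also $4\gamma_\beta b_{\max}^2<1$ and $\gamma_\beta b_{\max}<N$. **Theorem.** Let $N\ge1$, $0<\epsilon,\delta<1$ and $s_1,s_2>0$. (1) Let $K\in\{0,1,\dots\}\cup\{\infty\}$, $\gamma_\alpha,\gamma_\beta>0$, $q_\alpha,q_\beta\in\mathbb R$, $B\in\mathcal B_{\alpha,\beta}$, and let $(a_I)\in\mathcal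 A$ satisfy: some $a_I\neq0$; $c_2^{-1}\mu<a_0<c_1^{-1}\mu$; and for all integers $1\le k\le K$ $$c_2^{-1}\mu\frac{k^{q_\alpha}\gamma_\alpha^k}{(2k)!}\le\sum_{|I|=2k}a_I\le c_1^{-1}\mu\frac{k^{q_\beta}\gamma_\beta^k}{(2k)!},\qquad \sum_{|I|=2k}a_I^2\,I!\le c_1^{-2}\mu^2\frac{k^{2q_\beta}\gamma_\beta^{2k}}{(2k)!^2}m_k .$$ Then $(a_I)\in\mathcal A_B$, so that both guaranteed sample sizes are well defined and finite, and $$s_2\exp\!\big(s_1\,n^{\rm GBS\text{-}I}_{\mathrm{Haf}^2}\big)<n^{\rm MC}_{\mathrm{Haf}^2}<\infty .$$ (2) There is $K_0$ such that for every $K$ with $K_0\le K\le\infty$ there are $\gamma_\alpha,\gamma_\beta>0$ and $q_\alpha,q_\beta\in\mathbb R$ and a nonempty subset of $\mathcal P$, open if $K<\infty$, all of whose points $((a_I),B)$ satisfy $B\in\mathcal B_{\alpha,\beta}$ and the conditions on $(a_I)$ in (1). -/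

import Mathlib

open scoped NNReal ENNReal BigOperators Nat

noncomputable section

namespace GBS

/-! ### Hafnians -/

/-- The hafnian of a matrix indexed by a finite type `ι`. An enumeration `e` of `ι` by
`0, …, 2m - 1` plays the role of the permutation `σ`; if the size of the matrix is odd there is no
such enumeration and the hafnian is `0`, and the hafnian of the empty matrix is `1`. -/
def hafnian {ι : Type*} [Fintype ι] [DecidableEq ι] (M : Matrix ι ι ℝ) : ℝ :=
  (1 / (((Fintype.card ι / 2)! : ℝ) * 2 ^ (Fintype.card ι / 2))) *
    ∑ e : Fin (2 * (Fintype.card ι / 2)) ≃ ι,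
      ∏ j : Fin (Fintype.card ι / 2),
        M (e ⟨2 * (j : ℕ), by omega⟩) (e ⟨2 * (j : ℕ) + 1, by omega⟩)

/-- The matrix `B_I`: the `n`-th row and the `n`-th column of `B` are repeated `I n` times. -/
def expand {N : ℕ} (B : Matrix (Fin N) (Fin N) ℝ) (I : Fin N → ℕ) :
    Matrix (Σ n : Fin N, Fin (I n)) (Σ n : Fin N, Fin (I n)) ℝ :=
  fun x y => B x.1 y.1

/-! ### Problem space -/

/-- Orders `k` with `0 ≤ k ≤ K`, where `K` may be infinite. -/
abbrev Level (K : ℕ∞) : Type := {k : ℕ // (k : ℕ∞) ≤ K}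

/-- The multi-indices `I ∈ ℕ^N` with `|I| = 2k`. -/
abbrev MultiIdx (N k : ℕ) : Type := {I // I ∈ Finset.Nat.antidiagonalTuple N (2 * k)}

/-- The space `𝒜` of nonnegative coefficients `a_I`, `|I| = 2k`, `0 ≤ k ≤ K`, with the product
topology. -/
abbrev CoeffSpace (N : ℕ) (K : ℕ∞) : Type := (k : Level K) → MultiIdx N k → ℝ≥0

/-- The set `ℬ` of symmetric matrices with strictly positive entries and with all eigenvalues
strictly between `0` and `1`. -/
def matSet (N : ℕ) : Set (Matrix (Fin N) (Fin N) ℝ) :=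
  {B | (∀ i j, 0 < B i j) ∧ B.transpose = B ∧ spectrum ℝ B ⊆ Set.Ioo 0 1}

/-- `ℬ` as a topological subspace of the space of matrices. -/
abbrev MatSpace (N : ℕ) : Type := matSet N

theorem MatSpace.isHermitian {N : ℕ} (B : MatSpace N) : B.1.IsHermitian :=
  (Matrix.conjTranspose_eq_transpose_of_trivial B.1).trans B.2.2.1

/-- The normalization constant `d = ∏_j √(1 - λ_j²)` of the GBS distribution. -/
def gbsConst {N : ℕ} (B : MatSpace N) : ℝ :=
  ∏ j, √(1 - B.isHermitian.eigenvalues j ^ 2)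

/-- The smallest entry of `B`. -/
def bmin {N : ℕ} (B : MatSpace N) : ℝ := ⨅ p : Fin N × Fin N, B.1 p.1 p.2

/-- The largest absolute value of an entry of `B`. -/
def bmax {N : ℕ} (B : MatSpace N) : ℝ := ⨆ p : Fin N × Fin N, |B.1 p.1 p.2|

/-- The constant coefficient `a_{(0, …, 0)}`. -/
def coeffZero {N : ℕ} {K : ℕ∞} (a : CoeffSpace N K) : ℝ :=
  a ⟨0, by simp⟩ ⟨0, by simp [Finset.Nat.mem_antidiagonalTuple]⟩

/-- `I! = i_1! ⋯ i_N!`. -/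
def multiFact {N : ℕ} (I : Fin N → ℕ) : ℕ := ∏ n, (I n)!

/-- `Haf(B_I)²` as an extended nonnegative real. -/
def hafSq {N : ℕ} (B : MatSpace N) (I : Fin N → ℕ) : ℝ≥0∞ :=
  ENNReal.ofReal (hafnian (expand B.1 I) ^ 2)

/-- `μ = ∑_{k ≤ K} ∑_{|I| = 2k} a_I Haf(B_I)²`. -/
def mu {N : ℕ} {K : ℕ∞} (B : MatSpace N) (a : CoeffSpace N K) : ℝ≥0∞ :=
  ∑' k : Level K, ∑ I : MultiIdx N k, (a k I : ℝ≥0∞) * hafSq B I.1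

/-- `∑_{k ≤ K} ∑_{|I| = 2k} a_I² I! Haf(B_I)²`. -/
def sqSum {N : ℕ} {K : ℕ∞} (B : MatSpace N) (a : CoeffSpace N K) : ℝ≥0∞ :=
  ∑' k : Level K, ∑ I : MultiIdx N k, (a k I : ℝ≥0∞) ^ 2 * (multiFact I.1 : ℝ≥0∞) * hafSq B I.1

/-- The second moment of the importance estimator from GBS samples, for one sample. -/
def QGBS {N : ℕ} {K : ℕ∞} (B : MatSpace N) (a : CoeffSpace N K) : ℝ≥0∞ :=
  ENNReal.ofReal (1 / gbsConst B) * sqSum B a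

/-- The second moment of the plain Monte Carlo estimator, for one sample:
`∑_{k₁, k₂ ≤ K} ∑_{|I| = 2k₁, |J| = 2k₂} a_I a_J Haf(B_{I+J})²`. -/
def QMC {N : ℕ} {K : ℕ∞} (B : MatSpace N) (a : CoeffSpace N K) : ℝ≥0∞ :=
  ∑' (k₁ : Level K) (k₂ : Level K), ∑ I : MultiIdx N k₁, ∑ J : MultiIdx N k₂,
    (a k₁ I : ℝ≥0∞) * (a k₂ J : ℝ≥0∞) * hafSq B (I.1 + J.1)

/-- The guaranteed sample size `(Q - μ²) / (δ ε² μ²)` (from Chebyshev's inequality) of an estimator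
of `μ` with second moment `Q`. -/
def sampleSize (ε δ : ℝ) (Q μ : ℝ≥0∞) : ℝ≥0∞ :=
  (Q - μ ^ 2) / (ENNReal.ofReal (δ * ε ^ 2) * μ ^ 2)

/-- `n^{GBS-I}`. -/
def nGBS {N : ℕ} {K : ℕ∞} (ε δ : ℝ) (B : MatSpace N) (a : CoeffSpace N K) : ℝ≥0∞ :=
  sampleSize ε δ (QGBS B a) (mu B a)

/-- `n^{MC}`. -/
def nMC {N : ℕ} {K : ℕ∞} (ε δ : ℝ) (B : MatSpace N) (a : CoeffSpace N K) : ℝ≥0∞ :=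
  sampleSize ε δ (QMC B a) (mu B a)

/-- The set `𝒜_B` of coefficients for which `μ ≠ 0` and `μ` and both second moments are finite, so
that the approximation problem and both guaranteed sample sizes are well defined. -/
def coeffSet {N : ℕ} {K : ℕ∞} (B : MatSpace N) : Set (CoeffSpace N K) :=
  {a | mu B a ≠ 0 ∧ mu B a < ∞ ∧ sqSum B a < ∞ ∧ QMC B a < ∞}

/-- The problem space `𝒫 ⊆ 𝒜 × ℬ`, with the subspace topology. -/
abbrev ProblemSpace (N : ℕ) (K : ℕ∞) : Type :=
  {x : CoeffSpace N K × MatSpace N // x.1 ∈ coeffSet x.2}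

/-! ### Auxiliary functions -/

/-- The truncated polylogarithm `Li_{s,K}(z) = ∑_{1 ≤ k ≤ K} z^k / k^s`. -/
def polyLog (s : ℝ) (K : ℕ∞) (z : ℝ) : ℝ :=
  ∑' k : {k : ℕ // 1 ≤ k ∧ (k : ℕ∞) ≤ K}, z ^ (k : ℕ) / ((k : ℕ) : ℝ) ^ s

/-- The integer `s_k` in `2k = N s_k + r_k`, `1 ≤ r_k ≤ N` (for `k ≥ 1`). -/
def blockQuot (N k : ℕ) : ℕ := (2 * k - 1) / N

/-- The integer `r_k` in `2k = N s_k + r_k`, `1 ≤ r_k ≤ N` (for `k ≥ 1`). -/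
def blockRem (N k : ℕ) : ℕ := 2 * k - N * blockQuot N k

/-- `m_k = (s_k!)^N (s_k + 1)^{r_k}`. -/
def minFact (N k : ℕ) : ℕ := (blockQuot N k)! ^ N * (blockQuot N k + 1) ^ blockRem N k

/-- `f_{q,n}(z) = ∑_{k=1}^n k^q z^{2k} / (2k)!`. -/
def fFun (q : ℝ) (n : ℕ) (z : ℝ) : ℝ :=
  ∑ k ∈ Finset.Icc 1 n, (k : ℝ) ^ q / ((2 * k)! : ℝ) * z ^ (2 * k)

/-- The function `G_{q,K,N}`; here `s_∞ = ∞`. -/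
def GFun (q : ℝ) (K : ℕ∞) (N : ℕ) (z : ℝ) : ℝ :=
  fFun q (N / 2) z +
    (2 : ℝ) ^ (-min q 0) * (2 * Real.pi) ^ (((N : ℝ) - 1) / 2) * (N : ℝ) ^ (q - 1 / 2) *
      Real.exp ((N : ℝ) / 12) * polyLog 0 N (2 * z / N) *
      polyLog (1 / 2 - (N : ℝ) / 2 - q) (ENat.map (blockQuot N) K) (z ^ N / (N : ℝ) ^ N)

/-- The function `R_{q,K}`. -/
def RFun (q : ℝ) (K : ℕ∞) (z : ℝ) : ℝ :=
  if 0 ≤ q then (2 : ℝ) ^ (-q) * (1 / (2 * √Real.pi)) * polyLog (1 / 2 - q) K z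
  else 1 / (2 * √Real.pi) * polyLog (1 / 2 - 2 * q) K z

/-- The constant `c₁`, with `q = q_α` and `γ = γ_α`. -/
def c₁ {N : ℕ} (K : ℕ∞) (q γ : ℝ) (B : MatSpace N) : ℝ :=
  1 + 1 / √Real.pi * Real.exp (1 / 25 - 1 / 6) * polyLog (1 / 2 - q) K (γ * bmin B ^ 2)

/-- The constant `c₂`, with `q = q_β` and `γ = γ_β`. -/
def c₂ {N : ℕ} (K : ℕ∞) (q γ : ℝ) (B : MatSpace N) : ℝ :=
  1 + 1 / √Real.pi * polyLog (1 / 2 - q) K (γ * bmax B ^ 2)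

/-- The set `ℬ_{α,β}` of admissible matrices. -/
def matSetαβ (N : ℕ) (K : ℕ∞) (ε δ s₁ s₂ γα γβ qα qβ : ℝ) : Set (MatSpace N) :=
  {B | (c₂ K qβ γβ B)⁻¹ < (c₁ K qα γα B)⁻¹ ∧
    (∀ k : ℕ, 1 ≤ k → (k : ℕ∞) ≤ K →
      (c₂ K qβ γβ B)⁻¹ * ((k : ℝ) ^ qα * γα ^ k) <
        (c₁ K qα γα B)⁻¹ * ((k : ℝ) ^ qβ * γβ ^ k)) ∧
    s₁ / (ε ^ 2 * δ) * ((c₁ K qα γα B)⁻¹ ^ 2 / gbsConst B) *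
        (1 + 1 / √Real.pi * GFun (2 * qβ) K N (γβ * bmax B)) <
      Real.log (1 + Real.exp (1 / 25 - 1 / 6) * RFun qα K (4 * γα * bmin B ^ 2)) +
        2 * Real.log (c₂ K qβ γβ B)⁻¹ - Real.log (ε ^ 2 * δ + 1) + s₁ / (ε ^ 2 * δ) -
        Real.log (max s₂ 1) ∧
    (K = ⊤ → 4 * γβ * bmax B ^ 2 < 1 ∧ γβ * bmax B < N)}

/-- The conditions on the coefficients `a_I`. Only the real value of `μ` enters; if the series of
`μ` diverged, this value would be `0` and the bounds on `a_0` would contradict each other. -/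
structure CoeffCond {N : ℕ} {K : ℕ∞} (γα γβ qα qβ : ℝ) (B : MatSpace N) (a : CoeffSpace N K) :
    Prop where
  exists_ne_zero : ∃ (k : Level K) (I : MultiIdx N k), a k I ≠ 0
  lt_coeffZero : (c₂ K qβ γβ B)⁻¹ * (mu B a).toReal < coeffZero a
  coeffZero_lt : coeffZero a < (c₁ K qα γα B)⁻¹ * (mu B a).toReal
  le_sum : ∀ k : Level K, 1 ≤ k.1 →
    (c₂ K qβ γβ B)⁻¹ * (mu B a).toReal * ((k.1 : ℝ) ^ qα * γα ^ k.1 / ((2 * k.1)! : ℝ)) ≤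
      ∑ I : MultiIdx N k, (a k I : ℝ)
  sum_le : ∀ k : Level K, 1 ≤ k.1 →
    ∑ I : MultiIdx N k, (a k I : ℝ) ≤
      (c₁ K qα γα B)⁻¹ * (mu B a).toReal * ((k.1 : ℝ) ^ qβ * γβ ^ k.1 / ((2 * k.1)! : ℝ))
  sum_sq_le : ∀ k : Level K, 1 ≤ k.1 →
    ∑ I : MultiIdx N k, (a k I : ℝ) ^ 2 * (multiFact I.1 : ℝ) ≤
      (c₁ K qα γα B)⁻¹ ^ 2 * (mu B a).toReal ^ 2 *
        ((k.1 : ℝ) ^ (2 * qβ) * γβ ^ (2 * k.1) / ((2 * k.1)! : ℝ) ^ 2) * (minFact N k.1 : ℝ)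

end GBS

end

namespace GBS

/-! ### Estimates for central binomial coefficients and factorials -/

/-! Since all entries are positive, a hafnian lies between those of the constant matrices with
entries `b_min` and `b_max`. The squared hafnian of a constant matrix `b` of size `2k` is `b^(2k)
(2k)! binom(2k,k) / 4^k`, and `binom(2k,k) / 4^k` has order `k^(-1/2)` with explicit constants
(`hafnian_sq_le`, `le_hafnian_sq`, `centralBinom_lt`, `exp_div_sqrt_lt_centralBinom`). So both
second moments are controlled by power series in one variable.

For Monte Carlo, the factor `(2n)!` at `n = k + l` meets the denominators `(2k)! (2l)!` of the two
coefficients. The resulting `binom(2n, 2k)` sum to `4^n / 2` over `k + l = n`, which produces a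
series in `4 γ_α b_min²` (`le_QMC`). For GBS-I there is no double sum: the hafnian restores only one
of the two factors `(2k)!` in the quadratic condition, and the remaining `m_k / (2k)!` decays like
`N^(-2k)` up to powers of `k` by Stirling. This gives the function `G` (`sqSum_le`). The logarithmic
condition on `B` compares these two bounds after exponentiation (`mul_exp_lt_of_log_lt`).

The comparison also needs `μ² ≤ Q^GBS` (`mu_sq_le_QGBS`). This is Cauchy–Schwarz with the weights
`Haf(B_I)² / I!`, whose sum is at most `1 / d`. At each order that sum is the squared norm of a
symmetric tensor, divided by `(2k)!`; orthogonal invariance reduces it to a diagonal matrix, where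
it becomes a coefficient of a product of series `∑ binom(2m,m) (λ²/4)^m = (1 - λ²)^(-1/2)`.

For existence, take `q_α = q_β = 1/2`, so that `R` is a multiple of a truncated geometric series.
With `4 γ b_min²` close enough to `1`, it exceeds any given bound once `K` is large, while the other
terms stay bounded uniformly in `K` and `B` (`mem_matSetαβ_of_entries`). The coefficients `k^q γ^k /
(2k)!`, placed on balanced multi-indices, satisfy all conditions strictly, and for finite `K`
finitely many strict continuous conditions define an open set. -/

theorem factorial_two_mul_eq (k : ℕ) :
    ((2 * k)! : ℝ) = k.centralBinom * ((k ! : ℝ) * k !) := by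
  rw [Nat.centralBinom]
  have := Nat.choose_mul_factorial_mul_factorial (show k ≤ 2 * k by omega)
  rw [show 2 * k - k = k by omega] at this
  rw [← this]; push_cast; ring

/-- Passing from `k` to `k + 1` multiplies the right side by `4(2k+1)² / (k(k+1))`, which is larger
than 16. -/
theorem sixteen_pow_le_centralBinom_sq {k : ℕ} (hk : 1 ≤ k) :
    (16 : ℝ) ^ k ≤ 4 * k * (k.centralBinom : ℝ) ^ 2 := by
  induction k, hk using Nat.le_induction with
  | base => norm_num [Nat.centralBinom, Nat.choose]
  | succ k hk ih =>
    have h : ((k : ℝ) + 1) * ((k + 1).centralBinom : ℝ) = 2 * (2 * k + 1) * k.centralBinom := by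
      exact_mod_cast Nat.succ_mul_centralBinom_succ k
    have hk0 : (0 : ℝ) < k := by exact_mod_cast hk
    have h2 : ((k + 1).centralBinom : ℝ) = 2 * (2 * k + 1) * k.centralBinom / (k + 1) := by
      field_simp; linarith
    rw [h2, pow_succ]
    push_cast
    have e : 4 * ((k : ℝ) + 1) * (2 * (2 * k + 1) * k.centralBinom / (k + 1)) ^ 2 =
        4 * k * (k.centralBinom : ℝ) ^ 2 * (4 * (2 * k + 1) ^ 2 / (k * (k + 1))) := by
      field_simp
      ring
    rw [e]
    refine mul_le_mul ih ?_ (by norm_num) (by positivity)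
    rw [le_div_iff₀ (by positivity)]
    nlinarith

theorem inv_two_mul_sqrt_le_centralBinom {k : ℕ} (hk : 1 ≤ k) :
    1 / 2 / √(k : ℝ) ≤ (k.centralBinom : ℝ) / 4 ^ k := by
  have hk0 : (0 : ℝ) < k := by exact_mod_cast hk
  have h := sixteen_pow_le_centralBinom_sq hk
  refine abs_le_of_sq_le_sq' ?_ (by positivity) |>.2
  rw [div_pow, div_pow _ _ 2, div_pow _ _ 2, Real.sq_sqrt hk0.le, ← pow_mul, mul_comm k 2, pow_mul,
    div_le_div_iff₀ hk0 (by positivity)]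
  norm_num
  linarith

/-- After squaring this reads `4 < π e^(19/75)`, which holds with little room. It lets the
elementary constant `1/2` replace the Stirling correction `e^(1/25-1/6)`. -/
theorem exp_div_sqrt_pi_lt_half : 1 / √Real.pi * Real.exp (1 / 25 - 1 / 6) < 1 / 2 := by
  have hpi := Real.pi_gt_d6
  have h1 : (1 : ℝ) + 19 / 75 + (19 / 75) ^ 2 / 2 ≤ Real.exp (19 / 75) :=
    Real.quadratic_le_exp_of_nonneg (by norm_num)
  refine abs_lt_of_sq_lt_sq' ?_ (by norm_num) |>.2
  rw [mul_pow, ← Real.exp_nat_mul, div_pow, Real.sq_sqrt Real.pi_pos.le]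
  have e : ((2 : ℕ) : ℝ) * (1 / 25 - 1 / 6) = -(19 / 75) := by norm_num
  rw [e, Real.exp_neg, ← div_eq_mul_inv, div_div, one_pow, div_lt_iff₀ (by positivity)]
  nlinarith

theorem exp_div_sqrt_lt_centralBinom {k : ℕ} (hk : 1 ≤ k) :
    1 / √Real.pi * Real.exp (1 / 25 - 1 / 6) / √(k : ℝ) < (k.centralBinom : ℝ) / 4 ^ k := by
  have hk0 : (0 : ℝ) < k := by exact_mod_cast hk
  refine lt_of_lt_of_le ?_ (inv_two_mul_sqrt_le_centralBinom hk)
  exact div_lt_div_of_pos_right exp_div_sqrt_pi_lt_half (by positivity)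

/-- The Wallis product equals `16^k / (binom(2k,k)² (2k+1))`. Its lower bound `(2k+1)/(2k+2) · π/2`
gives the claim through `4k(k+1) < (2k+1)²`. -/
theorem centralBinom_lt {k : ℕ} (hk : 1 ≤ k) :
    (k.centralBinom : ℝ) / 4 ^ k < 1 / √Real.pi / √(k : ℝ) := by
  have hk0 : (0 : ℝ) < k := by exact_mod_cast hk
  have hW := Real.Wallis.le_W k
  rw [Real.Wallis.W_eq_factorial_ratio] at hW
  have hcp : (0 : ℝ) < k.centralBinom := by exact_mod_cast Nat.centralBinom_pos k
  have hf : (0 : ℝ) < k ! := by exact_mod_cast Nat.factorial_pos k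
  rw [factorial_two_mul_eq] at hW
  have e : (2 : ℝ) ^ (4 * k) * (k ! : ℝ) ^ 4 / ((k.centralBinom * ((k ! : ℝ) * k !)) ^ 2 * (2 * k + 1))
      = 16 ^ k / ((k.centralBinom : ℝ) ^ 2 * (2 * k + 1)) := by
    rw [pow_mul]; norm_num; field_simp
  rw [e] at hW
  refine abs_lt_of_sq_lt_sq' ?_ (by positivity) |>.2
  rw [div_pow, div_pow, div_pow, Real.sq_sqrt hk0.le, Real.sq_sqrt Real.pi_pos.le, ← pow_mul,
    mul_comm k 2, pow_mul, div_div, one_pow, div_lt_div_iff₀ (by positivity) (by positivity)]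
  norm_num
  rw [div_mul_div_comm, div_le_div_iff₀ (by positivity) (by positivity)] at hW
  have hpi := Real.pi_pos
  have h3 : (k.centralBinom : ℝ) ^ 2 * (Real.pi * k) * ((2 * k + 1 : ℝ) ^ 2) <
      16 ^ k * (2 * k + 1 : ℝ) ^ 2 := by
    calc (k.centralBinom : ℝ) ^ 2 * (Real.pi * k) * ((2 * k + 1 : ℝ) ^ 2)
        = k * ((2 * k + 1) * Real.pi * ((k.centralBinom : ℝ) ^ 2 * (2 * k + 1))) := by ring
      _ ≤ k * (16 ^ k * ((2 * k + 2 : ℝ) * 2)) := by gcongr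
      _ = 16 ^ k * (4 * k * (k + 1 : ℝ)) := by ring
      _ < 16 ^ k * (2 * k + 1 : ℝ) ^ 2 := by gcongr; nlinarith
  exact lt_of_mul_lt_mul_right h3 (by positivity)

/-- This is the case `s = 1` of the Stirling upper bound; it amounts to `e^11 ≤ (2π)^6`. -/
theorem exp_one_le_sqrt_two_pi_mul : Real.exp 1 ≤ √(2 * Real.pi) * Real.exp (1 / 12) := by
  have hpi := Real.pi_gt_d6
  have he := Real.exp_one_lt_d9
  have e0 : Real.exp 1 = Real.exp (11 / 12) * Real.exp (1 / 12) := by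
    rw [← Real.exp_add]; norm_num
  rw [e0]
  refine mul_le_mul_of_nonneg_right ?_ (Real.exp_pos _).le
  refine Real.le_sqrt_of_sq_le ?_
  refine le_of_pow_le_pow_left₀ (n := 6) (by norm_num) (by positivity) ?_
  rw [← pow_mul, ← Real.exp_nat_mul]
  have e1 : ((2 * 6 : ℕ) : ℝ) * (11 / 12) = ((11 : ℕ) : ℝ) * 1 := by norm_num
  rw [e1, Real.exp_nat_mul]
  calc Real.exp 1 ^ 11 ≤ 2.7182818286 ^ 11 := by gcongr
    _ ≤ (2 * 3.141592) ^ 6 := by norm_num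
    _ ≤ _ := by gcongr

/-- The Stirling sequence decreases, so it never exceeds its first value `e / √2`. -/
theorem factorial_le_stirling {s : ℕ} (hs : 1 ≤ s) :
    (s ! : ℝ) ≤ √(2 * Real.pi * s) * (s / Real.exp 1) ^ s * Real.exp (1 / 12) := by
  have hs0 : (0 : ℝ) < s := by exact_mod_cast hs
  obtain ⟨n, rfl⟩ : ∃ n, s = n + 1 := ⟨s - 1, by omega⟩
  have h := Stirling.stirlingSeq'_antitone (Nat.zero_le n)
  simp only [Function.comp, Nat.succ_eq_add_one, zero_add, Stirling.stirlingSeq_one] at h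
  rw [Stirling.stirlingSeq, div_le_iff₀ (by positivity)] at h
  refine h.trans ?_
  rw [Real.sqrt_mul (by norm_num), Real.sqrt_mul (x := 2 * Real.pi) (by positivity)]
  have := exp_one_le_sqrt_two_pi_mul
  calc Real.exp 1 / √2 * (√2 * √((n + 1 : ℕ) : ℝ) * (((n + 1 : ℕ) : ℝ) / Real.exp 1) ^ (n + 1))
      = Real.exp 1 * (√((n + 1 : ℕ) : ℝ) * (((n + 1 : ℕ) : ℝ) / Real.exp 1) ^ (n + 1)) := by
        field_simp
    _ ≤ (√(2 * Real.pi) * Real.exp (1 / 12)) *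
          (√((n + 1 : ℕ) : ℝ) * (((n + 1 : ℕ) : ℝ) / Real.exp 1) ^ (n + 1)) := by gcongr
    _ = _ := by ring

/-- The partial sums of the generating function `∑ binom(2m, m) x^m = (1 - 4x)^{-1/2}`. -/
theorem sum_centralBinom_mul_pow_le (n : ℕ) {x : ℝ} (hx : 0 ≤ x) (hx4 : 4 * x < 1) :
    ∑ m ∈ Finset.range n, (m.centralBinom : ℝ) * x ^ m ≤ (√(1 - 4 * x))⁻¹ := by
  set S : ℝ → ℝ := fun y => ∑ m ∈ Finset.range n, (m.centralBinom : ℝ) * y ^ m with hS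
  set D : ℝ → ℝ := fun y => ∑ m ∈ Finset.range n, (m.centralBinom : ℝ) * (m * y ^ (m - 1)) with hD
  have hder : ∀ y, HasDerivAt S (D y) y := fun y => by
    apply HasDerivAt.fun_sum
    intro m _
    exact (hasDerivAt_pow m y).const_mul _
  -- The function `(1-4y)^(-1/2)` solves `(1-4y) S' = 2S`. Truncation leaves one defect term,
  -- nonpositive for `y ≥ 0`, so `S(y) √(1-4y)` decreases from its value at `0`, which is at most
  -- `1`.
  have hrel : ∀ y, (1 - 4 * y) * D y = 2 * S y - n * n.centralBinom * y ^ (n - 1) := by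
    intro y
    simp only [hS, hD]
    clear hder hS hD S D
    induction n with
    | zero => simp
    | succ n ih =>
      rw [Finset.sum_range_succ, Finset.sum_range_succ, mul_add, ih]
      have h : ((n : ℝ) + 1) * ((n + 1).centralBinom : ℝ) = 2 * (2 * n + 1) * n.centralBinom := by
        exact_mod_cast Nat.succ_mul_centralBinom_succ n
      push_cast
      rw [h]
      rcases n with _ | n
      · simp
      · simp only [Nat.add_sub_cancel, pow_succ]; push_cast; ring
  have hcont : ContinuousOn (fun y => S y * √(1 - 4 * y)) (Set.Icc 0 x) := by
    apply Continuous.continuousOn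
    have : Continuous S := by fun_prop
    fun_prop
  have hanti : AntitoneOn (fun y => S y * √(1 - 4 * y)) (Set.Icc 0 x) := by
    refine antitoneOn_of_deriv_nonpos (convex_Icc 0 x) hcont ?_ ?_
    all_goals
      rw [interior_Icc]
      intro y hy
      have hy1 : 0 < 1 - 4 * y := by linarith [hy.2]
      have hd : HasDerivAt (fun y => S y * √(1 - 4 * y))
          (D y * √(1 - 4 * y) + S y * (-4 / (2 * √(1 - 4 * y)))) y := by
        refine (hder y).mul ?_
        refine HasDerivAt.sqrt ?_ hy1.ne'
        simpa using ((hasDerivAt_id y).const_mul 4).const_sub 1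
    · exact hd.differentiableAt.differentiableWithinAt
    · rw [hd.deriv]
      have hs : 0 < √(1 - 4 * y) := Real.sqrt_pos.2 hy1
      have e : D y * √(1 - 4 * y) + S y * (-4 / (2 * √(1 - 4 * y)))
          = ((1 - 4 * y) * D y - 2 * S y) / √(1 - 4 * y) := by
        field_simp
        rw [Real.sq_sqrt hy1.le]; ring
      rw [e, hrel]
      apply div_nonpos_of_nonpos_of_nonneg _ hs.le
      have : 0 ≤ (n : ℝ) * n.centralBinom * y ^ (n - 1) := by
        have := hy.1.le
        positivity
      linarith
  have h0 := hanti (Set.left_mem_Icc.2 hx) (Set.right_mem_Icc.2 hx) hx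
  have hS0 : S 0 ≤ 1 := by
    simp only [hS]
    rcases n with _ | n
    · simp
    · rw [Finset.sum_range_succ']; simp
  simp only [mul_zero, sub_zero, Real.sqrt_one, mul_one] at h0
  rw [← one_div, le_div_iff₀ (Real.sqrt_pos.2 (by linarith))]
  exact h0.trans hS0

/-! ### Hafnians as sums over functions -/

noncomputable section

/-- The product `∏_j B (f (2j)) (f (2j+1))`. -/
def pairProd {ι : Type*} {k : ℕ} (B : Matrix ι ι ℝ) (f : Fin (2 * k) → ι) : ℝ :=
  ∏ j : Fin k, B (f ⟨2 * (j : ℕ), by omega⟩) (f ⟨2 * (j : ℕ) + 1, by omega⟩)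

/-- The hafnian of the matrix `B (f i) (f j)`, as a function of the index map `f`. -/
def hafFun {ι : Type*} {k : ℕ} (B : Matrix ι ι ℝ) (f : Fin (2 * k) → ι) : ℝ :=
  (1 / ((k ! : ℝ) * 2 ^ k)) * ∑ σ : Equiv.Perm (Fin (2 * k)), pairProd B (f ∘ σ)

/-- The number of times each value is taken by `f`. -/
def counts {m N : ℕ} (f : Fin m → Fin N) (n : Fin N) : ℕ := Fintype.card {i // f i = n}

/-- Halving `Fin (2 * k) → Fin k`. -/
def half {k : ℕ} (i : Fin (2 * k)) : Fin k := ⟨(i : ℕ) / 2, by omega⟩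

end

theorem hafnian_eq {ι : Type*} [Fintype ι] [DecidableEq ι] (M : Matrix ι ι ℝ) {k : ℕ}
    (h : Fintype.card ι = 2 * k) :
    hafnian M = (1 / ((k ! : ℝ) * 2 ^ k)) * ∑ e : Fin (2 * k) ≃ ι, pairProd M e := by
  obtain rfl : k = Fintype.card ι / 2 := by omega
  rfl

theorem card_sigma_fin {N : ℕ} (I : Fin N → ℕ) :
    Fintype.card (Σ n : Fin N, Fin (I n)) = ∑ n, I n := by simp

theorem hafnian_expand_eq {N k : ℕ} (B : Matrix (Fin N) (Fin N) ℝ) (I : Fin N → ℕ)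
    (e₀ : Fin (2 * k) ≃ Σ n : Fin N, Fin (I n)) :
    hafnian (expand B I) = hafFun B (Sigma.fst ∘ e₀) := by
  rw [hafnian_eq _ (k := k) (by rw [← Fintype.card_congr e₀, Fintype.card_fin]), hafFun]
  congr 1
  refine (Fintype.sum_equiv (Equiv.equivCongr (Equiv.refl _) e₀) _ _ fun σ => ?_).symm
  rfl

theorem exists_equiv_of_counts {m N : ℕ} {f : Fin m → Fin N} {I : Fin N → ℕ} (h : counts f = I) :
    ∃ e : Fin m ≃ Σ n : Fin N, Fin (I n), Sigma.fst ∘ e = f := by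
  refine ⟨(Equiv.sigmaFiberEquiv f).symm.trans
    (Equiv.sigmaCongrRight fun n => Fintype.equivFinOfCardEq (congrFun h n)), ?_⟩
  funext i
  rfl

theorem counts_fst_comp {m N : ℕ} {I : Fin N → ℕ} (e : Fin m ≃ Σ n : Fin N, Fin (I n)) :
    counts (Sigma.fst ∘ e) = I := by
  funext n
  have h1 : Fintype.card {i // (Sigma.fst ∘ e) i = n} =
      Fintype.card {x : Σ n : Fin N, Fin (I n) // x.1 = n} :=
    Fintype.card_congr (e.subtypeEquiv fun i => Iff.rfl)
  rw [counts, h1, Fintype.card_congr (Equiv.sigmaSubtype n), Fintype.card_fin]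

theorem sum_counts {m N : ℕ} (f : Fin m → Fin N) : ∑ n, counts f n = m := by
  have := Fintype.card_congr (Equiv.sigmaFiberEquiv f)
  rw [Fintype.card_sigma, Fintype.card_fin] at this
  exact this

/-- The enumerations lying over `f` form a torsor under the permutations that fix `f`, a group of
order `∏ (fibre size)!`. -/
theorem card_equiv_fst_comp_eq {m N : ℕ} {I : Fin N → ℕ} {f : Fin m → Fin N} (h : counts f = I) :
    (Finset.univ.filter fun e : Fin m ≃ Σ n : Fin N, Fin (I n) => Sigma.fst ∘ e = f).card =
      multiFact I := by
  subst h
  obtain ⟨e₁, he₁⟩ := exists_equiv_of_counts (f := f) rfl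
  rw [← Fintype.card_subtype]
  refine Eq.trans ?_ (DomMulAct.stabilizer_card f)
  refine (Fintype.card_congr (Equiv.subtypeEquiv
    (Equiv.equivCongr (Equiv.refl (Fin m)) e₁) fun σ => ?_)).symm
  have : Sigma.fst ∘ ⇑((Equiv.equivCongr (Equiv.refl (Fin m)) e₁) σ) = f ∘ σ := by
    conv_rhs => rw [← he₁]
    rfl
  rw [this]

/-- Summing over enumerations of the blocks is summing over functions with given fibre sizes. -/
theorem sum_equiv_fst_comp {m N : ℕ} (I : Fin N → ℕ) (F : (Fin m → Fin N) → ℝ) :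
    ∑ e : Fin m ≃ Σ n : Fin N, Fin (I n), F (Sigma.fst ∘ e) =
      multiFact I * ∑ f with counts f = I, F f := by
  rw [← Finset.sum_fiberwise_of_maps_to (t := Finset.univ.filter fun f : Fin m → Fin N => counts f = I)
    (g := fun e : Fin m ≃ Σ n : Fin N, Fin (I n) => (Sigma.fst ∘ e : Fin m → Fin N))
    (fun e _ => by simp [counts_fst_comp]), Finset.mul_sum]
  refine Finset.sum_congr rfl fun f hf => ?_
  rw [← card_equiv_fst_comp_eq (Finset.mem_filter.1 hf).2, ← nsmul_eq_mul, ← Finset.sum_const]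
  exact Finset.sum_congr rfl fun e he => by rw [(Finset.mem_filter.1 he).2]

theorem card_equiv_sigma {m N : ℕ} {I : Fin N → ℕ} (h : ∑ n, I n = m) :
    Fintype.card (Fin m ≃ Σ n : Fin N, Fin (I n)) = m ! := by
  rw [Fintype.card_equiv (Fintype.equivOfCardEq (by rw [card_sigma_fin, h, Fintype.card_fin])),
    Fintype.card_fin]

theorem multiFact_pos {N : ℕ} (I : Fin N → ℕ) : 0 < multiFact I :=
  Finset.prod_pos fun _ _ => Nat.factorial_pos _

/-- A sum over functions whose summands depend only on fibre sizes. -/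
theorem sum_comp_counts {m N : ℕ} (G : (Fin N → ℕ) → ℝ) :
    ∑ f : Fin m → Fin N, G (counts f) =
      ∑ I ∈ Finset.Nat.antidiagonalTuple N m, (m ! : ℝ) / multiFact I * G I := by
  rw [← Finset.sum_fiberwise_of_maps_to (s := Finset.univ) (t := Finset.Nat.antidiagonalTuple N m)
    (g := fun f : Fin m → Fin N => counts f)
    (fun f _ => Finset.Nat.mem_antidiagonalTuple.2 (sum_counts f))]
  refine Finset.sum_congr rfl fun I hI => ?_
  have h := sum_equiv_fst_comp (m := m) I (fun _ => (1 : ℝ))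
  simp only [Finset.sum_const, Finset.card_univ, nsmul_eq_mul, mul_one,
    card_equiv_sigma (Finset.Nat.mem_antidiagonalTuple.1 hI)] at h
  have hpos : (0 : ℝ) < multiFact I := by exact_mod_cast multiFact_pos I
  rw [Finset.sum_congr rfl (g := fun _ => G I) (fun f hf => by rw [(Finset.mem_filter.1 hf).2]),
    Finset.sum_const, nsmul_eq_mul, h]
  field_simp

theorem hafFun_eq_of_counts {N k : ℕ} (B : Matrix (Fin N) (Fin N) ℝ) (f : Fin (2 * k) → Fin N) :
    hafFun B f = hafnian (expand B (counts f)) := by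
  obtain ⟨e, he⟩ := exists_equiv_of_counts (f := f) rfl
  rw [hafnian_expand_eq B _ e, he]

/-- A multi-index `I` is the fibre count of `(2k)! / I!` index functions. So the weight `1 / I!` is
what turns the sum into the squared norm of the tensor `f ↦ hafFun B f`, to which orthogonal
invariance applies. -/
theorem sum_hafFun_sq {N k : ℕ} (B : Matrix (Fin N) (Fin N) ℝ) :
    ∑ I ∈ Finset.Nat.antidiagonalTuple N (2 * k), hafnian (expand B I) ^ 2 / multiFact I =
      (1 / ((2 * k)! : ℝ)) * ∑ f : Fin (2 * k) → Fin N, hafFun B f ^ 2 := by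
  simp_rw [hafFun_eq_of_counts]
  rw [sum_comp_counts (fun I => hafnian (expand B I) ^ 2), Finset.mul_sum]
  refine Finset.sum_congr rfl fun I _ => ?_
  have : ((2 * k)! : ℝ) ≠ 0 := by exact_mod_cast (Nat.factorial_pos _).ne'
  field_simp

theorem hafnian_expand_eq_sum {N k : ℕ} (B : Matrix (Fin N) (Fin N) ℝ) {I : Fin N → ℕ}
    (h : ∑ n, I n = 2 * k) :
    hafnian (expand B I) = multiFact I / ((k ! : ℝ) * 2 ^ k) *
      ∑ f : Fin (2 * k) → Fin N with counts f = I, pairProd B f := by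
  rw [hafnian_eq _ (by rw [card_sigma_fin, h])]
  have := sum_equiv_fst_comp (m := 2 * k) I (pairProd B)
  rw [one_div_mul_eq_div, div_mul_eq_mul_div]
  exact congrArg (· / ((k ! : ℝ) * 2 ^ k)) this

/-! ### Rotation to the eigenbasis -/

theorem prod_fin_two_mul {k : ℕ} (F : Fin (2 * k) → ℝ) :
    ∏ i, F i = ∏ j : Fin k, F ⟨2 * (j : ℕ), by omega⟩ * F ⟨2 * (j : ℕ) + 1, by omega⟩ := by
  rw [← Fintype.prod_equiv (finProdFinEquiv.trans (finCongr (mul_comm k 2)))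
    (fun x => F (finCongr (mul_comm k 2) (finProdFinEquiv x))) F (fun _ => rfl),
    Fintype.prod_prod_type]
  refine Finset.prod_congr rfl fun j _ => ?_
  rw [Fin.prod_univ_two]
  congr 2 <;> ext <;> simp [finProdFinEquiv]; ring

theorem pairProd_diagonal_comp_half {N k : ℕ} (l : Fin N → ℝ) (h : Fin k → Fin N) :
    pairProd (Matrix.diagonal l) (h ∘ half) = ∏ j, l (h j) := by
  refine Finset.prod_congr rfl fun j _ => ?_
  have h1 : half (⟨2 * (j : ℕ), by omega⟩ : Fin (2 * k)) = j := by ext; simp [half]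
  have h2 : half (⟨2 * (j : ℕ) + 1, by omega⟩ : Fin (2 * k)) = j := by
    ext; simp only [half]; omega
  simp [h1, h2]

theorem half_surjective {k : ℕ} : Function.Surjective (half (k := k)) := fun j =>
  ⟨⟨2 * (j : ℕ), by omega⟩, by ext; simp [half]⟩

theorem eq_comp_half_of_pairProd_ne_zero {N k : ℕ} {l : Fin N → ℝ} {g : Fin (2 * k) → Fin N}
    (h : pairProd (Matrix.diagonal l) g ≠ 0) : ∃ h' : Fin k → Fin N, h' ∘ half = g := by
  refine ⟨fun j => g ⟨2 * (j : ℕ), by omega⟩, ?_⟩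
  funext i
  have hj := Finset.prod_ne_zero_iff.1 h (half i) (Finset.mem_univ _)
  have he : g ⟨2 * (half i : ℕ), by omega⟩ = g ⟨2 * (half i : ℕ) + 1, by omega⟩ := by
    by_contra hne
    exact hj (Matrix.diagonal_apply_ne _ hne)
  simp only [Function.comp]
  rcases Nat.mod_two_eq_zero_or_one i with h0 | h0
  · congr 1; ext; simp only [half]; omega
  · rw [he]; congr 1; ext; simp only [half]; omega

/-- For a diagonal matrix the product vanishes unless `g` is constant on every pair `{2j, 2j+1}`,
that is, unless `g` factors through `half`. -/
theorem sum_pairProd_diagonal {N k : ℕ} (l : Fin N → ℝ) (X : (Fin (2 * k) → Fin N) → ℝ) :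
    ∑ g : Fin (2 * k) → Fin N, pairProd (Matrix.diagonal l) g * X g =
      ∑ h : Fin k → Fin N, (∏ j, l (h j)) * X (h ∘ half) := by
  refine (Finset.sum_of_injOn (fun h : Fin k → Fin N => h ∘ half) ?_ (by simp) ?_ ?_).symm
  · exact (half_surjective.injective_comp_right).injOn
  · intro g _ hg
    by_contra hne
    obtain ⟨h', rfl⟩ := eq_comp_half_of_pairProd_ne_zero (left_ne_zero_of_mul hne)
    exact hg ⟨h', by simp, rfl⟩
  · intro h _
    rw [pairProd_diagonal_comp_half]

/-- Expanding the product of the spectral sums picks one eigenvalue index per pair, hence an index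
function of the form `h ∘ half`. -/
theorem pairProd_rotate {N k : ℕ} {B U : Matrix (Fin N) (Fin N) ℝ} {l : Fin N → ℝ}
    (hB : ∀ a b, B a b = ∑ c, l c * (U a c * U b c)) (f : Fin (2 * k) → Fin N) :
    pairProd B f =
      ∑ g : Fin (2 * k) → Fin N, pairProd (Matrix.diagonal l) g * ∏ i, U (f i) (g i) := by
  rw [sum_pairProd_diagonal, pairProd]
  simp_rw [hB]
  rw [Finset.prod_univ_sum, Fintype.piFinset_univ]
  refine Finset.sum_congr rfl fun h _ => ?_
  rw [Finset.prod_mul_distrib, prod_fin_two_mul]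
  congr 1
  refine Finset.prod_congr rfl fun j _ => ?_
  have h1 : half (⟨2 * (j : ℕ), by omega⟩ : Fin (2 * k)) = j := by ext; simp [half]
  have h2 : half (⟨2 * (j : ℕ) + 1, by omega⟩ : Fin (2 * k)) = j := by
    ext; simp only [half]; omega
  simp [h1, h2]

/-- Symmetrization commutes with the tensor power of `U`: permuting `f` and `g` together does not
change `∏ i, U (f i) (g i)`. -/
theorem hafFun_rotate {N k : ℕ} {B U : Matrix (Fin N) (Fin N) ℝ} {l : Fin N → ℝ}
    (hB : ∀ a b, B a b = ∑ c, l c * (U a c * U b c)) (f : Fin (2 * k) → Fin N) :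
    hafFun B f =
      ∑ g : Fin (2 * k) → Fin N, hafFun (Matrix.diagonal l) g * ∏ i, U (f i) (g i) := by
  have h1 : ∀ σ : Equiv.Perm (Fin (2 * k)), pairProd B (f ∘ σ) =
      ∑ g : Fin (2 * k) → Fin N, pairProd (Matrix.diagonal l) (g ∘ σ) * ∏ i, U (f i) (g i) := by
    intro σ
    rw [pairProd_rotate hB]
    refine (Fintype.sum_equiv (Equiv.arrowCongr σ.symm (Equiv.refl (Fin N))) _ _ fun g => ?_).symm
    have : ((Equiv.arrowCongr σ.symm (Equiv.refl (Fin N))) g : Fin (2 * k) → Fin N) = g ∘ σ := rfl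
    rw [this]
    congr 1
    exact (Equiv.prod_comp σ fun i => U (f i) (g i)).symm
  unfold hafFun
  simp_rw [h1]
  rw [Finset.sum_comm, Finset.mul_sum]
  refine Finset.sum_congr rfl fun g _ => ?_
  rw [← Finset.sum_mul, mul_assoc]

theorem sum_hafFun_sq_rotate {N k : ℕ} {B U : Matrix (Fin N) (Fin N) ℝ} {l : Fin N → ℝ}
    (hB : ∀ a b, B a b = ∑ c, l c * (U a c * U b c))
    (hU : ∀ a b, ∑ c, U c a * U c b = if a = b then 1 else 0) :
    ∑ f : Fin (2 * k) → Fin N, hafFun B f ^ 2 =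
      ∑ g : Fin (2 * k) → Fin N, hafFun (Matrix.diagonal l) g ^ 2 := by
  -- The tensor power of an orthogonal matrix is orthogonal, because the sum over `f` factors over
  -- positions.
  have hK : ∀ g g' : Fin (2 * k) → Fin N,
      ∑ f : Fin (2 * k) → Fin N, (∏ i, U (f i) (g i)) * (∏ i, U (f i) (g' i)) =
        if g = g' then 1 else 0 := by
    intro g g'
    simp_rw [← Finset.prod_mul_distrib]
    rw [← Fintype.piFinset_univ, ← Finset.prod_univ_sum (fun _ => Finset.univ)
      (fun i a => U a (g i) * U a (g' i))]
    simp_rw [hU, Finset.prod_ite_zero, funext_iff]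
    simp
  simp_rw [hafFun_rotate hB, sq, Finset.sum_mul_sum]
  rw [Finset.sum_comm]
  refine Finset.sum_congr rfl fun g _ => ?_
  rw [Finset.sum_comm]
  have : ∀ g' : Fin (2 * k) → Fin N, ∑ f : Fin (2 * k) → Fin N,
      hafFun (Matrix.diagonal l) g * (∏ i, U (f i) (g i)) *
        (hafFun (Matrix.diagonal l) g' * ∏ i, U (f i) (g' i)) =
      hafFun (Matrix.diagonal l) g * hafFun (Matrix.diagonal l) g' * if g = g' then 1 else 0 := by
    intro g'
    rw [← hK, Finset.mul_sum]
    exact Finset.sum_congr rfl fun f _ => by ring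
  simp [this]

/-! ### Hafnians of diagonal matrices -/

theorem counts_comp_half {N k : ℕ} (h : Fin k → Fin N) :
    counts (h ∘ half) = fun n => 2 * counts h n := by
  funext n
  unfold counts
  simp only [Fintype.card_subtype, Finset.card_filter]
  have hs : ∀ F : Fin (2 * k) → ℕ, ∑ i, F i =
      ∑ j : Fin k, (F ⟨2 * (j : ℕ), by omega⟩ + F ⟨2 * (j : ℕ) + 1, by omega⟩) := by
    intro F
    rw [← Fintype.sum_equiv (finProdFinEquiv.trans (finCongr (mul_comm k 2)))
      (fun x => F (finCongr (mul_comm k 2) (finProdFinEquiv x))) F (fun _ => rfl),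
      Fintype.sum_prod_type]
    refine Finset.sum_congr rfl fun j _ => ?_
    rw [Fin.sum_univ_two]
    congr 2 <;> ext <;> simp [finProdFinEquiv]; ring
  rw [hs, Finset.mul_sum]
  refine Finset.sum_congr rfl fun j _ => ?_
  have h1 : half (⟨2 * (j : ℕ), by omega⟩ : Fin (2 * k)) = j := by ext; simp [half]
  have h2 : half (⟨2 * (j : ℕ) + 1, by omega⟩ : Fin (2 * k)) = j := by
    ext; simp only [half]; omega
  simp only [Function.comp, h1, h2]
  ring

theorem prod_comp_eq_prod_pow_counts {m N : ℕ} (l : Fin N → ℝ) (h : Fin m → Fin N) :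
    ∏ j, l (h j) = ∏ n, l n ^ counts h n := by
  rw [← Finset.prod_fiberwise Finset.univ h]
  refine Finset.prod_congr rfl fun n _ => ?_
  rw [counts, Fintype.card_subtype, ← Finset.prod_const]
  exact Finset.prod_congr rfl fun j hj => by rw [(Finset.mem_filter.1 hj).2]

theorem sum_counts_eq_pairProd_diagonal {N k : ℕ} (l : Fin N → ℝ) {m : Fin N → ℕ}
    (hm : ∑ n, m n = k) :
    ∑ f : Fin (2 * k) → Fin N with counts f = (fun n => 2 * m n), pairProd (Matrix.diagonal l) f =
      (k ! : ℝ) / multiFact m * ∏ n, l n ^ m n := by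
  rw [Finset.sum_filter]
  have := sum_pairProd_diagonal (k := k) l (fun f => if counts f = (fun n => 2 * m n) then 1 else 0)
  simp only [mul_ite, mul_one, mul_zero] at this
  rw [this]
  have hiff : ∀ h : Fin k → Fin N, counts (h ∘ half) = (fun n => 2 * m n) ↔ counts h = m := by
    intro h
    rw [counts_comp_half, funext_iff, funext_iff]
    refine forall_congr' fun n => ?_
    omega
  simp_rw [hiff, prod_comp_eq_prod_pow_counts]
  rw [sum_comp_counts (fun I => if I = m then ∏ n, l n ^ I n else 0)]
  simp only [mul_ite, mul_zero]
  rw [Finset.sum_ite_eq' , if_pos (Finset.Nat.mem_antidiagonalTuple.2 hm)]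

theorem sum_hafFun_diagonal_sq {N k : ℕ} (l : Fin N → ℝ) :
    (1 / ((2 * k)! : ℝ)) * ∑ g : Fin (2 * k) → Fin N, hafFun (Matrix.diagonal l) g ^ 2 =
      ∑ m ∈ Finset.Nat.antidiagonalTuple N k,
        ∏ n, ((m n).centralBinom : ℝ) * (l n ^ 2 / 4) ^ m n := by
  have hinv : ∀ (σ : Equiv.Perm (Fin (2 * k))) (g : Fin (2 * k) → Fin N),
      hafFun (Matrix.diagonal l) (g ∘ σ) = hafFun (Matrix.diagonal l) g := by
    intro σ g
    unfold hafFun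
    congr 1
    exact Fintype.sum_equiv (Equiv.mulLeft σ) _ _ fun τ => rfl
  -- The hafnian is invariant under permutations of positions, so the symmetrization of one of the
  -- two factors can be undone: all `(2k)!` permutations contribute equally. The remaining
  -- `pairProd` then restricts the sum to `h ∘ half`.
  have h1 : ∑ g : Fin (2 * k) → Fin N, hafFun (Matrix.diagonal l) g ^ 2 =
      ((2 * k)! : ℝ) / ((k ! : ℝ) * 2 ^ k) * ∑ g : Fin (2 * k) → Fin N,
        pairProd (Matrix.diagonal l) g * hafFun (Matrix.diagonal l) g := by
    have h2 : ∀ g : Fin (2 * k) → Fin N, hafFun (Matrix.diagonal l) g ^ 2 =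
        (1 / ((k ! : ℝ) * 2 ^ k)) * ∑ σ : Equiv.Perm (Fin (2 * k)),
          pairProd (Matrix.diagonal l) (g ∘ σ) * hafFun (Matrix.diagonal l) (g ∘ σ) := by
      intro g
      simp_rw [hinv]
      rw [← Finset.sum_mul, ← mul_assoc, sq]
      rfl
    simp_rw [h2]
    rw [← Finset.mul_sum, Finset.sum_comm]
    have h3 : ∀ σ : Equiv.Perm (Fin (2 * k)), ∑ g : Fin (2 * k) → Fin N,
        pairProd (Matrix.diagonal l) (g ∘ σ) * hafFun (Matrix.diagonal l) (g ∘ σ) =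
        ∑ g : Fin (2 * k) → Fin N, pairProd (Matrix.diagonal l) g * hafFun (Matrix.diagonal l) g :=
      fun σ => Fintype.sum_equiv (Equiv.arrowCongr σ.symm (Equiv.refl _)) _ _ fun g => rfl
    simp_rw [h3]
    rw [Finset.sum_const, Finset.card_univ, Fintype.card_perm, Fintype.card_fin, nsmul_eq_mul]
    ring
  have h4 : ∀ h : Fin k → Fin N, (∏ j, l (h j)) * hafFun (Matrix.diagonal l) (h ∘ half) =
      (fun m : Fin N → ℕ => (multiFact (fun n => 2 * m n) : ℝ) / 2 ^ k / multiFact m *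
        (∏ n, l n ^ m n) ^ 2) (counts h) := by
    intro h
    have hs : ∑ n, 2 * counts h n = 2 * k := by rw [← Finset.mul_sum, sum_counts]
    rw [hafFun_eq_of_counts, counts_comp_half, hafnian_expand_eq_sum (k := k) _ hs,
      sum_counts_eq_pairProd_diagonal l (sum_counts h), prod_comp_eq_prod_pow_counts]
    have : (k ! : ℝ) ≠ 0 := by exact_mod_cast (Nat.factorial_pos _).ne'
    field_simp
  rw [h1, sum_pairProd_diagonal]
  simp_rw [h4]
  rw [sum_comp_counts (fun m : Fin N → ℕ => (multiFact (fun n => 2 * m n) : ℝ) / 2 ^ k /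
    multiFact m * (∏ n, l n ^ m n) ^ 2), Finset.mul_sum, Finset.mul_sum]
  refine Finset.sum_congr rfl fun m hm => ?_
  have hk0 : (k ! : ℝ) ≠ 0 := by exact_mod_cast (Nat.factorial_pos _).ne'
  have hk2 : ((2 * k)! : ℝ) ≠ 0 := by exact_mod_cast (Nat.factorial_pos _).ne'
  have hmf : (multiFact m : ℝ) ≠ 0 := by exact_mod_cast (multiFact_pos _).ne'
  have hcb : (multiFact (fun n => 2 * m n) : ℝ) =
      (∏ n, ((m n).centralBinom : ℝ)) * multiFact m ^ 2 := by
    unfold multiFact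
    push_cast
    simp_rw [factorial_two_mul_eq]
    rw [Finset.prod_mul_distrib, Finset.prod_mul_distrib, sq]
  have h4k : ∏ n, (4 : ℝ) ^ m n = 2 ^ k * 2 ^ k := by
    rw [Finset.prod_pow_eq_pow_sum, Finset.Nat.mem_antidiagonalTuple.1 hm, ← mul_pow]; norm_num
  have hp : ∏ n, ((m n).centralBinom : ℝ) * (l n ^ 2 / 4) ^ m n =
      (∏ n, ((m n).centralBinom : ℝ)) * (∏ n, l n ^ m n) ^ 2 / (2 ^ k * 2 ^ k) := by
    simp_rw [div_pow]
    rw [Finset.prod_mul_distrib, Finset.prod_div_distrib, h4k, ← Finset.prod_pow]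
    simp_rw [← pow_mul, mul_comm 2]
    ring
  rw [hp, hcb]
  field_simp

/-! ### Eigenvalues and normalization -/

theorem eigenvalues_mem_Ioo {N : ℕ} (B : MatSpace N) (j : Fin N) :
    B.isHermitian.eigenvalues j ∈ Set.Ioo (0 : ℝ) 1 :=
  B.2.2.2 (B.isHermitian.eigenvalues_mem_spectrum_real j)

theorem one_sub_eigenvalues_sq_pos {N : ℕ} (B : MatSpace N) (j : Fin N) :
    0 < 1 - B.isHermitian.eigenvalues j ^ 2 := by
  have h := eigenvalues_mem_Ioo B j
  nlinarith [h.1, h.2]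

theorem gbsConst_pos {N : ℕ} (B : MatSpace N) : 0 < gbsConst B :=
  Finset.prod_pos fun j _ => Real.sqrt_pos.2 (one_sub_eigenvalues_sq_pos B j)

theorem sum_hafnian_sq_div_multiFact {N : ℕ} (B : MatSpace N) (k : ℕ) :
    ∑ I ∈ Finset.Nat.antidiagonalTuple N (2 * k), hafnian (expand B.1 I) ^ 2 / multiFact I =
      ∑ m ∈ Finset.Nat.antidiagonalTuple N k,
        ∏ n, ((m n).centralBinom : ℝ) * (B.isHermitian.eigenvalues n ^ 2 / 4) ^ m n := by
  set U : Matrix (Fin N) (Fin N) ℝ := B.isHermitian.eigenvectorUnitary.1 with hUdef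
  have hU : star U * U = 1 := Matrix.mem_unitaryGroup_iff'.1 B.isHermitian.eigenvectorUnitary.2
  have hB : ∀ a b, B.1 a b = ∑ c, B.isHermitian.eigenvalues c * (U a c * U b c) := by
    intro a b
    conv_lhs => rw [B.isHermitian.spectral_theorem]
    rw [Unitary.conjStarAlgAut_apply, Matrix.mul_apply]
    refine Finset.sum_congr rfl fun c _ => ?_
    rw [Matrix.mul_diagonal]
    simp only [Function.comp, RCLike.ofReal_real_eq_id, id, Matrix.star_apply, star_trivial]
    rw [← hUdef]; ring
  have hU' : ∀ a b, ∑ c, U c a * U c b = if a = b then 1 else 0 := by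
    intro a b
    have := congrFun (congrFun hU a) b
    rw [Matrix.mul_apply, Matrix.one_apply] at this
    simpa using this
  rw [sum_hafFun_sq, sum_hafFun_sq_rotate hB hU', sum_hafFun_diagonal_sq]

/-- A tuple of total less than `n` has all entries below `n`, so the left side is part of the
expanded product. -/
theorem sum_range_sum_antidiagonalTuple_le {N : ℕ} (n : ℕ) (g : Fin N → ℕ → ℝ)
    (hg : ∀ i m, 0 ≤ g i m) :
    ∑ k ∈ Finset.range n, ∑ m ∈ Finset.Nat.antidiagonalTuple N k, ∏ i, g i (m i) ≤
      ∏ i, ∑ m ∈ Finset.range n, g i m := by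
  rw [Finset.prod_univ_sum, ← Finset.sum_biUnion]
  · refine Finset.sum_le_sum_of_subset_of_nonneg ?_ fun m _ _ => Finset.prod_nonneg fun i _ => hg _ _
    intro m hm
    obtain ⟨k, hk, hm⟩ := Finset.mem_biUnion.1 hm
    rw [Finset.Nat.mem_antidiagonalTuple] at hm
    rw [Fintype.mem_piFinset]
    intro i
    rw [Finset.mem_range] at hk ⊢
    have := Finset.single_le_sum (f := m) (fun _ _ => Nat.zero_le _) (Finset.mem_univ i)
    omega
  · intro k _ k' _ hkk
    refine Finset.disjoint_left.2 fun m hm hm' => hkk ?_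
    rw [Finset.Nat.mem_antidiagonalTuple] at hm hm'
    rw [← hm, hm']

/-- The GBS weights form a subprobability: `∑_I Haf(B_I)² / I! ≤ 1 / d`. -/
theorem sum_range_hafnian_sq_div_multiFact_le {N : ℕ} (B : MatSpace N) (n : ℕ) :
    ∑ k ∈ Finset.range n, ∑ I ∈ Finset.Nat.antidiagonalTuple N (2 * k),
      hafnian (expand B.1 I) ^ 2 / multiFact I ≤ 1 / gbsConst B := by
  simp_rw [sum_hafnian_sq_div_multiFact]
  refine (sum_range_sum_antidiagonalTuple_le n
    (fun i m => (m.centralBinom : ℝ) * (B.isHermitian.eigenvalues i ^ 2 / 4) ^ m)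
    fun i m => by positivity).trans ?_
  rw [one_div, gbsConst, ← Finset.prod_inv_distrib]
  refine Finset.prod_le_prod (fun i _ => Finset.sum_nonneg fun m _ => by positivity) fun i _ => ?_
  have h := one_sub_eigenvalues_sq_pos B i
  have := sum_centralBinom_mul_pow_le n (x := B.isHermitian.eigenvalues i ^ 2 / 4) (by positivity)
    (by linarith)
  rwa [mul_div_cancel₀ _ (by norm_num : (4 : ℝ) ≠ 0)] at this

/-! ### Contributions of a single order -/

theorem ofReal_level_mu {N : ℕ} {K : ℕ∞} (B : MatSpace N) (a : CoeffSpace N K) (k : Level K) :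
    ∑ I : MultiIdx N k, (a k I : ℝ≥0∞) * hafSq B I.1 =
      ENNReal.ofReal (∑ I : MultiIdx N k, (a k I : ℝ) * hafnian (expand B.1 I.1) ^ 2) := by
  rw [ENNReal.ofReal_sum_of_nonneg fun I _ => by positivity]
  refine Finset.sum_congr rfl fun I _ => ?_
  rw [ENNReal.ofReal_mul (by positivity), ENNReal.ofReal_coe_nnreal, hafSq]

theorem ofReal_level_sq {N : ℕ} {K : ℕ∞} (B : MatSpace N) (a : CoeffSpace N K) (k : Level K) :
    ∑ I : MultiIdx N k, (a k I : ℝ≥0∞) ^ 2 * (multiFact I.1 : ℝ≥0∞) * hafSq B I.1 =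
      ENNReal.ofReal (∑ I : MultiIdx N k,
        (a k I : ℝ) ^ 2 * multiFact I.1 * hafnian (expand B.1 I.1) ^ 2) := by
  rw [ENNReal.ofReal_sum_of_nonneg fun I _ => by positivity]
  refine Finset.sum_congr rfl fun I _ => ?_
  rw [ENNReal.ofReal_mul (by positivity), ENNReal.ofReal_mul (by positivity),
    ENNReal.ofReal_pow (by positivity), ENNReal.ofReal_coe_nnreal, ENNReal.ofReal_natCast, hafSq]

theorem ofReal_level_mc {N : ℕ} {K : ℕ∞} (B : MatSpace N) (a : CoeffSpace N K) (k l : Level K) :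
    ∑ I : MultiIdx N k, ∑ J : MultiIdx N l,
      (a k I : ℝ≥0∞) * (a l J : ℝ≥0∞) * hafSq B (I.1 + J.1) =
      ENNReal.ofReal (∑ I : MultiIdx N k, ∑ J : MultiIdx N l,
        (a k I : ℝ) * a l J * hafnian (expand B.1 (I.1 + J.1)) ^ 2) := by
  rw [ENNReal.ofReal_sum_of_nonneg fun I _ => Finset.sum_nonneg fun J _ => by positivity]
  refine Finset.sum_congr rfl fun I _ => ?_
  rw [ENNReal.ofReal_sum_of_nonneg fun I _ => by positivity]
  refine Finset.sum_congr rfl fun J _ => ?_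
  rw [ENNReal.ofReal_mul (by positivity), ENNReal.ofReal_mul (by positivity),
    ENNReal.ofReal_coe_nnreal, ENNReal.ofReal_coe_nnreal, hafSq]

/-! ### The second moment of the GBS estimator is at least the square of the mean -/

theorem sum_levels_weight_le {N : ℕ} {K : ℕ∞} (B : MatSpace N) (S : Finset (Level K)) :
    ∑ k ∈ S, ∑ I : MultiIdx N k, hafnian (expand B.1 I.1) ^ 2 / multiFact I.1 ≤
      1 / gbsConst B := by
  refine le_trans ?_ (sum_range_hafnian_sq_div_multiFact_le B (S.sup (fun k => k.1 + 1)))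
  have h1 : ∀ k : Level K, ∑ I : MultiIdx N k, hafnian (expand B.1 I.1) ^ 2 / multiFact I.1 =
      ∑ I ∈ Finset.Nat.antidiagonalTuple N (2 * k), hafnian (expand B.1 I) ^ 2 / multiFact I :=
    fun k => Finset.sum_coe_sort (Finset.Nat.antidiagonalTuple N (2 * k))
      (fun I => hafnian (expand B.1 I) ^ 2 / (multiFact I : ℝ))
  simp_rw [h1]
  rw [← Finset.sum_image (s := S) (g := fun k : Level K => k.1)
    (f := fun k => ∑ I ∈ Finset.Nat.antidiagonalTuple N (2 * k),
      hafnian (expand B.1 I) ^ 2 / (multiFact I : ℝ)) (fun x _ y _ h => Subtype.ext h)]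
  refine Finset.sum_le_sum_of_subset_of_nonneg ?_
    fun k _ _ => Finset.sum_nonneg fun I _ => by positivity
  intro k hk
  obtain ⟨k', hk', rfl⟩ := Finset.mem_image.1 hk
  exact Finset.mem_range.2 (Nat.lt_of_succ_le (Finset.le_sup (f := fun k : Level K => k.1 + 1) hk'))

/-- Cauchy–Schwarz for the splitting `a Haf² = (a √(I!) Haf) · (Haf / √(I!))`; the second factor has
total squared mass at most `1 / d`. -/
theorem sum_levels_mu_sq_le {N : ℕ} {K : ℕ∞} (B : MatSpace N) (a : CoeffSpace N K)
    (S : Finset (Level K)) :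
    (∑ k ∈ S, ∑ I : MultiIdx N k, (a k I : ℝ) * hafnian (expand B.1 I.1) ^ 2) ^ 2 ≤
      1 / gbsConst B * ∑ k ∈ S, ∑ I : MultiIdx N k,
        (a k I : ℝ) ^ 2 * multiFact I.1 * hafnian (expand B.1 I.1) ^ 2 := by
  have hd := gbsConst_pos B
  rw [mul_comm]
  refine le_trans ?_ (mul_le_mul_of_nonneg_left (sum_levels_weight_le B S)
    (Finset.sum_nonneg fun k _ => Finset.sum_nonneg fun I _ => by positivity))
  simp_rw [Finset.sum_sigma']
  refine Finset.sum_sq_le_sum_mul_sum_of_sq_le_mul _ (fun x _ => by positivity)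
    (fun x _ => by positivity) fun x _ => le_of_eq ?_
  have : (0 : ℝ) < multiFact x.2.1 := by exact_mod_cast multiFact_pos _
  field_simp

theorem mu_sq_le_QGBS {N : ℕ} {K : ℕ∞} (B : MatSpace N) (a : CoeffSpace N K) :
    mu B a ^ 2 ≤ QGBS B a := by
  have hd := gbsConst_pos B
  -- With the square root on the right, `μ` can be replaced by its finite partial sums, to which the
  -- real inequality applies.
  have key : mu B a ≤ QGBS B a ^ (2⁻¹ : ℝ) := by
    rw [mu, ENNReal.tsum_eq_iSup_sum]
    refine iSup_le fun S => ?_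
    rw [ENNReal.le_rpow_inv_iff (by norm_num)]
    simp_rw [ofReal_level_mu]
    rw [← ENNReal.ofReal_sum_of_nonneg fun k _ => Finset.sum_nonneg fun I _ => by positivity,
      show (2 : ℝ) = ((2 : ℕ) : ℝ) by norm_num, ENNReal.rpow_natCast, ← ENNReal.ofReal_pow
        (Finset.sum_nonneg fun k _ => Finset.sum_nonneg fun I _ => by positivity)]
    refine (ENNReal.ofReal_le_ofReal (sum_levels_mu_sq_le B a S)).trans ?_
    rw [ENNReal.ofReal_mul (by positivity), QGBS, ENNReal.ofReal_sum_of_nonneg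
      fun k _ => Finset.sum_nonneg fun I _ => by positivity]
    simp_rw [← ofReal_level_sq]
    gcongr
    exact ENNReal.sum_le_tsum S
  calc mu B a ^ 2 ≤ (QGBS B a ^ (2⁻¹ : ℝ)) ^ 2 := by gcongr
    _ = QGBS B a := by
      rw [← ENNReal.rpow_natCast, ← ENNReal.rpow_mul]; norm_num

/-! ### Bounds on hafnians -/

theorem bmin_le {N : ℕ} (B : MatSpace N) (i j : Fin N) : bmin B ≤ B.1 i j :=
  ciInf_le (Set.finite_range fun p : Fin N × Fin N => B.1 p.1 p.2).bddBelow (i, j)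

theorem le_bmax {N : ℕ} (B : MatSpace N) (i j : Fin N) : B.1 i j ≤ bmax B :=
  (le_abs_self _).trans
    (le_ciSup (Set.finite_range fun p : Fin N × Fin N => |B.1 p.1 p.2|).bddAbove (i, j))

theorem lt_bmin {N : ℕ} (hN : 1 ≤ N) (B : MatSpace N) {c : ℝ} (h : ∀ i j, c < B.1 i j) :
    c < bmin B := by
  have : Nonempty (Fin N) := ⟨⟨0, hN⟩⟩
  obtain ⟨p, hp⟩ := exists_eq_ciInf_of_finite (f := fun p : Fin N × Fin N => B.1 p.1 p.2)
  rw [bmin, ← hp]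
  exact h _ _

theorem bmax_lt {N : ℕ} (hN : 1 ≤ N) (B : MatSpace N) {c : ℝ} (h : ∀ i j, B.1 i j < c) :
    bmax B < c := by
  have : Nonempty (Fin N) := ⟨⟨0, hN⟩⟩
  obtain ⟨p, hp⟩ := exists_eq_ciSup_of_finite (f := fun p : Fin N × Fin N => |B.1 p.1 p.2|)
  rw [bmax, ← hp, abs_of_pos (B.2.1 _ _)]
  exact h _ _

theorem bmin_pos {N : ℕ} (hN : 1 ≤ N) (B : MatSpace N) : 0 < bmin B := lt_bmin hN B B.2.1

theorem bmin_le_bmax {N : ℕ} (hN : 1 ≤ N) (B : MatSpace N) : bmin B ≤ bmax B :=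
  (bmin_le B ⟨0, hN⟩ ⟨0, hN⟩).trans (le_bmax B _ _)

/-- All `(2k)!` enumerations contribute `b^k`, so the hafnian is `(2k-1)!! b^k`. Rewriting its
square with a single `(2k)!` isolates the factor that cancels against the denominators of the
coefficients. -/
theorem hafnian_const_sq {k : ℕ} (b : ℝ) :
    (1 / ((k ! : ℝ) * 2 ^ k) * ((2 * k)! * b ^ k)) ^ 2 =
      (b ^ 2) ^ k * ((2 * k)! * (k.centralBinom / 4 ^ k)) := by
  have hk : (k ! : ℝ) ≠ 0 := by exact_mod_cast (Nat.factorial_pos _).ne'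
  have h4 : (4 : ℝ) ^ k = (2 ^ k) ^ 2 := by rw [← pow_mul, mul_comm, pow_mul]; norm_num
  rw [h4, factorial_two_mul_eq, ← pow_mul, mul_comm 2 k, pow_mul]
  field_simp

theorem hafnian_sq_le {N k : ℕ} (B : MatSpace N) {I : Fin N → ℕ} (h : ∑ n, I n = 2 * k) :
    hafnian (expand B.1 I) ^ 2 ≤
      (bmax B ^ 2) ^ k * ((2 * k)! * (k.centralBinom / 4 ^ k)) := by
  rw [← hafnian_const_sq, hafnian_eq _ (by rw [card_sigma_fin, h])]
  have hc : ((2 * k)! : ℝ) * bmax B ^ k = ∑ e : Fin (2 * k) ≃ Σ n : Fin N, Fin (I n), bmax B ^ k := by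
    rw [Finset.sum_const, Finset.card_univ, card_equiv_sigma h, nsmul_eq_mul]
  rw [hc]
  have h0 : ∀ e : Fin (2 * k) ≃ Σ n : Fin N, Fin (I n), 0 ≤ pairProd (expand B.1 I) e :=
    fun e => Finset.prod_nonneg fun j _ => (B.2.1 _ _).le
  gcongr with e _
  · exact mul_nonneg (by positivity) (Finset.sum_nonneg fun e _ => h0 e)
  · refine (Finset.prod_le_prod (fun j _ => (B.2.1 _ _).le) fun j _ => le_bmax B _ _).trans ?_
    simp

theorem le_hafnian_sq {N k : ℕ} (hN : 1 ≤ N) (B : MatSpace N) {I : Fin N → ℕ}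
    (h : ∑ n, I n = 2 * k) :
    (bmin B ^ 2) ^ k * ((2 * k)! * (k.centralBinom / 4 ^ k)) ≤ hafnian (expand B.1 I) ^ 2 := by
  rw [← hafnian_const_sq, hafnian_eq _ (by rw [card_sigma_fin, h])]
  have hc : ((2 * k)! : ℝ) * bmin B ^ k = ∑ e : Fin (2 * k) ≃ Σ n : Fin N, Fin (I n), bmin B ^ k := by
    rw [Finset.sum_const, Finset.card_univ, card_equiv_sigma h, nsmul_eq_mul]
  have hb := bmin_pos hN B
  rw [hc]
  gcongr with e _
  refine le_trans ?_ (Finset.prod_le_prod (fun j _ => hb.le) fun j _ => bmin_le B _ _)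
  simp

/-! ### Truncated polylogarithms -/

theorem div_rpow_half_sub (k : ℕ) (hk : 1 ≤ k) (q x : ℝ) :
    x / (k : ℝ) ^ (1 / 2 - q) = (k : ℝ) ^ q / √(k : ℝ) * x := by
  have hk0 : (0 : ℝ) < k := by exact_mod_cast hk
  rw [Real.rpow_sub hk0, ← Real.sqrt_eq_rpow]
  have := (Real.rpow_pos_of_pos hk0 q).ne'
  field_simp

theorem summable_pow_div_rpow (s : ℝ) {z : ℝ} (hz : 0 ≤ z) (hz1 : z < 1) :
    Summable fun k : ℕ => z ^ k / (k : ℝ) ^ s := by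
  obtain ⟨m, hm⟩ := exists_nat_ge (-s)
  have h := summable_pow_mul_geometric_of_norm_lt_one (R := ℝ) m
    (by rwa [Real.norm_of_nonneg hz] : ‖z‖ < 1)
  refine (summable_nat_add_iff 1).1 (Summable.of_nonneg_of_le (fun k => by positivity) (fun k => ?_)
    ((summable_nat_add_iff 1).2 h))
  have hk : (1 : ℝ) ≤ ((k + 1 : ℕ) : ℝ) := by push_cast; linarith [Nat.cast_nonneg (α := ℝ) k]
  rw [div_eq_mul_inv, ← Real.rpow_neg (by positivity), mul_comm]
  gcongr
  calc ((k + 1 : ℕ) : ℝ) ^ (-s) ≤ ((k + 1 : ℕ) : ℝ) ^ (m : ℝ) := Real.rpow_le_rpow_of_exponent_le hk hm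
    _ = _ := Real.rpow_natCast _ _

theorem finite_orders {K : ℕ∞} (hK : K ≠ ⊤) : Finite {k : ℕ // 1 ≤ k ∧ (k : ℕ∞) ≤ K} := by
  lift K to ℕ using hK
  exact Set.Finite.to_subtype ((Set.finite_Iic K).subset fun k hk => by
    have := hk.2
    exact_mod_cast this)

theorem summable_polyLog (s : ℝ) {K : ℕ∞} {z : ℝ} (hz : 0 ≤ z) (hz1 : K = ⊤ → z < 1) :
    Summable fun k : {k : ℕ // 1 ≤ k ∧ (k : ℕ∞) ≤ K} => z ^ (k : ℕ) / ((k : ℕ) : ℝ) ^ s := by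
  by_cases hK : K = ⊤
  · exact (summable_pow_div_rpow s hz (hz1 hK)).subtype _
  · have := finite_orders hK
    exact Summable.of_finite

theorem polyLog_nonneg (s : ℝ) (K : ℕ∞) {z : ℝ} (hz : 0 ≤ z) : 0 ≤ polyLog s K z :=
  tsum_nonneg fun k => by positivity

/-- A divergent real `tsum` would be `0`, so `z < 1` is needed when `K = ⊤`. Comparisons with
polylogarithms are reduced to finite sets of orders by this lemma and `polyLog_le_of_sum_le`. -/
theorem sum_le_polyLog (s : ℝ) {K : ℕ∞} {z : ℝ} (hz : 0 ≤ z) (hz1 : K = ⊤ → z < 1)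
    (T : Finset ℕ) (hT : ∀ k ∈ T, 1 ≤ k ∧ (k : ℕ∞) ≤ K) :
    ∑ k ∈ T, z ^ k / (k : ℝ) ^ s ≤ polyLog s K z := by
  have h := (summable_polyLog s hz hz1).sum_le_tsum
    (T.subtype fun k : ℕ => 1 ≤ k ∧ (k : ℕ∞) ≤ K) (fun k _ => by positivity)
  rwa [Finset.sum_subtype_of_mem (fun k : ℕ => z ^ k / (k : ℝ) ^ s) hT] at h

theorem polyLog_le_of_sum_le (s : ℝ) {K : ℕ∞} {z c : ℝ} (hz : 0 ≤ z) (hz1 : K = ⊤ → z < 1)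
    (h : ∀ T : Finset ℕ, (∀ k ∈ T, 1 ≤ k ∧ (k : ℕ∞) ≤ K) → ∑ k ∈ T, z ^ k / (k : ℝ) ^ s ≤ c) :
    polyLog s K z ≤ c := by
  refine (summable_polyLog s hz hz1).tsum_le_of_sum_le fun S => ?_
  have := h (S.map (Function.Embedding.subtype _)) (fun k hk => by
    obtain ⟨k', _, rfl⟩ := Finset.mem_map.1 hk
    exact k'.2)
  rwa [Finset.sum_map] at this

theorem polyLog_mono (s : ℝ) {K K' : ℕ∞} {z z' : ℝ} (hK : K ≤ K') (hz : 0 ≤ z) (hzz : z ≤ z')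
    (hz1 : K' = ⊤ → z' < 1) : polyLog s K z ≤ polyLog s K' z' := by
  refine polyLog_le_of_sum_le s hz (fun h => hzz.trans_lt (hz1 (top_le_iff.1 (h ▸ hK)))) fun T hT => ?_
  refine le_trans ?_ (sum_le_polyLog s (hz.trans hzz) hz1 T fun k hk => ⟨(hT k hk).1, (hT k hk).2.trans hK⟩)
  gcongr

theorem polyLog_natCast (s : ℝ) (n : ℕ) (z : ℝ) :
    polyLog s n z = ∑ k ∈ Finset.Icc 1 n, z ^ k / (k : ℝ) ^ s := by
  rw [polyLog, ← Finset.tsum_subtype]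
  exact Equiv.tsum_eq (Equiv.subtypeEquivRight (fun k => by simp : ∀ k : ℕ,
    (1 ≤ k ∧ (k : ℕ∞) ≤ n) ↔ k ∈ Finset.Icc 1 n)) (fun k => z ^ (k : ℕ) / ((k : ℕ) : ℝ) ^ s)

/-! ### The bound on the second moment of the GBS estimator -/

theorem blockQuot_add_blockRem {N k : ℕ} (hN : 1 ≤ N) (hk : 1 ≤ k) :
    2 * k = N * blockQuot N k + blockRem N k ∧ 1 ≤ blockRem N k ∧ blockRem N k ≤ N := by
  have h1 := Nat.div_add_mod (2 * k - 1) N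
  have h2 := Nat.mod_lt (2 * k - 1) (show 0 < N by omega)
  unfold blockRem
  rw [show N * blockQuot N k = N * ((2 * k - 1) / N) from rfl]
  omega

/-- Stirling from above for `s!` and from below for `(Ns)!`: the powers of `s / e` cancel and leave
`N^(-Ns)`. The exponent `(N-1)/2` is what remains of `N` square roots against one. -/
theorem factorial_pow_le_factorial_mul {N s : ℕ} (hN : 1 ≤ N) (hs : 1 ≤ s) :
    (s ! : ℝ) ^ N * (√(N : ℝ) * (N : ℝ) ^ (N * s)) ≤
      (2 * Real.pi * s) ^ (((N : ℝ) - 1) / 2) * Real.exp ((N : ℝ) / 12) * (N * s)! := by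
  have hN0 : (0 : ℝ) < N := by exact_mod_cast hN
  have hs0 : (0 : ℝ) < s := by exact_mod_cast hs
  have hpi := Real.pi_pos
  have h1 := factorial_le_stirling hs
  have h2 := Stirling.le_factorial_stirling (N * s)
  have hx : (0 : ℝ) < 2 * Real.pi * s := by positivity
  have e1 : √(2 * Real.pi * s) ^ N =
      (2 * Real.pi * s) ^ (((N : ℝ) - 1) / 2) * √(2 * Real.pi * s) := by
    rw [Real.sqrt_eq_rpow, ← Real.rpow_natCast, ← Real.rpow_mul hx.le, ← Real.rpow_add hx]
    ring_nf
  have e2 : Real.exp (1 / 12) ^ N = Real.exp ((N : ℝ) / 12) := by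
    rw [← Real.exp_nat_mul]; ring_nf
  calc (s ! : ℝ) ^ N * (√(N : ℝ) * (N : ℝ) ^ (N * s))
      ≤ (√(2 * Real.pi * s) * (s / Real.exp 1) ^ s * Real.exp (1 / 12)) ^ N *
          (√(N : ℝ) * (N : ℝ) ^ (N * s)) := by gcongr
    _ = (2 * Real.pi * s) ^ (((N : ℝ) - 1) / 2) * Real.exp ((N : ℝ) / 12) *
          (√(2 * Real.pi * (N * s : ℕ)) * (((N * s : ℕ) : ℝ) / Real.exp 1) ^ (N * s)) := by
        rw [mul_pow, mul_pow, e1, e2, ← pow_mul, mul_comm s N]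
        have e3 : √(2 * Real.pi * (N * s : ℕ)) = √(2 * Real.pi * s) * √(N : ℝ) := by
          rw [← Real.sqrt_mul hx.le]; push_cast; ring_nf
        have e4 : (((N * s : ℕ) : ℝ) / Real.exp 1) ^ (N * s) =
            (N : ℝ) ^ (N * s) * (s / Real.exp 1) ^ (N * s) := by
          rw [← mul_pow]; push_cast; ring_nf
        rw [e3, e4]; ring
    _ ≤ _ := by gcongr

/-- Here `Ns/2 ≤ k ≤ Ns`, since `r ≤ N ≤ Ns`. The upper bound serves `q ≥ 0`; the lower one serves
`q ≤ 0` and costs the factor `2^(-q)`. -/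
theorem rpow_div_sqrt_le {N s r k : ℕ} (hN : 1 ≤ N) (hs : 1 ≤ s) (hr : r ≤ N) (hk : 1 ≤ k)
    (h : 2 * k = N * s + r) (q : ℝ) :
    (k : ℝ) ^ q / √(k : ℝ) ≤ (2 : ℝ) ^ (-min q 0) * ((N : ℝ) ^ q * (s : ℝ) ^ q) := by
  have hN0 : (0 : ℝ) < N := by exact_mod_cast hN
  have hs0 : (0 : ℝ) < s := by exact_mod_cast hs
  have hs1 : (1 : ℝ) ≤ s := by exact_mod_cast hs
  have hk0 : (0 : ℝ) < k := by exact_mod_cast hk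
  have hk1 : (1 : ℝ) ≤ k := by exact_mod_cast hk
  have hr' : (r : ℝ) ≤ N := by exact_mod_cast hr
  have hr0 : (0 : ℝ) ≤ r := by positivity
  have h' : 2 * (k : ℝ) = N * s + r := by exact_mod_cast h
  have hsq : 1 ≤ √(k : ℝ) := Real.one_le_sqrt.2 hk1
  refine (div_le_self (by positivity) hsq).trans ?_
  rw [← Real.mul_rpow hN0.le hs0.le]
  rcases le_total 0 q with hq | hq
  · rw [min_eq_right hq, neg_zero, Real.rpow_zero, one_mul]
    refine Real.rpow_le_rpow hk0.le ?_ hq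
    nlinarith
  · rw [min_eq_left hq]
    calc (k : ℝ) ^ q ≤ ((N : ℝ) * s / 2) ^ q :=
          Real.rpow_le_rpow_of_nonpos (by positivity) (by linarith) hq
      _ = _ := by
          rw [Real.div_rpow (by positivity) (by norm_num), Real.rpow_neg (by norm_num)]
          ring

/-- The summand of order `k` in the bound for the second moment of the GBS estimator. -/
theorem order_term_le {N k : ℕ} (hN : 1 ≤ N) (hk : 1 ≤ k) (hs : 1 ≤ blockQuot N k) (q : ℝ) {z : ℝ}
    (hz : 0 ≤ z) :
    (k : ℝ) ^ q / √(k : ℝ) * (z ^ (2 * k) * minFact N k / (2 * k)!) ≤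
      (2 : ℝ) ^ (-min q 0) * (2 * Real.pi) ^ (((N : ℝ) - 1) / 2) * (N : ℝ) ^ (q - 1 / 2) *
      Real.exp ((N : ℝ) / 12) * ((2 * z / N) ^ blockRem N k / (blockRem N k : ℝ) ^ (0 : ℝ) *
        ((z ^ N / (N : ℝ) ^ N) ^ blockQuot N k /
          (blockQuot N k : ℝ) ^ (1 / 2 - (N : ℝ) / 2 - q))) := by
  obtain ⟨h2k, hr1, hrN⟩ := blockQuot_add_blockRem hN hk
  rw [minFact]
  generalize blockQuot N k = s at *
  generalize blockRem N k = r at *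
  have hN0 : (0 : ℝ) < N := by exact_mod_cast hN
  have hs0 : (0 : ℝ) < s := by exact_mod_cast hs
  have hpi := Real.pi_pos
  have hA := rpow_div_sqrt_le hN hs hrN hk h2k q
  have hB := factorial_pow_le_factorial_mul hN hs
  have hC : ((N * s)! : ℝ) * ((N : ℝ) * s) ^ r ≤ ((2 * k)! : ℝ) := by
    rw [h2k]
    calc ((N * s)! : ℝ) * ((N : ℝ) * s) ^ r ≤ ((N * s)! : ℝ) * (((N * s : ℕ) : ℝ) + 1) ^ r := by
          gcongr; push_cast; linarith
      _ ≤ _ := by exact_mod_cast Nat.factorial_mul_pow_le_factorial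
  -- The estimate `s + 1 ≤ 2s` is the source of the `2` in the argument `2z / N`.
  have hD : ((s : ℝ) + 1) ^ r ≤ (2 * s) ^ r := by
    have : (1 : ℝ) ≤ s := by exact_mod_cast hs
    gcongr; linarith
  have hf : (0 : ℝ) < (N * s)! := by exact_mod_cast Nat.factorial_pos _
  have hE : (((s ! : ℝ)) ^ N * ((s : ℝ) + 1) ^ r) / (2 * k)! ≤
      (2 * Real.pi * s) ^ (((N : ℝ) - 1) / 2) * Real.exp ((N : ℝ) / 12) /
        (√(N : ℝ) * (N : ℝ) ^ (N * s)) * (2 / N) ^ r := by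
    calc (((s ! : ℝ)) ^ N * ((s : ℝ) + 1) ^ r) / (2 * k)!
        ≤ (((2 * Real.pi * s) ^ (((N : ℝ) - 1) / 2) * Real.exp ((N : ℝ) / 12) * (N * s)!) /
          (√(N : ℝ) * (N : ℝ) ^ (N * s)) * (2 * s) ^ r) / ((N * s)! * ((N : ℝ) * s) ^ r) := by
          gcongr
          rwa [le_div_iff₀ (by positivity)]
      _ = _ := by
          rw [mul_pow (2 : ℝ), mul_pow (N : ℝ), div_pow]
          field_simp
  have hz2 : z ^ (2 * k) = z ^ (N * s) * z ^ r := by rw [h2k, pow_add]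
  push_cast
  calc (k : ℝ) ^ q / √(k : ℝ) * (z ^ (2 * k) * (((s ! : ℝ)) ^ N * ((s : ℝ) + 1) ^ r) / (2 * k)!)
      = (k : ℝ) ^ q / √(k : ℝ) * (z ^ (2 * k) * ((((s ! : ℝ)) ^ N * ((s : ℝ) + 1) ^ r) / (2 * k)!)) := by
        ring
    _ ≤ (2 : ℝ) ^ (-min q 0) * ((N : ℝ) ^ q * (s : ℝ) ^ q) * (z ^ (2 * k) *
        ((2 * Real.pi * s) ^ (((N : ℝ) - 1) / 2) * Real.exp ((N : ℝ) / 12) /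
        (√(N : ℝ) * (N : ℝ) ^ (N * s)) * (2 / N) ^ r)) := by gcongr
    _ = _ := by
        have e1 : (N : ℝ) ^ (q - 1 / 2) = (N : ℝ) ^ q / √(N : ℝ) := by
          rw [Real.rpow_sub hN0, ← Real.sqrt_eq_rpow]
        have e2 : (s : ℝ) ^ (1 / 2 - (N : ℝ) / 2 - q) =
            ((s : ℝ) ^ (((N : ℝ) - 1) / 2) * (s : ℝ) ^ q)⁻¹ := by
          rw [← Real.rpow_add hs0, ← Real.rpow_neg hs0.le]; ring_nf
        have e3 : (z ^ N / (N : ℝ) ^ N) ^ s = z ^ (N * s) / (N : ℝ) ^ (N * s) := by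
          rw [div_pow, ← pow_mul, ← pow_mul]
        have e4 : (2 * z / (N : ℝ)) ^ r = (2 / (N : ℝ)) ^ r * z ^ r := by
          rw [← mul_pow]; ring
        rw [hz2, Real.rpow_zero, div_one, Real.mul_rpow (by positivity) hs0.le, e1, e2, e3, e4,
          div_inv_eq_mul]
        have : 0 < √(N : ℝ) := Real.sqrt_pos.2 hN0
        field_simp

theorem blockQuot_mono {N : ℕ} : Monotone (blockQuot N) := fun a b h =>
  Nat.div_le_div_right (by omega)

theorem blockQuot_le_map {N k : ℕ} {K : ℕ∞} (h : (k : ℕ∞) ≤ K) :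
    (blockQuot N k : ℕ∞) ≤ ENat.map (blockQuot N) K := by
  cases K with
  | top => exact le_top
  | coe K =>
    rw [ENat.map_natCast]
    exact Nat.cast_le.2 (blockQuot_mono (Nat.cast_le.1 h))

theorem map_blockQuot_eq_top {N : ℕ} {K : ℕ∞} (h : ENat.map (blockQuot N) K = ⊤) : K = ⊤ := by
  cases K with
  | top => rfl
  | coe K => simp at h

theorem pow_div_pow_lt_one {N : ℕ} (hN : 1 ≤ N) {z : ℝ} (hz : 0 ≤ z) (h : z < N) :
    z ^ N / (N : ℝ) ^ N < 1 := by
  have hN0 : (0 : ℝ) < N := by exact_mod_cast hN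
  rw [← div_pow]
  exact pow_lt_one₀ (by positivity) ((div_lt_one hN0).2 h) (by omega)

/-- Orders with `2k ≤ N` have `s_k = 0` and `m_k = 1`, and give `fFun`. For the others `k ↦ (s_k,
r_k)` is injective, and enlarging its image to a rectangle makes the sum a product of two
polylogarithms. -/
theorem sum_order_term_le_GFun {N : ℕ} (hN : 1 ≤ N) {K : ℕ∞} (q : ℝ) {z : ℝ} (hz : 0 ≤ z)
    (hzN : K = ⊤ → z < N) (T : Finset ℕ) (hT : ∀ k ∈ T, 1 ≤ k ∧ (k : ℕ∞) ≤ K) :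
    ∑ k ∈ T, (k : ℝ) ^ q / √(k : ℝ) * (z ^ (2 * k) * minFact N k / (2 * k)!) ≤ GFun q K N z := by
  have hN0 : (0 : ℝ) < N := by exact_mod_cast hN
  rw [← Finset.sum_filter_add_sum_filter_not T (fun k => 2 * k ≤ N), GFun]
  refine add_le_add ?_ ?_
  · rw [fFun]
    calc ∑ k ∈ T with 2 * k ≤ N, (k : ℝ) ^ q / √(k : ℝ) * (z ^ (2 * k) * minFact N k / (2 * k)!)
        ≤ ∑ k ∈ T with 2 * k ≤ N, (k : ℝ) ^ q / ((2 * k)! : ℝ) * z ^ (2 * k) := by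
          refine Finset.sum_le_sum fun k hk => ?_
          rw [Finset.mem_filter] at hk
          have hk1 := (hT k hk.1).1
          have hb : blockQuot N k = 0 := Nat.div_eq_of_lt (by omega)
          have hm : minFact N k = 1 := by simp [minFact, hb]
          have hsq : 1 ≤ √(k : ℝ) := Real.one_le_sqrt.2 (by exact_mod_cast hk1)
          rw [hm, Nat.cast_one, mul_one]
          calc (k : ℝ) ^ q / √(k : ℝ) * (z ^ (2 * k) / (2 * k)!)
              ≤ (k : ℝ) ^ q * (z ^ (2 * k) / (2 * k)!) := by
                gcongr
                exact div_le_self (by positivity) hsq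
            _ = _ := by ring
      _ ≤ _ := by
          refine Finset.sum_le_sum_of_subset_of_nonneg (fun k hk => ?_) fun k _ _ => by positivity
          rw [Finset.mem_filter] at hk
          rw [Finset.mem_Icc]
          exact ⟨(hT k hk.1).1, by omega⟩
  · set C : ℝ := (2 : ℝ) ^ (-min q 0) * (2 * Real.pi) ^ (((N : ℝ) - 1) / 2) * (N : ℝ) ^ (q - 1 / 2) *
      Real.exp ((N : ℝ) / 12) with hC
    have hC0 : 0 ≤ C := by have := Real.pi_pos; positivity
    set F : ℕ × ℕ → ℝ := fun p => (2 * z / N) ^ p.2 / (p.2 : ℝ) ^ (0 : ℝ) *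
        ((z ^ N / (N : ℝ) ^ N) ^ p.1 / (p.1 : ℝ) ^ (1 / 2 - (N : ℝ) / 2 - q)) with hF
    have hF0 : ∀ p, 0 ≤ F p := fun p => by positivity
    set T' := T.filter fun k => ¬ 2 * k ≤ N with hT'
    have hmem : ∀ k ∈ T', 1 ≤ k ∧ (k : ℕ∞) ≤ K ∧ 1 ≤ blockQuot N k := fun k hk => by
      rw [hT', Finset.mem_filter] at hk
      exact ⟨(hT k hk.1).1, (hT k hk.1).2, (Nat.one_le_div_iff (by omega)).2 (by omega)⟩
    calc ∑ k ∈ T', (k : ℝ) ^ q / √(k : ℝ) * (z ^ (2 * k) * minFact N k / (2 * k)!)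
        ≤ ∑ k ∈ T', C * F (blockQuot N k, blockRem N k) :=
          Finset.sum_le_sum fun k hk => order_term_le hN (hmem k hk).1 (hmem k hk).2.2 q hz
      _ = C * ∑ k ∈ T', F (blockQuot N k, blockRem N k) := by rw [Finset.mul_sum]
      _ = C * ∑ p ∈ T'.image (fun k => (blockQuot N k, blockRem N k)), F p := by
          rw [Finset.sum_image]
          intro k hk l hl h
          have h1 := (blockQuot_add_blockRem hN (hmem k hk).1).1
          have h2 := (blockQuot_add_blockRem hN (hmem l hl).1).1
          have h3 := Prod.mk.inj h
          rw [h3.1, h3.2] at h1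
          omega
      _ ≤ C * ∑ p ∈ (T'.image (blockQuot N)) ×ˢ Finset.Icc 1 N, F p := by
          refine mul_le_mul_of_nonneg_left ?_ hC0
          refine Finset.sum_le_sum_of_subset_of_nonneg (fun p hp => ?_) fun p _ _ => hF0 p
          obtain ⟨k, hk, rfl⟩ := Finset.mem_image.1 hp
          have h1 := (blockQuot_add_blockRem hN (hmem k hk).1).2
          exact Finset.mem_product.2 ⟨Finset.mem_image_of_mem _ hk, Finset.mem_Icc.2 h1⟩
      _ = C * ((∑ r ∈ Finset.Icc 1 N, (2 * z / N) ^ r / (r : ℝ) ^ (0 : ℝ)) *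
          ∑ s ∈ T'.image (blockQuot N),
            (z ^ N / (N : ℝ) ^ N) ^ s / (s : ℝ) ^ (1 / 2 - (N : ℝ) / 2 - q)) := by
          rw [Finset.sum_product, Finset.sum_comm, Finset.sum_mul_sum]
      _ ≤ C * (polyLog 0 N (2 * z / N) * polyLog (1 / 2 - (N : ℝ) / 2 - q)
            (ENat.map (blockQuot N) K) (z ^ N / (N : ℝ) ^ N)) := by
          rw [polyLog_natCast]
          gcongr
          · refine sum_le_polyLog _ (by positivity)
              (fun h => pow_div_pow_lt_one hN hz (hzN (map_blockQuot_eq_top h))) _ fun s hs => ?_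
            obtain ⟨k, hk, rfl⟩ := Finset.mem_image.1 hs
            exact ⟨(hmem k hk).2.2, blockQuot_le_map (hmem k hk).2.1⟩
      _ = _ := by ring

/-! ### Sums over a single order -/

theorem MultiIdx.sum_eq {N k : ℕ} (I : MultiIdx N k) : ∑ n, I.1 n = 2 * k :=
  Finset.Nat.mem_antidiagonalTuple.1 I.2

theorem sum_multiIdx_zero {N : ℕ} (F : MultiIdx N 0 → ℝ) (I : MultiIdx N 0) :
    ∑ J, F J = F I := by
  have h0 : ∀ J : MultiIdx N 0, J.1 = 0 := fun J => by
    have h : ∑ n, J.1 n = 0 := J.sum_eq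
    rw [Finset.sum_eq_zero_iff] at h
    exact funext fun n => h n (Finset.mem_univ n)
  have : Subsingleton (MultiIdx N 0) := ⟨fun I J => Subtype.ext ((h0 I).trans (h0 J).symm)⟩
  exact Fintype.sum_subsingleton F I

theorem sum_level_zero {N : ℕ} {K : ℕ∞} (a : CoeffSpace N K) {k : Level K} (hk : k.1 = 0) :
    ∑ I : MultiIdx N k, (a k I : ℝ) = coeffZero a := by
  obtain ⟨k, h⟩ := k
  obtain rfl : k = 0 := hk
  exact sum_multiIdx_zero (fun I => (a ⟨0, h⟩ I : ℝ)) _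

theorem level_sq_zero_le {N : ℕ} {K : ℕ∞} (B : MatSpace N) (a : CoeffSpace N K) {k : Level K}
    (hk : k.1 = 0) :
    ∑ I : MultiIdx N k, (a k I : ℝ) ^ 2 * multiFact I.1 * hafnian (expand B.1 I.1) ^ 2 ≤
      coeffZero a ^ 2 := by
  obtain ⟨k, h⟩ := k
  obtain rfl : k = 0 := hk
  rw [sum_multiIdx_zero _ ⟨0, by simp [Finset.Nat.mem_antidiagonalTuple]⟩]
  have h1 : hafnian (expand B.1 (0 : Fin N → ℕ)) ^ 2 ≤ 1 := by
    simpa using hafnian_sq_le B (k := 0) (I := 0) (by simp)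
  have h2 : multiFact (0 : Fin N → ℕ) = 1 := by simp [multiFact]
  simp only [h2, Nat.cast_one, mul_one]
  exact mul_le_of_le_one_right (by positivity) h1

theorem level_sq_le {N : ℕ} {K : ℕ∞} (B : MatSpace N) (a : CoeffSpace N K)
    {k : Level K} (hk : 1 ≤ k.1) {C q γ : ℝ} (hγ : 0 < γ)
    (h : ∑ I : MultiIdx N k, (a k I : ℝ) ^ 2 * (multiFact I.1 : ℝ) ≤
      C ^ 2 * ((k.1 : ℝ) ^ (2 * q) * γ ^ (2 * k.1) / ((2 * k.1)! : ℝ) ^ 2) * (minFact N k.1 : ℝ)) :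
    ∑ I : MultiIdx N k, (a k I : ℝ) ^ 2 * multiFact I.1 * hafnian (expand B.1 I.1) ^ 2 ≤
      C ^ 2 * (1 / √Real.pi) * ((k.1 : ℝ) ^ (2 * q) / √(k.1 : ℝ) *
        ((γ * bmax B) ^ (2 * k.1) * minFact N k.1 / (2 * k.1)!)) := by
  have hcb := (centralBinom_lt hk).le
  have hf : (0 : ℝ) < (2 * k.1)! := by exact_mod_cast Nat.factorial_pos _
  calc ∑ I : MultiIdx N k, (a k I : ℝ) ^ 2 * multiFact I.1 * hafnian (expand B.1 I.1) ^ 2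
      ≤ ∑ I : MultiIdx N k, (a k I : ℝ) ^ 2 * multiFact I.1 *
          ((bmax B ^ 2) ^ k.1 * ((2 * k.1)! * (1 / √Real.pi / √(k.1 : ℝ)))) := by
        gcongr with I _
        refine (hafnian_sq_le B I.sum_eq).trans ?_
        gcongr
    _ = (∑ I : MultiIdx N k, (a k I : ℝ) ^ 2 * (multiFact I.1 : ℝ)) *
          ((bmax B ^ 2) ^ k.1 * ((2 * k.1)! * (1 / √Real.pi / √(k.1 : ℝ)))) := by
        rw [Finset.sum_mul]
    _ ≤ (C ^ 2 * ((k.1 : ℝ) ^ (2 * q) * γ ^ (2 * k.1) / ((2 * k.1)! : ℝ) ^ 2) *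
          (minFact N k.1 : ℝ)) *
          ((bmax B ^ 2) ^ k.1 * ((2 * k.1)! * (1 / √Real.pi / √(k.1 : ℝ)))) := by gcongr
    _ = _ := by
        rw [mul_pow, ← pow_mul]
        field_simp

theorem sqSum_le {N : ℕ} (hN : 1 ≤ N) {K : ℕ∞} (B : MatSpace N) (a : CoeffSpace N K)
    {C q γ : ℝ} (hγ : 0 < γ) (hK : K = ⊤ → γ * bmax B < N) (h0 : coeffZero a ≤ C)
    (h : ∀ k : Level K, 1 ≤ k.1 → ∑ I : MultiIdx N k, (a k I : ℝ) ^ 2 * (multiFact I.1 : ℝ) ≤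
      C ^ 2 * ((k.1 : ℝ) ^ (2 * q) * γ ^ (2 * k.1) / ((2 * k.1)! : ℝ) ^ 2) *
        (minFact N k.1 : ℝ)) :
    sqSum B a ≤ ENNReal.ofReal
      (C ^ 2 * (1 + 1 / √Real.pi * GFun (2 * q) K N (γ * bmax B))) := by
  have hb : 0 < bmax B := (bmin_pos hN B).trans_le (bmin_le_bmax hN B)
  have hc0 : 0 ≤ coeffZero a := NNReal.coe_nonneg _
  rw [sqSum, ENNReal.tsum_eq_iSup_sum]
  refine iSup_le fun S => ?_
  simp_rw [ofReal_level_sq]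
  rw [← ENNReal.ofReal_sum_of_nonneg fun k _ => Finset.sum_nonneg fun I _ => by positivity]
  refine ENNReal.ofReal_le_ofReal ?_
  rw [← Finset.sum_filter_add_sum_filter_not S (fun k => k.1 = 0), mul_add, mul_one]
  refine add_le_add ?_ ?_
  · calc ∑ k ∈ S with k.1 = 0, ∑ I : MultiIdx N k,
          (a k I : ℝ) ^ 2 * multiFact I.1 * hafnian (expand B.1 I.1) ^ 2
        ≤ ∑ k ∈ S with k.1 = 0, coeffZero a ^ 2 :=
          Finset.sum_le_sum fun k hk => level_sq_zero_le B a (Finset.mem_filter.1 hk).2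
      _ ≤ 1 * coeffZero a ^ 2 := by
          rw [Finset.sum_const, nsmul_eq_mul]
          gcongr
          have : (S.filter fun k => k.1 = 0).card ≤ 1 := Finset.card_le_one.2 fun x hx y hy =>
            Subtype.ext ((Finset.mem_filter.1 hx).2.trans (Finset.mem_filter.1 hy).2.symm)
          exact_mod_cast this
      _ ≤ C ^ 2 := by rw [one_mul]; gcongr
  · have hpos : ∀ k ∈ S.filter (fun k => ¬ k.1 = 0), 1 ≤ k.1 := fun k hk =>
      Nat.one_le_iff_ne_zero.2 (Finset.mem_filter.1 hk).2
    refine (Finset.sum_le_sum fun k hk => level_sq_le B a (hpos k hk) hγ (h k (hpos k hk))).trans ?_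
    rw [← Finset.mul_sum, mul_assoc]
    gcongr
    have := sum_order_term_le_GFun hN (K := K) (2 * q) (z := γ * bmax B) (by positivity) hK
      ((S.filter fun k => ¬ k.1 = 0).image fun k => k.1) (fun k hk => by
        obtain ⟨k', hk', rfl⟩ := Finset.mem_image.1 hk
        exact ⟨hpos k' hk', k'.2⟩)
    rwa [Finset.sum_image fun x _ y _ hxy => Subtype.ext hxy] at this

/-! ### Bounds on the second moment of the Monte Carlo estimator -/

noncomputable section

/-- The power `k^q`, with the convention that it is `1` for `k = 0`. -/
def natRpow (q : ℝ) (k : ℕ) : ℝ := if k = 0 then 1 else (k : ℝ) ^ q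

end

theorem natRpow_pos (q : ℝ) (k : ℕ) : 0 < natRpow q k := by
  unfold natRpow
  split_ifs with h
  · exact one_pos
  · exact Real.rpow_pos_of_pos (by exact_mod_cast Nat.pos_of_ne_zero h) _

theorem level_mc_le {N : ℕ} {K : ℕ∞} (B : MatSpace N) (a : CoeffSpace N K) (k l : Level K) :
    ∑ I : MultiIdx N k, ∑ J : MultiIdx N l,
      (a k I : ℝ) * a l J * hafnian (expand B.1 (I.1 + J.1)) ^ 2 ≤
      (∑ I : MultiIdx N k, (a k I : ℝ)) * (∑ J : MultiIdx N l, (a l J : ℝ)) *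
        ((bmax B ^ 2) ^ (k.1 + l.1) * ((2 * (k.1 + l.1))! *
          ((k.1 + l.1).centralBinom / 4 ^ (k.1 + l.1)))) := by
  simp_rw [Finset.sum_mul_sum, Finset.sum_mul]
  gcongr with I _ J _
  refine hafnian_sq_le B ?_
  simp [Finset.sum_add_distrib, I.sum_eq, J.sum_eq, mul_add]

theorem le_level_mc {N : ℕ} (hN : 1 ≤ N) {K : ℕ∞} (B : MatSpace N) (a : CoeffSpace N K)
    (k l : Level K) :
    (∑ I : MultiIdx N k, (a k I : ℝ)) * (∑ J : MultiIdx N l, (a l J : ℝ)) *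
        ((bmin B ^ 2) ^ (k.1 + l.1) * ((2 * (k.1 + l.1))! *
          ((k.1 + l.1).centralBinom / 4 ^ (k.1 + l.1)))) ≤
    ∑ I : MultiIdx N k, ∑ J : MultiIdx N l,
      (a k I : ℝ) * a l J * hafnian (expand B.1 (I.1 + J.1)) ^ 2 := by
  simp_rw [Finset.sum_mul_sum, Finset.sum_mul]
  gcongr with I _ J _
  refine le_hafnian_sq hN B ?_
  simp [Finset.sum_add_distrib, I.sum_eq, J.sum_eq, mul_add]

theorem factorial_two_mul_add (k l : ℕ) :
    ((2 * (k + l))! : ℝ) = (2 * (k + l)).choose (2 * k) * (((2 * k)! : ℝ) * (2 * l)!) := by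
  have := Nat.choose_mul_factorial_mul_factorial (show 2 * k ≤ 2 * (k + l) by omega)
  rw [show 2 * (k + l) - 2 * k = 2 * l by omega] at this
  rw [← this]; push_cast; ring

theorem finite_level {K : ℕ∞} (hK : K ≠ ⊤) : Finite (Level K) := by
  lift K to ℕ using hK
  exact Set.Finite.to_subtype ((Set.finite_Iic K).subset fun k hk => by
    have h : (k : ℕ∞) ≤ K := hk
    exact_mod_cast h)

theorem tsum_ofReal_natRpow_mul_pow_lt_top (K : ℕ∞) (q : ℝ) {y : ℝ} (hy : 0 ≤ y)
    (hy1 : K = ⊤ → y < 1) : ∑' k : Level K, ENNReal.ofReal (natRpow q k.1 * y ^ k.1) < ∞ := by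
  have hs : Summable fun k : Level K => natRpow q k.1 * y ^ k.1 := by
    by_cases hK : K = ⊤
    · have h1 : Summable fun k : ℕ => natRpow q k * y ^ k := by
        refine (summable_nat_add_iff 1).1 ?_
        refine ((summable_nat_add_iff 1).2 (summable_pow_div_rpow (-q) hy (hy1 hK))).congr fun k => ?_
        rw [natRpow, if_neg (Nat.succ_ne_zero k), Real.rpow_neg (by positivity), div_inv_eq_mul,
          mul_comm]
      exact h1.subtype _
    · have := finite_level hK
      exact Summable.of_finite
  exact hs.tsum_ofReal_lt_top

/-- Finiteness needs only the crude bounds `binom(2n,2k) ≤ 4^n` and `binom(2n,n) ≤ 4^n`, after which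
the double series is dominated by a product of two series of ratio `4 γ b_max²`. -/
theorem QMC_lt_top {N : ℕ} {K : ℕ∞} (B : MatSpace N) (a : CoeffSpace N K)
    {C q γ : ℝ} (hC : 0 ≤ C) (hγ : 0 < γ) (hK : K = ⊤ → 4 * γ * bmax B ^ 2 < 1)
    (h0 : coeffZero a ≤ C)
    (h : ∀ k : Level K, 1 ≤ k.1 → ∑ I : MultiIdx N k, (a k I : ℝ) ≤
      C * ((k.1 : ℝ) ^ q * γ ^ k.1 / ((2 * k.1)! : ℝ))) :
    QMC B a < ∞ := by
  have hA : ∀ k : Level K, ∑ I : MultiIdx N k, (a k I : ℝ) ≤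
      C * (natRpow q k.1 * γ ^ k.1 / ((2 * k.1)! : ℝ)) := by
    intro k
    rcases Nat.eq_zero_or_pos k.1 with hk | hk
    · rw [sum_level_zero a hk, hk]
      simpa [natRpow] using h0
    · rw [natRpow, if_neg hk.ne']
      exact h k hk
  set y := 4 * γ * bmax B ^ 2 with hy
  have hy0 : 0 ≤ y := by positivity
  have hψ : ∀ k, 0 ≤ natRpow q k * y ^ k := fun k => by have := natRpow_pos q k; positivity
  have hterm : ∀ k l : Level K, ∑ I : MultiIdx N k, ∑ J : MultiIdx N l,
      (a k I : ℝ≥0∞) * (a l J : ℝ≥0∞) * hafSq B (I.1 + J.1) ≤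
      ENNReal.ofReal (C ^ 2) * (ENNReal.ofReal (natRpow q k.1 * y ^ k.1) *
        ENNReal.ofReal (natRpow q l.1 * y ^ l.1)) := by
    intro k l
    rw [ofReal_level_mc, ← ENNReal.ofReal_mul (hψ _), ← ENNReal.ofReal_mul (by positivity)]
    refine ENNReal.ofReal_le_ofReal ((level_mc_le B a k l).trans ?_)
    have hch : (((2 * (k.1 + l.1)).choose (2 * k.1) : ℕ) : ℝ) ≤ 4 ^ (k.1 + l.1) := by
      have := Nat.choose_le_two_pow (2 * (k.1 + l.1)) (2 * k.1)
      rw [pow_mul] at this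
      exact_mod_cast this
    have hr : ((k.1 + l.1).centralBinom : ℝ) / 4 ^ (k.1 + l.1) ≤ 1 := by
      rw [div_le_one (by positivity)]
      exact_mod_cast Nat.centralBinom_le_four_pow _
    have hk := natRpow_pos q k.1
    have hl := natRpow_pos q l.1
    have hfk : ((2 * k.1)! : ℝ) ≠ 0 := by exact_mod_cast (Nat.factorial_pos _).ne'
    have hfl : ((2 * l.1)! : ℝ) ≠ 0 := by exact_mod_cast (Nat.factorial_pos _).ne'
    calc _ ≤ (C * (natRpow q k.1 * γ ^ k.1 / ((2 * k.1)! : ℝ))) *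
          (C * (natRpow q l.1 * γ ^ l.1 / ((2 * l.1)! : ℝ))) *
          ((bmax B ^ 2) ^ (k.1 + l.1) *
            ((4 ^ (k.1 + l.1) * (((2 * k.1)! : ℝ) * (2 * l.1)!)) * 1)) := by
          rw [factorial_two_mul_add]
          gcongr
          · exact hA k
          · exact hA l
      _ = _ := by
          rw [hy, mul_pow, mul_pow, mul_pow, mul_pow]
          simp only [pow_add]
          field_simp
  have hfin := tsum_ofReal_natRpow_mul_pow_lt_top K q hy0 hK
  calc QMC B a ≤ ∑' (k : Level K) (l : Level K),
        ENNReal.ofReal (C ^ 2) * (ENNReal.ofReal (natRpow q k.1 * y ^ k.1) *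
        ENNReal.ofReal (natRpow q l.1 * y ^ l.1)) :=
        ENNReal.tsum_le_tsum fun k => ENNReal.tsum_le_tsum fun l => hterm k l
    _ = ENNReal.ofReal (C ^ 2) * ((∑' k : Level K, ENNReal.ofReal (natRpow q k.1 * y ^ k.1)) *
        ∑' l : Level K, ENNReal.ofReal (natRpow q l.1 * y ^ l.1)) := by
        simp_rw [ENNReal.tsum_mul_left, ENNReal.tsum_mul_right]
    _ < ∞ := ENNReal.mul_lt_top ENNReal.ofReal_lt_top (ENNReal.mul_lt_top hfin hfin)

/-- By Pascal's rule each even-indexed coefficient of row `M + 1` is the sum of two neighbours in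
row `M`, and these neighbours exhaust the row. -/
theorem sum_range_choose_succ_two_mul (M m : ℕ) :
    ∑ k ∈ Finset.range (m + 1), (M + 1).choose (2 * k) =
      ∑ j ∈ Finset.range (2 * m + 1), M.choose j := by
  induction m with
  | zero => simp
  | succ m ih =>
    rw [Finset.sum_range_succ, ih, show 2 * (m + 1) + 1 = 2 * m + 1 + 1 + 1 by ring,
      Finset.sum_range_succ _ (2 * m + 1 + 1), Finset.sum_range_succ _ (2 * m + 1),
      show 2 * (m + 1) = 2 * m + 1 + 1 by ring, Nat.choose_succ_succ]
    ring

theorem sum_antidiagonal_choose_two_mul {n : ℕ} (hn : 1 ≤ n) :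
    ∑ p ∈ Finset.HasAntidiagonal.antidiagonal n, (((2 * n).choose (2 * p.1) : ℕ) : ℝ) = 4 ^ n / 2 := by
  obtain ⟨n, rfl⟩ : ∃ m, n = m + 1 := ⟨n - 1, by omega⟩
  rw [Finset.Nat.sum_antidiagonal_eq_sum_range_succ (fun i _ => (((2 * (n + 1)).choose (2 * i) : ℕ) : ℝ))]
  have h := sum_range_choose_succ_two_mul (2 * n + 1) (n + 1)
  rw [show 2 * (n + 1) + 1 = (2 * n + 1) + 1 + 1 by ring, Finset.sum_range_succ _ (2 * n + 1 + 1),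
    Nat.sum_range_choose, Nat.choose_eq_zero_of_lt (by omega)] at h
  rw [show 2 * (n + 1) = 2 * n + 1 + 1 by ring]
  have h2 : ((∑ k ∈ Finset.range (n + 1 + 1), (2 * n + 1 + 1).choose (2 * k) : ℕ) : ℝ) =
      ((2 ^ (2 * n + 1) + 0 : ℕ) : ℝ) := by rw [h]
  push_cast at h2
  rw [Nat.succ_eq_add_one, h2, pow_succ, pow_succ, pow_mul]
  norm_num
  ring

/-- A lower bound for `k^q l^q` in terms of `k + l`. -/
noncomputable def splitPow (q : ℝ) (n : ℕ) : ℝ :=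
  if 0 ≤ q then (2 : ℝ) ^ (-q) * (n : ℝ) ^ q else (n : ℝ) ^ (2 * q)

/-- For `k, l ≥ 1` one has `(k+l)/2 ≤ kl ≤ (k+l)²`; the first inequality serves `q ≥ 0`, the second
`q < 0`, whence the two cases of `RFun`. If one index is `0`, its factor is `1` by convention. -/
theorem splitPow_le_natRpow_mul {k l : ℕ} (h : 1 ≤ k + l) (q : ℝ) :
    splitPow q (k + l) ≤ natRpow q k * natRpow q l := by
  have aux : ∀ n : ℕ, 1 ≤ n → splitPow q n ≤ (n : ℝ) ^ q := by
    intro n hn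
    have hn1 : (1 : ℝ) ≤ n := by exact_mod_cast hn
    unfold splitPow
    split_ifs with hq
    · refine mul_le_of_le_one_left (by positivity) ?_
      exact Real.rpow_le_one_of_one_le_of_nonpos (by norm_num) (by linarith)
    · exact Real.rpow_le_rpow_of_exponent_le hn1 (by linarith)
  rcases Nat.eq_zero_or_pos k with rfl | hk
  · rw [natRpow, if_pos rfl, one_mul, zero_add, natRpow, if_neg (by omega)]
    exact aux l (by omega)
  rcases Nat.eq_zero_or_pos l with rfl | hl
  · rw [natRpow, natRpow, if_pos rfl, mul_one, add_zero, if_neg (by omega)]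
    exact aux k hk
  have hk1 : (1 : ℝ) ≤ k := by exact_mod_cast hk
  have hl1 : (1 : ℝ) ≤ l := by exact_mod_cast hl
  rw [natRpow, natRpow, if_neg hk.ne', if_neg hl.ne', ← Real.mul_rpow (by positivity) (by positivity)]
  unfold splitPow
  push_cast
  split_ifs with hq
  · rw [Real.rpow_neg (by norm_num), ← Real.inv_rpow (by norm_num),
      ← Real.mul_rpow (by norm_num) (by positivity)]
    refine Real.rpow_le_rpow (by positivity) ?_ hq
    nlinarith [mul_nonneg (sub_nonneg.2 hk1) (sub_nonneg.2 hl1)]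
  · rw [Real.rpow_mul (by positivity), Real.rpow_two]
    refine Real.rpow_le_rpow_of_nonpos (by positivity) ?_ (by linarith)
    nlinarith

/-- The double series is regrouped by `n = k + l`. Requiring `n ≤ K` keeps only complete
antidiagonals; for finite `K` the pairs with `k + l > K` are dropped. -/
theorem sum_antidiagonal_le_QMC {N : ℕ} {K : ℕ∞} (B : MatSpace N) (a : CoeffSpace N K)
    (F : ℕ × ℕ → ℝ) (hF0 : ∀ p, 0 ≤ F p)
    (hF : ∀ k l : Level K, F (k.1, l.1) ≤ ∑ I : MultiIdx N k, ∑ J : MultiIdx N l,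
      (a k I : ℝ) * a l J * hafnian (expand B.1 (I.1 + J.1)) ^ 2)
    (T : Finset ℕ) (hT : ∀ k ∈ T, (k : ℕ∞) ≤ K) :
    ENNReal.ofReal (∑ n ∈ T, ∑ p ∈ Finset.HasAntidiagonal.antidiagonal n, F p) ≤ QMC B a := by
  rw [← Finset.sum_biUnion]
  swap
  · intro n _ m _ hnm
    refine Finset.disjoint_left.2 fun p hp hp' => hnm ?_
    rw [Finset.HasAntidiagonal.mem_antidiagonal] at hp hp'
    rw [← hp, hp']
  set S := T.biUnion fun n => Finset.HasAntidiagonal.antidiagonal n with hS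
  set ι : Level K × Level K → ℕ × ℕ := fun p => (p.1.1, p.2.1) with hι
  have hinj : Function.Injective ι := fun p p' h => by
    have := Prod.mk.inj h
    exact Prod.ext (Subtype.ext this.1) (Subtype.ext this.2)
  have hsum : ∑ p ∈ S, F p = ∑ p ∈ S.preimage ι hinj.injOn, F (ι p) := by
    refine (Finset.sum_preimage ι S hinj.injOn F fun p hp hp' => ?_).symm
    obtain ⟨n, hn, hpn⟩ := Finset.mem_biUnion.1 hp
    rw [Finset.HasAntidiagonal.mem_antidiagonal] at hpn
    refine absurd ⟨(⟨p.1, ?_⟩, ⟨p.2, ?_⟩), rfl⟩ hp'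
    · exact le_trans (by exact_mod_cast (by omega : p.1 ≤ n)) (hT n hn)
    · exact le_trans (by exact_mod_cast (by omega : p.2 ≤ n)) (hT n hn)
  rw [hsum, ENNReal.ofReal_sum_of_nonneg fun p _ => hF0 _, QMC, ← ENNReal.tsum_prod]
  refine le_trans (Finset.sum_le_sum fun p _ => ?_) (ENNReal.sum_le_tsum (S.preimage ι hinj.injOn))
  rw [ofReal_level_mc]
  exact ENNReal.ofReal_le_ofReal (hF _ _)

theorem partial_sum_le_QMC {N : ℕ} (hN : 1 ≤ N) {K : ℕ∞} (B : MatSpace N) (a : CoeffSpace N K)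
    {D q γ : ℝ} (hD : 0 ≤ D) (hγ : 0 < γ) (hfin : QMC B a < ∞)
    (h0 : D ≤ coeffZero a)
    (h : ∀ k : Level K, 1 ≤ k.1 → D * ((k.1 : ℝ) ^ q * γ ^ k.1 / ((2 * k.1)! : ℝ)) ≤
      ∑ I : MultiIdx N k, (a k I : ℝ))
    (T : Finset ℕ) (hT : ∀ k ∈ T, 1 ≤ k ∧ (k : ℕ∞) ≤ K) :
    D ^ 2 * (1 + Real.exp (1 / 25 - 1 / 6) * (1 / (2 * √Real.pi) *
      ∑ n ∈ T, splitPow q n / √(n : ℝ) * (4 * γ * bmin B ^ 2) ^ n)) ≤ (QMC B a).toReal := by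
  have hb := bmin_pos hN B
  have hA : ∀ k : Level K, D * (natRpow q k.1 * γ ^ k.1 / ((2 * k.1)! : ℝ)) ≤
      ∑ I : MultiIdx N k, (a k I : ℝ) := by
    intro k
    rcases Nat.eq_zero_or_pos k.1 with hk | hk
    · rw [sum_level_zero a hk, hk]
      simpa [natRpow] using h0
    · rw [natRpow, if_neg hk.ne']
      exact h k hk
  set F : ℕ × ℕ → ℝ := fun p => (D * (natRpow q p.1 * γ ^ p.1 / ((2 * p.1)! : ℝ))) *
    (D * (natRpow q p.2 * γ ^ p.2 / ((2 * p.2)! : ℝ))) *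
    ((bmin B ^ 2) ^ (p.1 + p.2) * ((2 * (p.1 + p.2))! *
      ((p.1 + p.2).centralBinom / 4 ^ (p.1 + p.2)))) with hF
  have hAk : ∀ k : ℕ, 0 ≤ D * (natRpow q k * γ ^ k / ((2 * k)! : ℝ)) := fun k => by
    have := natRpow_pos q k
    positivity
  have hF0 : ∀ p, 0 ≤ F p := fun p => by
    have h1 := hAk p.1
    have h2 := hAk p.2
    positivity
  have hFle : ∀ k l : Level K, F (k.1, l.1) ≤ ∑ I : MultiIdx N k, ∑ J : MultiIdx N l,
      (a k I : ℝ) * a l J * hafnian (expand B.1 (I.1 + J.1)) ^ 2 := by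
    intro k l
    refine le_trans ?_ (le_level_mc hN B a k l)
    have h1 := hAk k.1
    have h2 := hAk l.1
    simp only [hF]
    gcongr
    · exact hA k
    · exact hA l
  have hFn : ∀ n ∈ T, D ^ 2 * (Real.exp (1 / 25 - 1 / 6) * (1 / (2 * √Real.pi) *
      (splitPow q n / √(n : ℝ) * (4 * γ * bmin B ^ 2) ^ n))) ≤
      ∑ p ∈ Finset.HasAntidiagonal.antidiagonal n, F p := by
    intro n hn
    have hn1 := (hT n hn).1
    have hcb := (exp_div_sqrt_lt_centralBinom hn1).le
    have hsp : 0 ≤ splitPow q n := by unfold splitPow; split_ifs <;> positivity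
    calc D ^ 2 * (Real.exp (1 / 25 - 1 / 6) * (1 / (2 * √Real.pi) *
          (splitPow q n / √(n : ℝ) * (4 * γ * bmin B ^ 2) ^ n)))
        = (4 ^ n / 2) * (D ^ 2 * splitPow q n * (γ * bmin B ^ 2) ^ n *
            (1 / √Real.pi * Real.exp (1 / 25 - 1 / 6) / √(n : ℝ))) := by
          rw [mul_assoc 4 γ, mul_pow 4]
          ring
      _ = ∑ p ∈ Finset.HasAntidiagonal.antidiagonal n, (((2 * n).choose (2 * p.1) : ℕ) : ℝ) *
            (D ^ 2 * splitPow q n * (γ * bmin B ^ 2) ^ n *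
            (1 / √Real.pi * Real.exp (1 / 25 - 1 / 6) / √(n : ℝ))) := by
          rw [← sum_antidiagonal_choose_two_mul hn1, Finset.sum_mul]
      _ ≤ _ := by
          refine Finset.sum_le_sum fun p hp => ?_
          obtain rfl := Finset.HasAntidiagonal.mem_antidiagonal.1 hp
          have hs := splitPow_le_natRpow_mul hn1 q
          have hp1 := natRpow_pos q p.1
          have hp2 := natRpow_pos q p.2
          have hfk : ((2 * p.1)! : ℝ) ≠ 0 := by exact_mod_cast (Nat.factorial_pos _).ne'
          have hfl : ((2 * p.2)! : ℝ) ≠ 0 := by exact_mod_cast (Nat.factorial_pos _).ne'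
          calc _ ≤ (((2 * (p.1 + p.2)).choose (2 * p.1) : ℕ) : ℝ) *
                (D ^ 2 * (natRpow q p.1 * natRpow q p.2) * (γ * bmin B ^ 2) ^ (p.1 + p.2) *
                (((p.1 + p.2).centralBinom : ℝ) / 4 ^ (p.1 + p.2))) := by gcongr
            _ = _ := by
                simp only [hF]
                rw [factorial_two_mul_add, mul_pow γ, pow_add γ]
                field_simp
  have h0T : (0 : ℕ) ∉ T := fun h => by have := (hT 0 h).1; omega
  -- Order `0` is added separately; it contributes `D²`, the summand `1` in the parenthesis.
  have hmain := sum_antidiagonal_le_QMC B a F hF0 hFle (insert 0 T) (fun k hk => by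
    rcases Finset.mem_insert.1 hk with rfl | hk
    · simp
    · exact (hT k hk).2)
  rw [ENNReal.ofReal_le_iff_le_toReal hfin.ne, Finset.sum_insert h0T] at hmain
  refine le_trans ?_ hmain
  rw [mul_add, mul_one, Finset.mul_sum, Finset.mul_sum, Finset.mul_sum]
  refine add_le_add ?_ (Finset.sum_le_sum hFn)
  simp [hF, natRpow, sq]

theorem le_QMC {N : ℕ} (hN : 1 ≤ N) {K : ℕ∞} (B : MatSpace N) (a : CoeffSpace N K)
    {D q γ : ℝ} (hD : 0 < D) (hγ : 0 < γ) (hK : K = ⊤ → 4 * γ * bmin B ^ 2 < 1)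
    (hfin : QMC B a < ∞) (h0 : D ≤ coeffZero a)
    (h : ∀ k : Level K, 1 ≤ k.1 → D * ((k.1 : ℝ) ^ q * γ ^ k.1 / ((2 * k.1)! : ℝ)) ≤
      ∑ I : MultiIdx N k, (a k I : ℝ)) :
    D ^ 2 * (1 + Real.exp (1 / 25 - 1 / 6) * RFun q K (4 * γ * bmin B ^ 2)) ≤
      (QMC B a).toReal := by
  have hpart := partial_sum_le_QMC hN B a hD.le hγ hfin h0 h
  set z := 4 * γ * bmin B ^ 2 with hz
  have hz0 : 0 ≤ z := by positivity
  set E := Real.exp (1 / 25 - 1 / 6) with hE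
  have hE0 : 0 < E := Real.exp_pos _
  have hpi : 0 < √Real.pi := Real.sqrt_pos.2 Real.pi_pos
  -- Both branches of `RFun` have the shape `κ · Li_{1/2-p}`: `κ = 2^(-q)`, `p = q` for `q ≥ 0`, and
  -- `κ = 1`, `p = 2q` otherwise.
  suffices hs : ∀ κ p : ℝ, 0 < κ → (∀ n : ℕ, 1 ≤ n → splitPow q n / √(n : ℝ) * z ^ n =
      κ * (z ^ n / (n : ℝ) ^ (1 / 2 - p))) →
      D ^ 2 * (1 + E * (1 / (2 * √Real.pi) * (κ * polyLog (1 / 2 - p) K z))) ≤ (QMC B a).toReal by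
    unfold RFun
    split_ifs with hq
    · refine le_trans (le_of_eq ?_) (hs ((2 : ℝ) ^ (-q)) q (by positivity) fun n hn => ?_)
      · ring
      · rw [div_rpow_half_sub n hn, splitPow, if_pos hq]; ring
    · refine le_trans (le_of_eq ?_) (hs 1 (2 * q) one_pos fun n hn => ?_)
      · ring
      · rw [div_rpow_half_sub n hn, splitPow, if_neg hq]; ring
  intro κ p hκ hterm
  have hle : polyLog (1 / 2 - p) K z ≤
      (((QMC B a).toReal / D ^ 2 - 1) / E) * (2 * √Real.pi) / κ := by
    refine polyLog_le_of_sum_le _ hz0 hK fun T hT => ?_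
    have h1 := hpart T hT
    rw [Finset.sum_congr rfl fun n hn => hterm n (hT n hn).1, ← Finset.mul_sum] at h1
    rw [le_div_iff₀ hκ, ← div_le_iff₀ (by positivity), le_div_iff₀ hE0, le_sub_iff_add_le,
      le_div_iff₀ (by positivity)]
    refine le_trans (le_of_eq ?_) h1
    ring
  rw [le_div_iff₀ hκ, ← div_le_iff₀ (by positivity), le_div_iff₀ hE0, le_sub_iff_add_le,
      le_div_iff₀ (by positivity)] at hle
  refine le_trans (le_of_eq ?_) hle
  ring

/-! ### Comparison of the two sample sizes -/

theorem one_le_c₁ {N : ℕ} (K : ℕ∞) (q : ℝ) {γ : ℝ} (hγ : 0 < γ) (B : MatSpace N) :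
    1 ≤ c₁ K q γ B := by
  have := polyLog_nonneg (1 / 2 - q) K (z := γ * bmin B ^ 2) (by positivity)
  unfold c₁
  exact le_add_of_nonneg_right (by positivity)

theorem one_le_c₂ {N : ℕ} (K : ℕ∞) (q : ℝ) {γ : ℝ} (hγ : 0 < γ) (B : MatSpace N) :
    1 ≤ c₂ K q γ B := by
  have := polyLog_nonneg (1 / 2 - q) K (z := γ * bmax B ^ 2) (by positivity)
  unfold c₂
  exact le_add_of_nonneg_right (by positivity)

theorem sampleSize_eq_ofReal {ε δ : ℝ} (hε : 0 < ε) (hδ : 0 < δ) {Q μ : ℝ≥0∞} (hQ : Q < ∞)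
    (hμ : μ < ∞) (hμ0 : μ ≠ 0) :
    sampleSize ε δ Q μ =
      ENNReal.ofReal ((Q.toReal - μ.toReal ^ 2) / (δ * ε ^ 2 * μ.toReal ^ 2)) := by
  have hm : 0 < μ.toReal := ENNReal.toReal_pos hμ0 hμ.ne
  rw [sampleSize, ENNReal.ofReal_div_of_pos (by positivity), ENNReal.ofReal_sub _ (by positivity),
    ENNReal.ofReal_mul (p := δ * ε ^ 2) (by positivity), ENNReal.ofReal_pow hm.le, ENNReal.ofReal_toReal hQ.ne,
    ENNReal.ofReal_toReal hμ.ne]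

/-- The exponents of the geometric growth are ordered if the lower bounds on the coefficients stay
below the upper bounds at all orders. -/
theorem le_of_forall_mul_rpow_mul_pow_lt {x y p q α β : ℝ} (hx : 0 < x) (hα : 0 < α) (hβ : 0 < β)
    (h : ∀ k : ℕ, 1 ≤ k → x * ((k : ℝ) ^ p * α ^ k) < y * ((k : ℝ) ^ q * β ^ k)) : α ≤ β := by
  by_contra hlt
  push Not at hlt
  have ht : β / α < 1 := (div_lt_one hα).2 hlt
  -- If `β < α`, the factor `(β/α)^k` beats every power of `k`, so the assumed inequality fails for
  -- large `k`.
  have hlim := (summable_pow_div_rpow (p - q) (by positivity : 0 ≤ β / α) ht).tendsto_atTop_zero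
  have hlim2 := hlim.const_mul y
  rw [mul_zero] at hlim2
  obtain ⟨k, hk, hk1⟩ := ((hlim2.eventually (gt_mem_nhds hx)).and
    (Filter.eventually_ge_atTop 1)).exists
  have hk0 : (0 : ℝ) < k := by exact_mod_cast hk1
  have h1 := h k hk1
  rw [Real.rpow_sub hk0, div_pow] at hk
  have hp := Real.rpow_pos_of_pos hk0 p
  have hq := Real.rpow_pos_of_pos hk0 q
  have hak : 0 < α ^ k := by positivity
  have h2 : y * ((k : ℝ) ^ q * β ^ k) / ((k : ℝ) ^ p * α ^ k) < x := by
    refine lt_of_eq_of_lt ?_ hk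
    field_simp
  rw [div_lt_iff₀ (by positivity)] at h2
  exact lt_asymm h1 h2

/-- The scalar inequality behind the exponential separation. -/
theorem mul_exp_lt_of_log_lt {D s₁ s₂ U T Lc R c : ℝ} (hD : 0 < D) (hs₁ : 0 < s₁) (hc : 0 < c)
    (hR : 0 ≤ R) (hU : 1 ≤ U) (hT : T = c ^ 2 * (1 + R)) (hL : Lc = s₁ / D * U)
    (h : Lc < Real.log (1 + R) + 2 * Real.log c - Real.log (D + 1) + s₁ / D -
      Real.log (max s₂ 1)) :
    s₂ * Real.exp (s₁ * ((U - 1) / D)) < (T - 1) / D := by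
  have hmax : 0 < max s₂ 1 := lt_max_of_lt_right one_pos
  have hlogT : Real.log T = Real.log (1 + R) + 2 * Real.log c := by
    rw [hT, Real.log_mul (by positivity) (by positivity), Real.log_pow]
    push_cast; ring
  have hT0 : 0 < T := by rw [hT]; positivity
  set X := s₁ * ((U - 1) / D) with hX
  have hXL : X = Lc - s₁ / D := by rw [hX, hL]; ring
  have hX0 : 0 ≤ X := mul_nonneg hs₁.le (div_nonneg (by linarith) hD.le)
  have h1 : X + Real.log (D + 1) + Real.log (max s₂ 1) < Real.log T := by
    rw [hlogT, hXL]; linarith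
  -- Of the `D + 1` copies of `e^X max(s₂, 1)`, one is at least `1` and absorbs the `-1` in `T - 1`;
  -- the other `D` dominate `s₂ e^X D`.
  have h2 : Real.exp X * (D + 1) * max s₂ 1 < T := by
    have := Real.exp_lt_exp.2 h1
    rwa [Real.exp_add, Real.exp_add, Real.exp_log (by positivity), Real.exp_log hmax,
      Real.exp_log hT0] at this
  have h3 : 1 ≤ Real.exp X := Real.one_le_exp hX0
  rw [lt_div_iff₀ hD]
  have h4 : s₂ ≤ max s₂ 1 := le_max_left _ _
  have h5 : 1 ≤ max s₂ 1 := le_max_right _ _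
  have h6 : s₂ * Real.exp X * D ≤ max s₂ 1 * Real.exp X * D := by gcongr
  have h7 : 1 ≤ Real.exp X * max s₂ 1 := by nlinarith
  nlinarith

/-- After division by `μ²`, the GBS second moment is at most `U` and the Monte Carlo one is at least
`c₂^(-2) (1 + R)`; the scalar inequality then applies. -/
theorem exponential_separation {N : ℕ} (hN : 1 ≤ N) {ε δ s₁ s₂ : ℝ} (hε : 0 < ε) (hδ : 0 < δ)
    (hs₁ : 0 < s₁) (hs₂ : 0 < s₂) {K : ℕ∞} {γα γβ qα qβ : ℝ} (hα : 0 < γα) (hβ : 0 < γβ)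
    {B : MatSpace N} (hB : B ∈ matSetαβ N K ε δ s₁ s₂ γα γβ qα qβ)
    {a : CoeffSpace N K} (ha : CoeffCond γα γβ qα qβ B a) :
    a ∈ coeffSet B ∧ nGBS ε δ B a < ∞ ∧
      ENNReal.ofReal (s₂ * Real.exp (s₁ * (nGBS ε δ B a).toReal)) < nMC ε δ B a ∧
      nMC ε δ B a < ∞ := by
  obtain ⟨hc, hgrow, hlog, hK⟩ := hB
  obtain ⟨-, hlt0, h0lt, hle, hsum, hsq⟩ := ha
  have hb := bmin_pos hN B
  have hbb := bmin_le_bmax hN B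
  have hc1 := one_le_c₁ K qα hα B
  have hc2 := one_le_c₂ K qβ hβ B
  have hd := gbsConst_pos B
  set m := (mu B a).toReal with hm
  -- If `μ` were `0` or `∞`, its real value would be `0` and the strict bounds on `a_0` would read
  -- `0 < a_0 < 0`.
  have hm0 : 0 < m := by
    have := hlt0.trans h0lt
    by_contra hcon
    have hmz : m = 0 := le_antisymm (not_lt.1 hcon) ENNReal.toReal_nonneg
    rw [hmz] at this
    simp at this
  have hmu0 : mu B a ≠ 0 := fun h => by rw [hm, h] at hm0; simp at hm0
  have hmut : mu B a < ∞ := lt_top_iff_ne_top.2 fun h => by rw [hm, h] at hm0; simp at hm0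
  set C := (c₁ K qα γα B)⁻¹ * m with hC
  set D := (c₂ K qβ γβ B)⁻¹ * m with hDdef
  have hC0 : 0 < C := by positivity
  have hD0 : 0 < D := by positivity
  have hsq' := sqSum_le hN B a (C := C) hβ (fun h => (hK h).2) h0lt.le (fun k hk => by
    refine (hsq k hk).trans (le_of_eq ?_)
    rw [hC]; ring)
  have hsqt : sqSum B a < ∞ := hsq'.trans_lt ENNReal.ofReal_lt_top
  have hQM : QMC B a < ∞ := QMC_lt_top B a hC0.le hβ (fun h => (hK h).1) h0lt.le hsum
  -- For `K = ⊤` the growth comparison holds at every order and forces `γ_α ≤ γ_β`, so the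
  -- convergence condition for `γ_β` and `b_max` passes to `γ_α` and `b_min`.
  have hα1 : K = ⊤ → 4 * γα * bmin B ^ 2 < 1 := fun h => by
    have hle : γα ≤ γβ := le_of_forall_mul_rpow_mul_pow_lt (x := (c₂ K qβ γβ B)⁻¹)
      (y := (c₁ K qα γα B)⁻¹) (by positivity) hα hβ fun k hk => hgrow k hk (by rw [h]; exact le_top)
    refine lt_of_le_of_lt ?_ (hK h).1
    gcongr
  have hQMle := le_QMC hN B a hD0 hα hα1 hQM hlt0.le hle
  have hQG : QGBS B a < ∞ := ENNReal.mul_lt_top ENNReal.ofReal_lt_top hsqt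
  set G := GFun (2 * qβ) K N (γβ * bmax B) with hG
  set R := Real.exp (1 / 25 - 1 / 6) * RFun qα K (4 * γα * bmin B ^ 2) with hR
  set U := (c₁ K qα γα B)⁻¹ ^ 2 / gbsConst B * (1 + 1 / √Real.pi * G) with hU
  have hR0 : 0 ≤ R := by
    have h1 := polyLog_nonneg (1 / 2 - qα) K (z := 4 * γα * bmin B ^ 2) (by positivity)
    have h2 := polyLog_nonneg (1 / 2 - 2 * qα) K (z := 4 * γα * bmin B ^ 2) (by positivity)
    rw [hR]
    unfold RFun
    split_ifs <;> positivity
  have hmsq : m ^ 2 ≤ (QGBS B a).toReal := by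
    have := ENNReal.toReal_mono hQG.ne (mu_sq_le_QGBS B a)
    rwa [ENNReal.toReal_pow] at this
  have hG1 : 0 ≤ C ^ 2 * (1 + 1 / √Real.pi * G) := by
    by_contra hneg
    rw [ENNReal.ofReal_of_nonpos (not_le.1 hneg).le, nonpos_iff_eq_zero] at hsq'
    rw [QGBS, hsq', mul_zero, ENNReal.toReal_zero] at hmsq
    nlinarith [pow_pos hm0 2]
  have hQGle : (QGBS B a).toReal ≤ U * m ^ 2 := by
    have h1 : QGBS B a ≤ ENNReal.ofReal (1 / gbsConst B * (C ^ 2 * (1 + 1 / √Real.pi * G))) := by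
      rw [ENNReal.ofReal_mul (by positivity), QGBS]
      gcongr
    refine (ENNReal.toReal_mono ENNReal.ofReal_ne_top h1).trans (le_of_eq ?_)
    rw [ENNReal.toReal_ofReal (mul_nonneg (by positivity) hG1), hU, hC]
    ring
  -- This follows from `m² ≤ Q^GBS ≤ U m²`, and makes the exponent in the scalar inequality
  -- nonnegative.
  have hU1 : 1 ≤ U := by
    have : 1 * m ^ 2 ≤ U * m ^ 2 := by rw [one_mul]; exact hmsq.trans hQGle
    exact le_of_mul_le_mul_right this (by positivity)
  have hED : 0 < ε ^ 2 * δ := by positivity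
  have hmain := mul_exp_lt_of_log_lt (D := ε ^ 2 * δ) (s₂ := s₂) (U := U)
    (T := (c₂ K qβ γβ B)⁻¹ ^ 2 * (1 + R)) hED hs₁ (inv_pos.2 (by linarith : 0 < c₂ K qβ γβ B)) hR0
    hU1 rfl (by rw [hU, mul_assoc]) hlog
  refine ⟨⟨hmu0, hmut, hsqt, hQM⟩, ?_, ?_, ?_⟩
  · rw [nGBS, sampleSize_eq_ofReal hε hδ hQG hmut hmu0]
    exact ENNReal.ofReal_lt_top
  · rw [nGBS, nMC, sampleSize_eq_ofReal hε hδ hQG hmut hmu0,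
      sampleSize_eq_ofReal hε hδ hQM hmut hmu0]
    have hlt : s₂ * Real.exp (s₁ * ((U - 1) / (ε ^ 2 * δ))) <
        ((QMC B a).toReal - m ^ 2) / (δ * ε ^ 2 * m ^ 2) := by
      refine hmain.trans_le ?_
      rw [div_le_div_iff₀ hED (by positivity)]
      have h2 : (c₂ K qβ γβ B)⁻¹ ^ 2 * (1 + R) * m ^ 2 ≤ (QMC B a).toReal := by
        refine le_trans (le_of_eq ?_) hQMle
        rw [hDdef, hR]; ring
      calc ((c₂ K qβ γβ B)⁻¹ ^ 2 * (1 + R) - 1) * (δ * ε ^ 2 * m ^ 2)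
          = ((c₂ K qβ γβ B)⁻¹ ^ 2 * (1 + R) * m ^ 2 - m ^ 2) * (ε ^ 2 * δ) := by ring
        _ ≤ _ := by gcongr
    have hnG : (ENNReal.ofReal (((QGBS B a).toReal - m ^ 2) / (δ * ε ^ 2 * m ^ 2))).toReal ≤
        (U - 1) / (ε ^ 2 * δ) := by
      rw [ENNReal.toReal_ofReal (div_nonneg (sub_nonneg.2 hmsq) (by positivity)),
        div_le_div_iff₀ (by positivity) hED]
      calc ((QGBS B a).toReal - m ^ 2) * (ε ^ 2 * δ) ≤ (U * m ^ 2 - m ^ 2) * (ε ^ 2 * δ) := by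
            gcongr
        _ = _ := by ring
    have hpos : 0 < s₂ * Real.exp (s₁ * ((U - 1) / (ε ^ 2 * δ))) := by positivity
    rw [ENNReal.ofReal_lt_ofReal_iff (hpos.trans hlt)]
    refine lt_of_le_of_lt ?_ hlt
    gcongr
  · rw [nMC, sampleSize_eq_ofReal hε hδ hQM hmut hmu0]
    exact ENNReal.ofReal_lt_top

/-! ### Admissible matrices -/

/-- Gershgorin's theorem: for positive entries the right end of each disc is a row sum. -/
theorem eigenvalues_le_of_entries {N : ℕ} (B : MatSpace N) {c : ℝ} (h : ∀ i j, B.1 i j ≤ c)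
    (j : Fin N) : B.isHermitian.eigenvalues j ≤ N * c := by
  have hev : Module.End.HasEigenvalue (Matrix.toLin' B.1) (B.isHermitian.eigenvalues j) := by
    rw [Module.End.hasEigenvalue_iff_mem_spectrum, Matrix.spectrum_toLin']
    exact B.isHermitian.eigenvalues_mem_spectrum_real j
  obtain ⟨k, hk⟩ := eigenvalue_mem_ball hev
  rw [Metric.mem_closedBall, Real.dist_eq] at hk
  have h1 : B.isHermitian.eigenvalues j ≤ B.1 k k + ∑ j ∈ Finset.univ.erase k, ‖B.1 k j‖ := by
    linarith [le_abs_self (B.isHermitian.eigenvalues j - B.1 k k)]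
  have h2 : ∀ j, ‖B.1 k j‖ = B.1 k j := fun j => Real.norm_of_nonneg (B.2.1 _ _).le
  simp_rw [h2] at h1
  rw [Finset.add_sum_erase _ _ (Finset.mem_univ k)] at h1
  refine h1.trans ((Finset.sum_le_sum fun j _ => h k j).trans ?_)
  simp

/-- Eigenvalues are at most `5/8`, so `1 - λ² ≥ 39/64 > 1/4`. The value `5/8` is `(1 + t)/2` at the
largest width `t = 1/4`. -/
theorem half_pow_le_gbsConst {N : ℕ} (hN : 1 ≤ N) (B : MatSpace N)
    (h : ∀ i j, B.1 i j ≤ 5 / (8 * N)) : (1 / 2 : ℝ) ^ N ≤ gbsConst B := by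
  have hN0 : (0 : ℝ) < N := by exact_mod_cast hN
  have hp : ∏ _j : Fin N, (1 / 2 : ℝ) = (1 / 2) ^ N := by simp
  rw [gbsConst, ← hp]
  refine Finset.prod_le_prod (fun _ _ => by norm_num) fun j _ => Real.le_sqrt_of_sq_le ?_
  have h1 := eigenvalues_le_of_entries B h j
  have h2 := (eigenvalues_mem_Ioo B j).1
  have h3 : (N : ℝ) * (5 / (8 * N)) = 5 / 8 := by field_simp
  rw [h3] at h1
  nlinarith

theorem GFun_mono {N : ℕ} (hN : 1 ≤ N) (q : ℝ) {K K' : ℕ∞} (hK : K ≤ K') {z z' : ℝ} (hz : 0 ≤ z)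
    (hzz : z ≤ z') (hzN : K' = ⊤ → z' < N) : GFun q K N z ≤ GFun q K' N z' := by
  have hN0 : (0 : ℝ) < N := by exact_mod_cast hN
  have hz' := hz.trans hzz
  have hpi := Real.pi_pos
  have hmap : ENat.map (blockQuot N) K ≤ ENat.map (blockQuot N) K' := by
    cases K' with
    | top => exact le_top
    | coe K' =>
      lift K to ℕ using ne_top_of_le_ne_top (ENat.natCast_ne_top K') hK
      exact Nat.cast_le.2 (blockQuot_mono (Nat.cast_le.1 hK))
  have h1 : fFun q (N / 2) z ≤ fFun q (N / 2) z' := by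
    unfold fFun
    gcongr
  have h2 : polyLog 0 N (2 * z / N) ≤ polyLog 0 N (2 * z' / N) :=
    polyLog_mono 0 le_rfl (by positivity) (by gcongr) fun h => absurd h (ENat.natCast_ne_top N)
  have h3 : polyLog (1 / 2 - (N : ℝ) / 2 - q) (ENat.map (blockQuot N) K) (z ^ N / (N : ℝ) ^ N) ≤
      polyLog (1 / 2 - (N : ℝ) / 2 - q) (ENat.map (blockQuot N) K') (z' ^ N / (N : ℝ) ^ N) :=
    polyLog_mono _ hmap (by positivity) (by gcongr)
      fun h => pow_div_pow_lt_one hN hz' (hzN (map_blockQuot_eq_top h))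
  have h4 := polyLog_nonneg 0 N (z := 2 * z' / N) (by positivity)
  have h5 := polyLog_nonneg (1 / 2 - (N : ℝ) / 2 - q) (ENat.map (blockQuot N) K)
    (z := z ^ N / (N : ℝ) ^ N) (by positivity)
  unfold GFun
  gcongr

theorem GFun_nonneg (N : ℕ) (q : ℝ) (K : ℕ∞) {z : ℝ} (hz : 0 ≤ z) : 0 ≤ GFun q K N z := by
  have hpi := Real.pi_pos
  have h4 := polyLog_nonneg 0 N (z := 2 * z / N) (by positivity)
  have h5 := polyLog_nonneg (1 / 2 - (N : ℝ) / 2 - q) (ENat.map (blockQuot N) K)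
    (z := z ^ N / (N : ℝ) ^ N) (by positivity)
  unfold GFun fFun
  positivity

theorem exp_lt_one : Real.exp (1 / 25 - 1 / 6) < 1 := by
  rw [Real.exp_lt_one_iff]; norm_num

theorem polyLog_pos (s : ℝ) {K : ℕ∞} (hK : 1 ≤ K) {z : ℝ} (hz : 0 < z) (hz1 : K = ⊤ → z < 1) :
    0 < polyLog s K z := by
  have := sum_le_polyLog s hz.le hz1 {1} (fun k hk => by
    rw [Finset.mem_singleton.1 hk]; exact ⟨le_rfl, by exact_mod_cast hK⟩)
  rw [Finset.sum_singleton] at this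
  refine lt_of_lt_of_le ?_ this
  simpa using hz

theorem c₁_lt_c₂ {N : ℕ} (hN : 1 ≤ N) {K : ℕ∞} (hK : 1 ≤ K) (q : ℝ) {γ : ℝ} (hγ : 0 < γ)
    (B : MatSpace N) (h : K = ⊤ → γ * bmax B ^ 2 < 1) : c₁ K q γ B < c₂ K q γ B := by
  have hb := bmin_pos hN B
  have hbb := bmin_le_bmax hN B
  have h1 : polyLog (1 / 2 - q) K (γ * bmin B ^ 2) ≤ polyLog (1 / 2 - q) K (γ * bmax B ^ 2) :=
    polyLog_mono _ le_rfl (by positivity) (by gcongr) h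
  have h2 : 0 < polyLog (1 / 2 - q) K (γ * bmin B ^ 2) :=
    polyLog_pos _ hK (by positivity) fun hk => lt_of_le_of_lt (by gcongr) (h hk)
  have hpi : 0 < √Real.pi := Real.sqrt_pos.2 Real.pi_pos
  unfold c₁ c₂
  have h3 := exp_lt_one
  have h4 : Real.exp (1 / 25 - 1 / 6) * polyLog (1 / 2 - q) K (γ * bmin B ^ 2) <
      polyLog (1 / 2 - q) K (γ * bmax B ^ 2) := by nlinarith
  rw [mul_assoc]
  gcongr

theorem lt_log_one_add_of_exp_le {c x : ℝ} (h : Real.exp c ≤ x) : c < Real.log (1 + x) := by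
  have : 0 < x := (Real.exp_pos c).trans_le h
  rw [Real.lt_log_iff_exp_lt (by linarith)]
  linarith

/-- The part of the admissibility condition that does not involve `R_{q,K}`, made uniform in the
matrix and in `K`. -/
noncomputable def logThreshold (N : ℕ) (ε δ s₁ s₂ : ℝ) : ℝ :=
  s₁ / (ε ^ 2 * δ) * 2 ^ N * (1 + 1 / √Real.pi * GFun (2 * (1 / 2)) ⊤ N (N / 2)) +
    2 * Real.log (1 + 1 / √Real.pi * polyLog (1 / 2 - 1 / 2) ⊤ (1 / 4)) +
    Real.log (ε ^ 2 * δ + 1) - s₁ / (ε ^ 2 * δ) + Real.log (max s₂ 1)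

/-- The choice `γ = N² / (1+t)²` gives `1/(1+t)² ≤ 4γ b_min²` and `4γ b_max² < 1`. At `q = 1/2` the
polylogarithm has exponent `0`, so its first `K₀` terms are powers of at least `1/2` each. The
remaining quantities are bounded by constants: `γ b_max ≤ N/2`, `γ b_max² ≤ 1/4`, and `c₁^(-2) / d ≤
2^N`. -/
theorem mem_matSetαβ_of_entries {N : ℕ} (hN : 1 ≤ N) {ε δ s₁ s₂ : ℝ} (hε : 0 < ε) (hδ : 0 < δ)
    (hs₁ : 0 < s₁) {K₀ : ℕ} (hK₀ : 1 ≤ K₀) {t : ℝ} (ht0 : 0 < t) (ht : t ≤ 1 / 4)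
    (htK : 1 / 2 ≤ (1 / (1 + t) ^ 2) ^ K₀)
    (hL : Real.exp (logThreshold N ε δ s₁ s₂) ≤ Real.exp (1 / 25 - 1 / 6) *
      ((2 : ℝ) ^ (-(1 / 2 : ℝ)) * (1 / (2 * √Real.pi)) * (K₀ * (1 / 2))))
    {K : ℕ∞} (hK : K₀ ≤ K) (B : MatSpace N)
    (hB : ∀ i j, 1 / (2 * N) < B.1 i j ∧ B.1 i j < (1 + t) / (2 * N)) :
    B ∈ matSetαβ N K ε δ s₁ s₂ (N ^ 2 / (1 + t) ^ 2) (N ^ 2 / (1 + t) ^ 2) (1 / 2) (1 / 2) := by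
  have hN0 : (0 : ℝ) < N := by exact_mod_cast hN
  have hb0 := bmin_pos hN B
  have hbb := bmin_le_bmax hN B
  have hbM0 := hb0.trans_le hbb
  have hbm : 1 / (2 * N) < bmin B := lt_bmin hN B fun i j => (hB i j).1
  have hbM : bmax B < (1 + t) / (2 * N) := bmax_lt hN B fun i j => (hB i j).2
  have hK1 : 1 ≤ K := le_trans (by exact_mod_cast hK₀) hK
  have hpi : 0 < √Real.pi := Real.sqrt_pos.2 Real.pi_pos
  set γ : ℝ := N ^ 2 / (1 + t) ^ 2 with hγdef
  have hγ : 0 < γ := by positivity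
  have h4 : 4 * γ * bmax B ^ 2 < 1 := by
    calc 4 * γ * bmax B ^ 2 < 4 * γ * ((1 + t) / (2 * N)) ^ 2 := by gcongr
      _ = 1 := by rw [hγdef]; field_simp; norm_num
  have hγN : γ * bmax B ≤ N / 2 := by
    calc γ * bmax B ≤ γ * ((1 + t) / (2 * N)) := by gcongr
      _ = N / 2 / (1 + t) := by rw [hγdef]; field_simp
      _ ≤ N / 2 := div_le_self (by positivity) (by linarith)
  have hz : 1 / (1 + t) ^ 2 ≤ 4 * γ * bmin B ^ 2 := by
    calc 1 / (1 + t) ^ 2 = 4 * γ * (1 / (2 * N)) ^ 2 := by rw [hγdef]; field_simp; norm_num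
      _ ≤ _ := by gcongr
  have hz1 : 4 * γ * bmin B ^ 2 < 1 := lt_of_le_of_lt (by gcongr) h4
  have hc := c₁_lt_c₂ hN hK1 (1 / 2) hγ B (fun _ => by nlinarith)
  have hc1 := one_le_c₁ K (1 / 2) hγ B
  have hc2 := one_le_c₂ K (1 / 2) hγ B
  have hcinv : (c₂ K (1 / 2) γ B)⁻¹ < (c₁ K (1 / 2) γ B)⁻¹ := by gcongr
  refine ⟨hcinv, fun k hk _ => ?_, ?_, fun _ => ⟨h4, hγN.trans_lt (by linarith)⟩⟩
  · have hk0 : (0 : ℝ) < k := by exact_mod_cast hk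
    exact mul_lt_mul_of_pos_right hcinv (by positivity)
  have hd : (1 / 2 : ℝ) ^ N ≤ gbsConst B := half_pow_le_gbsConst hN B fun i j => by
    refine (hB i j).2.le.trans ?_
    rw [div_le_div_iff₀ (by positivity) (by positivity)]
    nlinarith
  have hG0 := GFun_nonneg N (2 * (1 / 2)) K (z := γ * bmax B) (by positivity)
  have hG := GFun_mono hN (2 * (1 / 2)) (le_top : K ≤ ⊤) (z := γ * bmax B) (z' := N / 2)
    (by positivity) hγN (fun _ => by linarith)
  have hcd : (c₁ K (1 / 2) γ B)⁻¹ ^ 2 / gbsConst B ≤ 2 ^ N := by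
    calc (c₁ K (1 / 2) γ B)⁻¹ ^ 2 / gbsConst B ≤ 1 / (1 / 2) ^ N := by
          gcongr
          exact pow_le_one₀ (by positivity) (inv_le_one_of_one_le₀ hc1)
      _ = 2 ^ N := by simp
  have hlhs : s₁ / (ε ^ 2 * δ) * ((c₁ K (1 / 2) γ B)⁻¹ ^ 2 / gbsConst B) *
      (1 + 1 / √Real.pi * GFun (2 * (1 / 2)) K N (γ * bmax B)) ≤
      s₁ / (ε ^ 2 * δ) * 2 ^ N * (1 + 1 / √Real.pi * GFun (2 * (1 / 2)) ⊤ N (N / 2)) := by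
    gcongr
  have hc2le : c₂ K (1 / 2) γ B ≤ 1 + 1 / √Real.pi * polyLog (1 / 2 - 1 / 2) ⊤ (1 / 4) := by
    unfold c₂
    gcongr
    exact polyLog_mono _ le_top (by positivity) (by linarith) fun _ => by norm_num
  have hlogc : Real.log (c₂ K (1 / 2) γ B) ≤
      Real.log (1 + 1 / √Real.pi * polyLog (1 / 2 - 1 / 2) ⊤ (1 / 4)) :=
    Real.log_le_log (by linarith) hc2le
  have hR : (2 : ℝ) ^ (-(1 / 2 : ℝ)) * (1 / (2 * √Real.pi)) * (K₀ * (1 / 2)) ≤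
      RFun (1 / 2) K (4 * γ * bmin B ^ 2) := by
    rw [RFun, if_pos (by norm_num)]
    gcongr
    refine le_trans ?_ (sum_le_polyLog _ (by positivity) (fun _ => hz1) (Finset.Icc 1 K₀)
      fun k hk => ?_)
    · have : ∀ k ∈ Finset.Icc 1 K₀, (1 / 2 : ℝ) ≤
          (4 * γ * bmin B ^ 2) ^ k / (k : ℝ) ^ (1 / 2 - 1 / 2 : ℝ) := by
        intro k hk
        rw [sub_self, Real.rpow_zero, div_one]
        refine htK.trans ((pow_le_pow_of_le_one (by positivity) ?_ (Finset.mem_Icc.1 hk).2).trans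
          (by gcongr))
        rw [div_le_one (by positivity)]
        nlinarith
      refine le_trans (le_of_eq ?_) (Finset.sum_le_sum this)
      simp
    · exact ⟨(Finset.mem_Icc.1 hk).1,
        le_trans (by exact_mod_cast (Finset.mem_Icc.1 hk).2) hK⟩
  have hlogR : logThreshold N ε δ s₁ s₂ <
      Real.log (1 + Real.exp (1 / 25 - 1 / 6) * RFun (1 / 2) K (4 * γ * bmin B ^ 2)) :=
    lt_log_one_add_of_exp_le (hL.trans (by gcongr))
  rw [Real.log_inv]
  unfold logThreshold at hlogR
  linarith

/-- First `K₀` is taken large against `c / κ`, then `t = 1/(4 K₀)`, so that `(1+t)^(2 K₀) ≤ e^(1/2)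
< 2`. -/
theorem exists_order_and_width (c κ : ℝ) (hκ : 0 < κ) :
    ∃ K₀ : ℕ, 1 ≤ K₀ ∧ c ≤ κ * (K₀ * (1 / 2)) ∧
      ∃ t : ℝ, 0 < t ∧ t ≤ 1 / 4 ∧ 1 / 2 ≤ (1 / (1 + t) ^ 2) ^ K₀ := by
  obtain ⟨n, hn⟩ := exists_nat_ge (2 * c / κ)
  refine ⟨n + 1, by omega, ?_, 1 / (4 * (n + 1 : ℕ)), by positivity, ?_, ?_⟩
  · rw [div_le_iff₀ hκ] at hn
    push_cast
    nlinarith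
  · rw [div_le_div_iff₀ (by positivity) (by norm_num)]
    push_cast
    linarith [Nat.cast_nonneg (α := ℝ) n]
  · set m : ℕ := n + 1
    have hm : (0 : ℝ) < m := by positivity
    rw [div_pow, one_pow, ← pow_mul]
    refine one_div_le_one_div_of_le (by positivity) ?_
    have h1 : (1 + 1 / (4 * (m : ℝ))) ^ (2 * m) ≤ Real.exp (1 / (4 * m)) ^ (2 * m) := by
      gcongr
      linarith [Real.add_one_le_exp (1 / (4 * (m : ℝ)))]
    refine h1.trans ?_
    rw [← Real.exp_nat_mul]
    have e : ((2 * m : ℕ) : ℝ) * (1 / (4 * m)) = 1 / 2 := by push_cast; field_simp; norm_num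
    rw [e]
    have h2 : Real.exp (1 / 2) ^ 2 = Real.exp 1 := by rw [← Real.exp_nat_mul]; norm_num
    have h3 := Real.exp_one_lt_d9
    refine abs_le_of_sq_le_sq' ?_ (by norm_num) |>.2
    rw [h2]
    linarith

/-- Take `u` times the all-ones matrix plus `η` times the identity. Its entries are `1 + t/3` and `1
+ 2t/3` in units of `1/(2N)`, and every eigenvalue is `η` or `Nu + η`, with `Nu + η ≤ 5/8 + 1/12 <
1`. -/
theorem exists_matrix_entries {N : ℕ} (hN : 1 ≤ N) {t : ℝ} (ht0 : 0 < t) (ht : t ≤ 1 / 4) :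
    ∃ B : MatSpace N, ∀ i j, 1 / (2 * N) < B.1 i j ∧ B.1 i j < (1 + t) / (2 * N) := by
  have hN0 : (0 : ℝ) < N := by exact_mod_cast hN
  have hN1 : (1 : ℝ) ≤ N := by exact_mod_cast hN
  set u : ℝ := (1 + t / 3) / (2 * N) with hu
  set η : ℝ := (t / 3) / (2 * N) with hη
  have hu0 : 0 < u := by positivity
  have hη0 : 0 < η := by positivity
  have hη1 : η ≤ 1 / 12 := by
    rw [hη, div_le_iff₀ (by positivity)]; nlinarith
  have huN : N * u ≤ 5 / 8 := by
    rw [hu]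
    have : (N : ℝ) * ((1 + t / 3) / (2 * N)) = (1 + t / 3) / 2 := by field_simp
    rw [this]; linarith
  set M : Matrix (Fin N) (Fin N) ℝ := fun i j => u + if i = j then η else 0 with hM
  have hlow : 1 / (2 * N) < u := by rw [hu]; exact div_lt_div_of_pos_right (by linarith) (by positivity)
  have hupp : u + η < (1 + t) / (2 * N) := by 
    rw [hu, hη, ← add_div]; exact div_lt_div_of_pos_right (by linarith) (by positivity)
  have hent : ∀ i j, 1 / (2 * N) < M i j ∧ M i j < (1 + t) / (2 * N) := by
    intro i j
    simp only [hM]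
    split_ifs <;> constructor <;> linarith
  refine ⟨⟨M, fun i j => lt_trans (by positivity) (hent i j).1, ?_, ?_⟩, hent⟩
  · ext i j
    change M j i = M i j
    simp only [hM, @eq_comm _ j i]
  · intro l hl
    rw [← Matrix.spectrum_toLin', ← Module.End.hasEigenvalue_iff_mem_spectrum] at hl
    obtain ⟨v, hv⟩ := hl.exists_hasEigenvector
    have hev : ∀ i, u * (∑ j, v j) + η * v i = l * v i := by
      intro i
      have := congrFun hv.apply_eq_smul i
      rw [Matrix.toLin'_apply, Matrix.mulVec, dotProduct] at this
      simp only [hM, add_mul, ite_mul, zero_mul, Finset.sum_add_distrib, Finset.sum_ite_eq,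
        Finset.mem_univ, if_true, Pi.smul_apply, smul_eq_mul] at this
      rw [Finset.mul_sum]
      exact this
    -- If the coordinates of `v` sum to zero, the all-ones part kills `v` and `l = η`; otherwise
    -- summing the eigenvalue equation gives `l = Nu + η`.
    by_cases hS : ∑ j, v j = 0
    · obtain ⟨i, hi⟩ := Function.ne_iff.1 hv.2
      have h1 := hev i
      rw [hS, mul_zero, zero_add] at h1
      have : η = l := mul_right_cancel₀ hi h1
      rw [← this]
      exact ⟨hη0, by linarith⟩
    · have h1 : ∑ i, (u * (∑ j, v j) + η * v i) = ∑ i, l * v i :=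
        Finset.sum_congr rfl fun i _ => hev i
      rw [Finset.sum_add_distrib, ← Finset.mul_sum, ← Finset.mul_sum, Finset.sum_const,
        Finset.card_univ, Fintype.card_fin, nsmul_eq_mul, ← mul_assoc, ← add_mul] at h1
      rw [← Finset.mul_sum] at h1
      have : u * N + η = l := mul_right_cancel₀ hS h1
      rw [← this]
      exact ⟨by positivity, by linarith⟩

/-! ### An explicit family of coefficients -/

noncomputable section

/-- The multi-index of size `2k` whose entries are as equal as possible. -/
def balanced (N k : ℕ) (n : Fin N) : ℕ := blockQuot N k + if (n : ℕ) < blockRem N k then 1 else 0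

/-- The coefficient `k^q γ^k / (2k)!`. -/
def growthCoeff (q γ : ℝ) (k : ℕ) : ℝ := natRpow q k * γ ^ k / ((2 * k)! : ℝ)

/-- The coefficients `k^q γ^k / (2k)!`, concentrated on balanced multi-indices. -/
def balancedCoeff (N : ℕ) (K : ℕ∞) (q γ : ℝ) : CoeffSpace N K := fun k I =>
  if I.1 = balanced N k then Real.toNNReal (growthCoeff q γ k) else 0

end

theorem blockQuot_blockRem_spec {N : ℕ} (hN : 1 ≤ N) (k : ℕ) :
    2 * k = N * blockQuot N k + blockRem N k ∧ blockRem N k ≤ N := by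
  rcases Nat.eq_zero_or_pos k with rfl | hk
  · simp [blockQuot, blockRem]
  · have := blockQuot_add_blockRem hN hk
    exact ⟨this.1, this.2.2⟩

theorem range_filter_lt {N r : ℕ} (h : r ≤ N) : (Finset.range N).filter (· < r) = Finset.range r := by
  ext i
  simp only [Finset.mem_filter, Finset.mem_range]
  omega

theorem sum_balanced {N : ℕ} (hN : 1 ≤ N) (k : ℕ) : ∑ n, balanced N k n = 2 * k := by
  obtain ⟨h1, h2⟩ := blockQuot_blockRem_spec hN k
  unfold balanced
  rw [Fin.sum_univ_eq_sum_range (fun i => blockQuot N k + if i < blockRem N k then 1 else 0) N,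
    Finset.sum_add_distrib, ← Finset.sum_filter, range_filter_lt h2]
  simp [← h1]

/-- Exactly `r_k` entries equal `s_k + 1` and the others `s_k`. Balanced coefficients therefore meet
the quadratic condition up to the factor `(c₁^(-1) μ)²`. -/
theorem multiFact_balanced {N : ℕ} (hN : 1 ≤ N) (k : ℕ) :
    multiFact (balanced N k) = minFact N k := by
  obtain ⟨h1, h2⟩ := blockQuot_blockRem_spec hN k
  unfold balanced multiFact minFact
  have h3 : ∀ i : ℕ, (blockQuot N k + if i < blockRem N k then 1 else 0)! =
      (blockQuot N k)! * if i < blockRem N k then blockQuot N k + 1 else 1 := by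
    intro i
    split_ifs
    · rw [Nat.factorial_succ, mul_comm]
    · simp
  simp_rw [h3]
  rw [Fin.prod_univ_eq_prod_range (fun i => (blockQuot N k)! *
      if i < blockRem N k then blockQuot N k + 1 else 1) N, Finset.prod_mul_distrib,
    ← Finset.prod_filter, range_filter_lt h2]
  simp

theorem growthCoeff_pos {q γ : ℝ} (hγ : 0 < γ) (k : ℕ) : 0 < growthCoeff q γ k := by
  have := natRpow_pos q k
  unfold growthCoeff
  positivity

/-- The general `F` covers the sums of `a`, `a² I!` and `a Haf²` at once. -/
theorem sum_balancedCoeff {N : ℕ} (hN : 1 ≤ N) {K : ℕ∞} {q γ : ℝ} (hγ : 0 < γ) (k : Level K)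
    (F : ℝ → (Fin N → ℕ) → ℝ) (hF : ∀ I, F 0 I = 0) :
    ∑ I : MultiIdx N k, F (balancedCoeff N K q γ k I) I.1 =
      F (growthCoeff q γ k) (balanced N k) := by
  rw [Finset.sum_eq_single ⟨balanced N k, Finset.Nat.mem_antidiagonalTuple.2 (sum_balanced hN k)⟩]
  · rw [balancedCoeff, if_pos rfl, Real.coe_toNNReal _ (growthCoeff_pos hγ k).le]
  · intro I _ hI
    have : I.1 ≠ balanced N k := fun h => hI (Subtype.ext h)
    rw [balancedCoeff, if_neg this, NNReal.coe_zero, hF]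
  · exact fun h => absurd (Finset.mem_univ _) h

theorem growthCoeff_mul_hafnian_sq_zero {N : ℕ} (hN : 1 ≤ N) (B : MatSpace N) (q γ : ℝ) :
    growthCoeff q γ 0 * hafnian (expand B.1 (balanced N 0)) ^ 2 = 1 := by
  have h1 := hafnian_sq_le B (sum_balanced hN 0)
  have h2 := le_hafnian_sq hN B (sum_balanced hN 0)
  have h3 : hafnian (expand B.1 (balanced N 0)) ^ 2 = 1 :=
    le_antisymm (by simpa using h1) (by simpa using h2)
  rw [h3]
  simp [growthCoeff, natRpow]

theorem growthCoeff_mul_hafnian_sq_lt {N k : ℕ} (hN : 1 ≤ N) (hk : 1 ≤ k) (B : MatSpace N)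
    {q γ : ℝ} (hγ : 0 < γ) :
    growthCoeff q γ k * hafnian (expand B.1 (balanced N k)) ^ 2 <
      1 / √Real.pi * ((γ * bmax B ^ 2) ^ k / (k : ℝ) ^ (1 / 2 - q)) := by
  have hb := (bmin_pos hN B).trans_le (bmin_le_bmax hN B)
  have hk0 : (0 : ℝ) < k := by exact_mod_cast hk
  have hf : ((2 * k)! : ℝ) ≠ 0 := by exact_mod_cast (Nat.factorial_pos _).ne'
  calc growthCoeff q γ k * hafnian (expand B.1 (balanced N k)) ^ 2
      ≤ growthCoeff q γ k * ((bmax B ^ 2) ^ k * ((2 * k)! * (k.centralBinom / 4 ^ k))) :=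
        mul_le_mul_of_nonneg_left (hafnian_sq_le B (sum_balanced hN k)) (growthCoeff_pos hγ k).le
    _ = (k : ℝ) ^ q * (γ * bmax B ^ 2) ^ k * (k.centralBinom / 4 ^ k) := by
        rw [growthCoeff, natRpow, if_neg (by omega), mul_pow]
        field_simp
    _ < (k : ℝ) ^ q * (γ * bmax B ^ 2) ^ k * (1 / √Real.pi / √(k : ℝ)) := by
        exact mul_lt_mul_of_pos_left (centralBinom_lt hk) (by positivity)
    _ = _ := by rw [div_rpow_half_sub k hk]; ring

theorem lt_growthCoeff_mul_hafnian_sq {N k : ℕ} (hN : 1 ≤ N) (hk : 1 ≤ k) (B : MatSpace N)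
    {q γ : ℝ} (hγ : 0 < γ) :
    1 / √Real.pi * Real.exp (1 / 25 - 1 / 6) * ((γ * bmin B ^ 2) ^ k / (k : ℝ) ^ (1 / 2 - q)) <
      growthCoeff q γ k * hafnian (expand B.1 (balanced N k)) ^ 2 := by
  have hb := bmin_pos hN B
  have hk0 : (0 : ℝ) < k := by exact_mod_cast hk
  have hf : ((2 * k)! : ℝ) ≠ 0 := by exact_mod_cast (Nat.factorial_pos _).ne'
  calc _ = (k : ℝ) ^ q * (γ * bmin B ^ 2) ^ k *
        (1 / √Real.pi * Real.exp (1 / 25 - 1 / 6) / √(k : ℝ)) := by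
        rw [div_rpow_half_sub k hk]; ring
    _ < (k : ℝ) ^ q * (γ * bmin B ^ 2) ^ k * (k.centralBinom / 4 ^ k) := by
        exact mul_lt_mul_of_pos_left (exp_div_sqrt_lt_centralBinom hk) (by positivity)
    _ = growthCoeff q γ k * ((bmin B ^ 2) ^ k * ((2 * k)! * (k.centralBinom / 4 ^ k))) := by
        rw [growthCoeff, natRpow, if_neg (by omega), mul_pow]
        field_simp
    _ ≤ _ :=
        mul_le_mul_of_nonneg_left (le_hafnian_sq hN B (sum_balanced hN k)) (growthCoeff_pos hγ k).le

theorem tsum_level_eq {K : ℕ∞} (f : ℕ → ℝ≥0∞) :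
    ∑' k : Level K, f k = f 0 + ∑' k : {k : ℕ // 1 ≤ k ∧ (k : ℕ∞) ≤ K}, f k := by
  have hd : Disjoint ({0} : Set ℕ) {k : ℕ | 1 ≤ k ∧ (k : ℕ∞) ≤ K} := by
    rw [Set.disjoint_singleton_left]
    rintro ⟨h, -⟩
    omega
  have h := ENNReal.summable.tsum_union_disjoint (f := f) hd ENNReal.summable
  rw [tsum_singleton 0 f] at h
  refine Eq.trans ?_ h
  have hs : ({0} : Set ℕ) ∪ {k : ℕ | 1 ≤ k ∧ (k : ℕ∞) ≤ K} = {k : ℕ | (k : ℕ∞) ≤ K} := by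
    ext k
    simp only [Set.mem_union, Set.mem_singleton_iff, Set.mem_ofPred_eq]
    constructor
    · rintro (rfl | h)
      · simp
      · exact h.2
    · intro h
      rcases Nat.eq_zero_or_pos k with hk | hk
      · exact Or.inl hk
      · exact Or.inr ⟨hk, h⟩
  rw [hs]
  rfl

/-- The constants `c₁` and `c₂` are the hafnian bounds summed against the coefficients `k^q γ^k /
(2k)!`, with `1` from order `0`. The termwise bounds are strict for `k ≥ 1`, and `K ≥ 1` ensures
that such an order exists. -/
theorem mu_balancedCoeff_mem_Ioo {N : ℕ} (hN : 1 ≤ N) {K : ℕ∞} (hK : 1 ≤ K) (B : MatSpace N)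
    {q γ : ℝ} (hγ : 0 < γ) (hB : K = ⊤ → γ * bmax B ^ 2 < 1) :
    (mu B (balancedCoeff N K q γ)).toReal ∈ Set.Ioo (c₁ K q γ B) (c₂ K q γ B) := by
  have hb := bmin_pos hN B
  have hbb := bmin_le_bmax hN B
  set x : ℕ → ℝ := fun k => growthCoeff q γ k * hafnian (expand B.1 (balanced N k)) ^ 2 with hx
  have hx0 : ∀ k, 0 ≤ x k := fun k => mul_nonneg (growthCoeff_pos hγ k).le (sq_nonneg _)
  have hmax := summable_polyLog (1 / 2 - q) (K := K) (z := γ * bmax B ^ 2) (by positivity) hB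
  have hmin := summable_polyLog (1 / 2 - q) (K := K) (z := γ * bmin B ^ 2) (by positivity)
    (fun h => lt_of_le_of_lt (by gcongr) (hB h))
  have hup : ∀ k : {k : ℕ // 1 ≤ k ∧ (k : ℕ∞) ≤ K}, x k <
      1 / √Real.pi * ((γ * bmax B ^ 2) ^ (k : ℕ) / ((k : ℕ) : ℝ) ^ (1 / 2 - q)) :=
    fun k => growthCoeff_mul_hafnian_sq_lt hN k.2.1 B hγ
  have hlo : ∀ k : {k : ℕ // 1 ≤ k ∧ (k : ℕ∞) ≤ K},
      1 / √Real.pi * Real.exp (1 / 25 - 1 / 6) *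
        ((γ * bmin B ^ 2) ^ (k : ℕ) / ((k : ℕ) : ℝ) ^ (1 / 2 - q)) < x k :=
    fun k => lt_growthCoeff_mul_hafnian_sq hN k.2.1 B hγ
  have hsum : Summable fun k : {k : ℕ // 1 ≤ k ∧ (k : ℕ∞) ≤ K} => x k :=
    Summable.of_nonneg_of_le (fun k => hx0 k) (fun k => (hup k).le) (hmax.mul_left _)
  have hX0 : 0 ≤ ∑' k : {k : ℕ // 1 ≤ k ∧ (k : ℕ∞) ≤ K}, x k := tsum_nonneg fun k => hx0 k
  have hmu : mu B (balancedCoeff N K q γ) =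
      ENNReal.ofReal (1 + ∑' k : {k : ℕ // 1 ≤ k ∧ (k : ℕ∞) ≤ K}, x k) := by
    rw [mu]
    simp_rw [ofReal_level_mu]
    have h1 : ∀ k : Level K, ∑ I : MultiIdx N k, (balancedCoeff N K q γ k I : ℝ) *
        hafnian (expand B.1 I.1) ^ 2 = x k := fun k =>
      sum_balancedCoeff hN hγ k (fun y I => y * hafnian (expand B.1 I) ^ 2) fun I => zero_mul _
    simp_rw [h1]
    rw [tsum_level_eq (fun k => ENNReal.ofReal (x k)),
      show x 0 = 1 from growthCoeff_mul_hafnian_sq_zero hN B q γ, ENNReal.ofReal_add zero_le_one hX0,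
      ENNReal.ofReal_tsum_of_nonneg
        (f := fun k : {k : ℕ // 1 ≤ k ∧ (k : ℕ∞) ≤ K} => x k) (fun k => hx0 k) hsum]
  rw [hmu, ENNReal.toReal_ofReal (add_nonneg zero_le_one hX0)]
  have i₀ : {k : ℕ // 1 ≤ k ∧ (k : ℕ∞) ≤ K} := ⟨1, le_rfl, by exact_mod_cast hK⟩
  constructor
  · unfold c₁ polyLog
    rw [← tsum_mul_left]
    exact add_lt_add_right
      (Summable.tsum_lt_tsum (i := i₀) (fun k => (hlo k).le) (hlo i₀) (hmin.mul_left _) hsum) 1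
  · unfold c₂ polyLog
    rw [← tsum_mul_left]
    exact add_lt_add_right
      (Summable.tsum_lt_tsum (i := i₀) (fun k => (hup k).le) (hup i₀) hsum (hmax.mul_left _)) 1

/-! ### The strict conditions and their openness -/

/-- The points whose matrix entries lie strictly between `lo` and `hi` and whose coefficients
satisfy the strict versions of the conditions. -/
def strictSet (N : ℕ) (K : ℕ∞) (γ q lo hi : ℝ) : Set (CoeffSpace N K × MatSpace N) :=
  {x | (∀ i j, lo < x.2.1 i j ∧ x.2.1 i j < hi) ∧
    (c₂ K q γ x.2)⁻¹ * (mu x.2 x.1).toReal < coeffZero x.1 ∧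
    coeffZero x.1 < (c₁ K q γ x.2)⁻¹ * (mu x.2 x.1).toReal ∧
    ∀ k : Level K, 1 ≤ k.1 →
      (c₂ K q γ x.2)⁻¹ * (mu x.2 x.1).toReal * ((k.1 : ℝ) ^ q * γ ^ k.1 / ((2 * k.1)! : ℝ)) <
        ∑ I : MultiIdx N k, (x.1 k I : ℝ) ∧
      ∑ I : MultiIdx N k, (x.1 k I : ℝ) <
        (c₁ K q γ x.2)⁻¹ * (mu x.2 x.1).toReal * ((k.1 : ℝ) ^ q * γ ^ k.1 / ((2 * k.1)! : ℝ)) ∧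
      ∑ I : MultiIdx N k, (x.1 k I : ℝ) ^ 2 * (multiFact I.1 : ℝ) <
        (c₁ K q γ x.2)⁻¹ ^ 2 * (mu x.2 x.1).toReal ^ 2 *
        ((k.1 : ℝ) ^ (2 * q) * γ ^ (2 * k.1) / ((2 * k.1)! : ℝ) ^ 2) * (minFact N k.1 : ℝ)}

theorem coeffCond_of_mem_strictSet {N : ℕ} {K : ℕ∞} {γ q lo hi : ℝ} (hγ : 0 < γ)
    {x : CoeffSpace N K × MatSpace N} (hx : x ∈ strictSet N K γ q lo hi) :
    CoeffCond γ γ q q x.2 x.1 := by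
  obtain ⟨-, h1, h2, h3⟩ := hx
  refine ⟨?_, h1, h2, fun k hk => (h3 k hk).1.le, fun k hk => (h3 k hk).2.1.le,
    fun k hk => (h3 k hk).2.2.le⟩
  have hc := one_le_c₂ K q hγ x.2
  refine ⟨⟨0, by simp⟩, ⟨0, by simp [Finset.Nat.mem_antidiagonalTuple]⟩, fun h => ?_⟩
  have h0 : coeffZero x.1 = 0 := by
    unfold coeffZero
    rw [h, NNReal.coe_zero]
  rw [h0] at h1
  have : 0 ≤ (c₂ K q γ x.2)⁻¹ * (mu x.2 x.1).toReal := by positivity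
  linarith

/-- Everything reduces to `c₂^(-1) μ < 1 < c₁^(-1) μ`: the conditions are these inequalities, or the
square of the second one, multiplied by positive numbers. -/
theorem balancedCoeff_mem_strictSet {N : ℕ} (hN : 1 ≤ N) {K : ℕ∞} (hK : 1 ≤ K) (B : MatSpace N)
    {q γ lo hi : ℝ} (hγ : 0 < γ) (hB : K = ⊤ → γ * bmax B ^ 2 < 1)
    (hent : ∀ i j, lo < B.1 i j ∧ B.1 i j < hi) :
    (balancedCoeff N K q γ, B) ∈ strictSet N K γ q lo hi := by
  obtain ⟨hm1, hm2⟩ := mu_balancedCoeff_mem_Ioo hN hK B (q := q) hγ hB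
  set m := (mu B (balancedCoeff N K q γ)).toReal with hm
  have hc1 := one_le_c₁ K q hγ B
  have hc2 := one_le_c₂ K q hγ B
  have hlt1 : (c₂ K q γ B)⁻¹ * m < 1 := by
    rw [inv_mul_lt_iff₀ (by linarith)]; linarith
  have hlt2 : 1 < (c₁ K q γ B)⁻¹ * m := by
    rw [lt_inv_mul_iff₀ (by linarith)]; linarith
  have hsum : ∀ k : Level K, ∑ I : MultiIdx N k, (balancedCoeff N K q γ k I : ℝ) =
      growthCoeff q γ k := fun k => sum_balancedCoeff hN hγ k (fun y _ => y) fun _ => rfl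
  have hzero : coeffZero (balancedCoeff N K q γ) = 1 := by
    rw [← sum_level_zero _ (k := ⟨0, by simp⟩) rfl, hsum]
    simp [growthCoeff, natRpow]
  refine ⟨hent, ?_, ?_, fun k hk => ?_⟩
  · rw [hzero]; exact hlt1
  · rw [hzero]; exact hlt2
  · have hk0 : (0 : ℝ) < k.1 := by exact_mod_cast hk
    have hg : (k.1 : ℝ) ^ q * γ ^ k.1 / ((2 * k.1)! : ℝ) = growthCoeff q γ k.1 := by
      rw [growthCoeff, natRpow, if_neg (by omega)]
    have hg0 := growthCoeff_pos (q := q) hγ k.1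
    have hg2 : (k.1 : ℝ) ^ (2 * q) * γ ^ (2 * k.1) / ((2 * k.1)! : ℝ) ^ 2 = growthCoeff q γ k.1 ^ 2 := by
      rw [← hg, div_pow, mul_pow, ← Real.rpow_natCast ((k.1 : ℝ) ^ q), ← Real.rpow_mul hk0.le,
        ← pow_mul, mul_comm q, mul_comm k.1 2]
      norm_num
    have hsq : ∑ I : MultiIdx N k, (balancedCoeff N K q γ k I : ℝ) ^ 2 * (multiFact I.1 : ℝ) =
        growthCoeff q γ k.1 ^ 2 * minFact N k.1 := by
      rw [sum_balancedCoeff hN hγ k (fun y I => y ^ 2 * (multiFact I : ℝ)) (fun I => by simp),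
        multiFact_balanced hN]
    have hmf : (0 : ℝ) < minFact N k.1 := by
      rw [← multiFact_balanced hN]
      exact_mod_cast multiFact_pos _
    dsimp only
    rw [hsum, hg, hsq, hg2, ← hm]
    refine ⟨mul_lt_of_lt_one_left hg0 hlt1, lt_mul_of_one_lt_left hg0 hlt2, ?_⟩
    rw [← mul_pow, mul_assoc]
    exact lt_mul_of_one_lt_left (by positivity) (one_lt_pow₀ hlt2 two_ne_zero)

theorem continuous_entry {N : ℕ} (i j : Fin N) : Continuous fun B : MatSpace N => B.1 i j :=
  (continuous_apply j).comp ((continuous_apply i).comp continuous_subtype_val)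

theorem continuous_bmin {N : ℕ} (hN : 1 ≤ N) : Continuous (bmin : MatSpace N → ℝ) := by
  have : Nonempty (Fin N) := ⟨⟨0, hN⟩⟩
  unfold bmin
  simp_rw [← Finset.inf'_univ_eq_ciInf]
  exact Continuous.finset_inf'_apply _ fun p _ => continuous_entry p.1 p.2

theorem continuous_bmax {N : ℕ} (hN : 1 ≤ N) : Continuous (bmax : MatSpace N → ℝ) := by
  have : Nonempty (Fin N) := ⟨⟨0, hN⟩⟩
  unfold bmax
  simp_rw [← Finset.sup'_univ_eq_ciSup]
  exact Continuous.finset_sup'_apply _ fun p _ => (continuous_entry p.1 p.2).abs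

theorem continuous_polyLog (s : ℝ) {K : ℕ∞} (hK : K ≠ ⊤) : Continuous (polyLog s K) := by
  lift K to ℕ using hK
  have : polyLog s (K : ℕ∞) = fun z => ∑ k ∈ Finset.Icc 1 K, z ^ k / (k : ℝ) ^ s :=
    funext fun z => polyLog_natCast s K z
  rw [this]
  fun_prop

theorem continuous_c₁ {N : ℕ} (hN : 1 ≤ N) {K : ℕ∞} (hK : K ≠ ⊤) (q γ : ℝ) :
    Continuous (c₁ K q γ : MatSpace N → ℝ) := by
  have h1 := continuous_polyLog (1 / 2 - q) hK
  have h2 := continuous_bmin hN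
  unfold c₁
  fun_prop

theorem continuous_c₂ {N : ℕ} (hN : 1 ≤ N) {K : ℕ∞} (hK : K ≠ ⊤) (q γ : ℝ) :
    Continuous (c₂ K q γ : MatSpace N → ℝ) := by
  have h1 := continuous_polyLog (1 / 2 - q) hK
  have h2 := continuous_bmax hN
  unfold c₂
  fun_prop

theorem continuous_hafnian_expand {N : ℕ} (I : Fin N → ℕ) :
    Continuous fun B : MatSpace N => hafnian (expand B.1 I) := by
  unfold hafnian expand
  refine continuous_const.mul (continuous_finsetSum _ fun e _ => continuous_finsetProd _ fun j _ => ?_)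
  exact continuous_entry _ _

theorem continuous_coeff {N : ℕ} {K : ℕ∞} (k : Level K) (I : MultiIdx N k) :
    Continuous fun x : CoeffSpace N K × MatSpace N => (x.1 k I : ℝ) :=
  NNReal.continuous_coe.comp
    ((continuous_apply I).comp ((continuous_apply k).comp continuous_fst))

theorem continuous_mu {N : ℕ} {K : ℕ∞} (hK : K ≠ ⊤) :
    Continuous fun x : CoeffSpace N K × MatSpace N => (mu x.2 x.1).toReal := by
  have := finite_level hK
  have := Fintype.ofFinite (Level K)
  have h : ∀ x : CoeffSpace N K × MatSpace N, (mu x.2 x.1).toReal =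
      ∑ k : Level K, ∑ I : MultiIdx N k, (x.1 k I : ℝ) * hafnian (expand x.2.1 I.1) ^ 2 := by
    intro x
    rw [mu, tsum_fintype]
    simp_rw [ofReal_level_mu]
    rw [← ENNReal.ofReal_sum_of_nonneg fun k _ => Finset.sum_nonneg fun I _ => by positivity,
      ENNReal.toReal_ofReal (Finset.sum_nonneg fun k _ => Finset.sum_nonneg fun I _ => by positivity)]
  simp_rw [h]
  refine continuous_finsetSum _ fun k _ => continuous_finsetSum _ fun I _ => ?_
  exact (continuous_coeff k I).mul (((continuous_hafnian_expand I.1).comp continuous_snd).pow 2)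

/-- For finite `K`, `μ` and the polylogarithms are finite sums, so the set is cut out by finitely
many strict inequalities between continuous functions. -/
theorem isOpen_strictSet {N : ℕ} (hN : 1 ≤ N) {K : ℕ∞} (hK : K ≠ ⊤) {γ : ℝ} (hγ : 0 < γ)
    (q lo hi : ℝ) : IsOpen (strictSet N K γ q lo hi) := by
  have := finite_level hK
  have hmu := continuous_mu (N := N) hK
  have hc1 : Continuous fun x : CoeffSpace N K × MatSpace N => (c₁ K q γ x.2)⁻¹ :=
    ((continuous_c₁ hN hK q γ).comp continuous_snd).inv₀ fun x =>
      (lt_of_lt_of_le one_pos (one_le_c₁ K q hγ x.2)).ne'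
  have hc2 : Continuous fun x : CoeffSpace N K × MatSpace N => (c₂ K q γ x.2)⁻¹ :=
    ((continuous_c₂ hN hK q γ).comp continuous_snd).inv₀ fun x =>
      (lt_of_lt_of_le one_pos (one_le_c₂ K q hγ x.2)).ne'
  have h0 : Continuous fun x : CoeffSpace N K × MatSpace N => coeffZero x.1 := continuous_coeff _ _
  have hent : ∀ i j, Continuous fun x : CoeffSpace N K × MatSpace N => x.2.1 i j :=
    fun i j => (continuous_entry i j).comp continuous_snd
  have hs : ∀ k : Level K, Continuous fun x : CoeffSpace N K × MatSpace N =>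
      ∑ I : MultiIdx N k, (x.1 k I : ℝ) :=
    fun k => continuous_finsetSum _ fun I _ => continuous_coeff k I
  have hsq : ∀ k : Level K, Continuous fun x : CoeffSpace N K × MatSpace N =>
      ∑ I : MultiIdx N k, (x.1 k I : ℝ) ^ 2 * (multiFact I.1 : ℝ) :=
    fun k => continuous_finsetSum _ fun I _ => ((continuous_coeff k I).pow 2).mul continuous_const
  have hlt : ∀ {f g : CoeffSpace N K × MatSpace N → ℝ}, Continuous f → Continuous g → ∀ x,
      f x < g x → ∀ᶠ y in nhds x, f y < g y :=
    fun hf hg x h => hf.continuousAt.eventually_lt hg.continuousAt h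
  refine isOpen_iff_eventually.2 fun x hx => ?_
  obtain ⟨h1, h2, h3, h4⟩ := hx
  refine (Filter.eventually_all.2 fun i => Filter.eventually_all.2 fun j =>
    (hlt continuous_const (hent i j) x (h1 i j).1).and
      (hlt (hent i j) continuous_const x (h1 i j).2)).and
    ((hlt (hc2.mul hmu) h0 x h2).and ((hlt h0 (hc1.mul hmu) x h3).and ?_))
  refine Filter.eventually_all.2 fun k => Filter.eventually_imp_distrib_left.2 fun hk => ?_
  obtain ⟨h5, h6, h7⟩ := h4 k hk
  exact (hlt ((hc2.mul hmu).mul continuous_const) (hs k) x h5).and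
    ((hlt (hs k) ((hc1.mul hmu).mul continuous_const) x h6).and
      (hlt (hsq k) ((((hc1.pow 2).mul (hmu.pow 2)).mul continuous_const).mul continuous_const) x h7))

/-- Admissible problems exist for all large `K`, in an open set if `K` is finite. -/
theorem exists_admissible {N : ℕ} (hN : 1 ≤ N) {ε δ s₁ s₂ : ℝ} (hε : 0 < ε) (hδ : 0 < δ)
    (hs₁ : 0 < s₁) (hs₂ : 0 < s₂) :
    ∃ K₀ : ℕ, ∀ K : ℕ∞, (K₀ : ℕ∞) ≤ K → ∃ γα γβ qα qβ : ℝ, 0 < γα ∧ 0 < γβ ∧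
      ∃ W : Set (ProblemSpace N K), (K ≠ ⊤ → IsOpen W) ∧ W.Nonempty ∧
        ∀ x ∈ W, x.1.2 ∈ matSetαβ N K ε δ s₁ s₂ γα γβ qα qβ ∧
          CoeffCond γα γβ qα qβ x.1.2 x.1.1 := by
  have hN0 : (0 : ℝ) < N := by exact_mod_cast hN
  have hpi : 0 < √Real.pi := Real.sqrt_pos.2 Real.pi_pos
  obtain ⟨K₀, hK₀, hc, t, ht0, ht, htK⟩ := exists_order_and_width
    (Real.exp (logThreshold N ε δ s₁ s₂)) (Real.exp (1 / 25 - 1 / 6) *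
      ((2 : ℝ) ^ (-(1 / 2 : ℝ)) * (1 / (2 * √Real.pi)))) (by positivity)
  rw [mul_assoc] at hc
  refine ⟨K₀, fun K hK => ?_⟩
  have hK1 : 1 ≤ K := le_trans (by exact_mod_cast hK₀) hK
  have hγ : (0 : ℝ) < N ^ 2 / (1 + t) ^ 2 := by positivity
  have hadm : ∀ B : MatSpace N, (∀ i j, 1 / (2 * N) < B.1 i j ∧ B.1 i j < (1 + t) / (2 * N)) →
      B ∈ matSetαβ N K ε δ s₁ s₂ (N ^ 2 / (1 + t) ^ 2) (N ^ 2 / (1 + t) ^ 2) (1 / 2) (1 / 2) :=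
    mem_matSetαβ_of_entries hN hε hδ hs₁ hK₀ ht0 ht htK hc hK
  obtain ⟨B, hB⟩ := exists_matrix_entries hN ht0 ht
  refine ⟨N ^ 2 / (1 + t) ^ 2, N ^ 2 / (1 + t) ^ 2, 1 / 2, 1 / 2, hγ, hγ,
    Subtype.val ⁻¹' strictSet N K (N ^ 2 / (1 + t) ^ 2) (1 / 2) (1 / (2 * N)) ((1 + t) / (2 * N)),
    fun hK' => (isOpen_strictSet hN hK' hγ _ _ _).preimage continuous_subtype_val, ?_,
    fun x hx => ⟨hadm _ hx.1, coeffCond_of_mem_strictSet hγ hx⟩⟩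
  have hmem := balancedCoeff_mem_strictSet hN hK1 B (q := 1 / 2) hγ (fun h => by
    have h1 := ((hadm B hB).2.2.2 h).1
    have h2 : 0 ≤ (N : ℝ) ^ 2 / (1 + t) ^ 2 * bmax B ^ 2 := by positivity
    linarith) hB
  -- That this point belongs to the problem space is itself part of the conclusion of the separation
  -- theorem.
  exact ⟨⟨(balancedCoeff N K (1 / 2) (N ^ 2 / (1 + t) ^ 2), B),
    (exponential_separation hN hε hδ hs₁ hs₂ hγ hγ (hadm B hB)
      (coeffCond_of_mem_strictSet hγ hmem)).1⟩, hmem⟩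

end GBS

theorem theorem5 (N : ℕ) (hN : 1 ≤ N) (ε δ s₁ s₂ : ℝ) (hε : 0 < ε) (hε1 : ε < 1) (hδ : 0 < δ)
    (hδ1 : δ < 1) (hs₁ : 0 < s₁) (hs₂ : 0 < s₂) :
    (∀ (K : ℕ∞) (γα γβ qα qβ : ℝ), 0 < γα → 0 < γβ →
      ∀ B ∈ GBS.matSetαβ N K ε δ s₁ s₂ γα γβ qα qβ,
      ∀ a : GBS.CoeffSpace N K, GBS.CoeffCond γα γβ qα qβ B a →
        a ∈ GBS.coeffSet B ∧
        GBS.nGBS ε δ B a < ∞ ∧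
        ENNReal.ofReal (s₂ * Real.exp (s₁ * (GBS.nGBS ε δ B a).toReal)) < GBS.nMC ε δ B a ∧
        GBS.nMC ε δ B a < ∞) ∧
    (∃ K₀ : ℕ, ∀ K : ℕ∞, (K₀ : ℕ∞) ≤ K →
      ∃ γα γβ qα qβ : ℝ, 0 < γα ∧ 0 < γβ ∧
      ∃ W : Set (GBS.ProblemSpace N K), (K ≠ ⊤ → IsOpen W) ∧ W.Nonempty ∧
        ∀ x ∈ W, x.1.2 ∈ GBS.matSetαβ N K ε δ s₁ s₂ γα γβ qα qβ ∧
          GBS.CoeffCond γα γβ qα qβ x.1.2 x.1.1) :=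
  ⟨fun _ _ _ _ _ hα hβ _ hB _ ha => GBS.exponential_separation hN hε hδ hs₁ hs₂ hα hβ hB ha,
    GBS.exists_admissible hN hε hδ hs₁ hs₂⟩
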